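/- Let $m$ be fixed. For each $N\ge 1$ let $\Lambda=\Lambda_N=(\lambda_1,\dots,\lambda_N)^\top\in\mathbb R^{N\times m}$ and $A=A_N\in\mathbb R^{N\times N}$ be deterministic, put $\Sigma_\epsilon=AA^\top$, and let the observations be $y_t=\Lambda f_t+\epsilon_t\in\mathbb R^N$, $t=1,\dots,T$. Assume the following. (1) $(f_t^\top,\epsilon_t^\top)^\top=\xi_t\begin{pmatrix}I_m&0\\0&A\end{pmatrix}g_t/\|g_t\|_2$, where the pairs $(\xi_t,g_t)$ are independent over $t$, $\xi_t$ is independent of $g_t$, $g_t\sim\mathcal N(0,I_{m+N})$, and the $\xi_t$ are distributed as a scalar random variable $\xi=\xi^{(N)}$ with $P(\xi=0)=0$ and $\xi/\sqrt N=O_p(1)$ as $N\to\infty$. Moreover the largest diagonal entry of $\Sigma_0=\operatorname{diag}(I_m,\Sigma_\epsilon)$ is $1$. (2) $\|\lambda_i\|_2$ is bounded uniformly in $i\le N$ and $N$, and $\Lambda^\top\Lambda/N\to V$ as $N\to\infty$, where $V$ is positive definite with distinct eigenvalues. (3) There are constants $c_1,c_2>0$, not depending on $N$, such that all eigenvalues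 of $\Sigma_\epsilon$ lie in $[c_2,c_1]$. Let $\widehat K_y=\frac{2}{T(T-1)}\sum_{t<s}\frac{(y_t-y_s)(y_t-y_s)^\top}{\|y_t-y_s\|_2^2}$ be the sample spatial Kendall's tau matrix, let $\widehat V$ be the diagonal matrix of its $m$ largest eigenvalues in descending order, and let the robust two-step (RTS) loading estimator $\widetilde\Lambda=(\tilde\lambda_1,\dots,\tilde\lambda_N)^\top\in\mathbb R^{N\times m}$ be $\sqrt N$ times any choice of corresponding orthonormal eigenvectors, that is, $\widetilde\Lambda^\top\widetilde\Lambda=N I_m$ and $\widehat K_y\widetilde\Lambda=\widetilde\Lambda\widehat V$. Put $$\widehat H=M_1\Lambda^\top\widetilde\Lambda\widehat V^{-1},\qquad M_1=\frac{2}{T(T-1)}\sum_{t<s}\frac{(f_t-f_s)(f_t-f_s)^\top}{\|y_t-y_s\|_2^2}$$ (with $\widehat V^{-1}$ replaced by $0$ where $\widehat V$ is singular). Then, as $N,T\to\infty$, $\widehat H^\top V\widehat H\to I_m$ in probability and $$\max_{1\le i\le N}\big\|\tilde\lambda_i-\widehat H^\top\lambda_i\big\|_2=O_p\big(N^{-1/2}\big)+O_p\big((N/T)^{1/2}\big).$$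 -/

import Mathlib

open MeasureTheory ProbabilityTheory Filter Topology Matrix

noncomputable section

namespace RTS

/-- The Euclidean norm of a plain coordinate vector. -/
def l2norm {ι : Type*} [Fintype ι] (v : ι → ℝ) : ℝ := ‖WithLp.toLp 2 v‖

/-- `X i = O_p(a i)` along the filter `l`: for every `δ > 0` there is a constant `C` such that
eventually `P(|X i| > C * a i) ≤ δ`. -/
def IsBigOp {Ω ι : Type*} [MeasurableSpace Ω] (P : Measure Ω) (l : Filter ι)
    (X : ι → Ω → ℝ) (a : ι → ℝ) : Prop :=
  ∀ δ : ℝ, 0 < δ → ∃ C : ℝ, ∀ᶠ i in l, P {ω | C * a i < |X i ω|} ≤ ENNReal.ofReal δ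

/-- The `j`-th largest eigenvalue (`j = 0, 1, …`, counted with multiplicity) of a symmetric
matrix; `0` beyond the size of the matrix. -/
def descEig {N : ℕ} {K : Matrix (Fin N) (Fin N) ℝ} (hK : K.IsHermitian) (j : ℕ) : ℝ :=
  if h : j < Fintype.card (Fin N) then hK.eigenvalues₀ ⟨j, h⟩ else 0

/-- `(2 / (T (T - 1))) ∑_{t < s} (a_t - a_s) (b_t - b_s)ᵀ / ‖y_t - y_s‖²` over the sample
points `t, s ∈ {0, …, T - 1}`. -/
def pairAverage {N p q : ℕ} (T : ℕ) (y : ℕ → Fin N → ℝ) (a : ℕ → Fin p → ℝ)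
    (b : ℕ → Fin q → ℝ) : Matrix (Fin p) (Fin q) ℝ :=
  (2 / ((T : ℝ) * ((T : ℝ) - 1))) •
    ∑ s ∈ Finset.range T, ∑ t ∈ Finset.range s,
      (l2norm (y t - y s) ^ 2)⁻¹ • vecMulVec (a t - a s) (b t - b s)

/-- The sample spatial Kendall's tau matrix of `y_0, …, y_{T-1}`. -/
def kendall {N : ℕ} (T : ℕ) (y : ℕ → Fin N → ℝ) : Matrix (Fin N) (Fin N) ℝ :=
  pairAverage T y y y

theorem kendall_isHermitian {N : ℕ} (T : ℕ) (y : ℕ → Fin N → ℝ) :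
    (kendall T y).IsHermitian := by
  ext i j
  simp [kendall, pairAverage, Matrix.sum_apply, vecMulVec_apply, mul_comm]

theorem scatter_isHermitian {N : ℕ} (A : Matrix (Fin N) (Fin N) ℝ) :
    (A * Aᵀ).IsHermitian := by
  simpa using Matrix.isHermitian_mul_conjTranspose_self A

/-- The diagonal matrix of the `m` largest eigenvalues of the sample Kendall's tau matrix. -/
def eigMatrix {N : ℕ} (m T : ℕ) (y : ℕ → Fin N → ℝ) : Matrix (Fin m) (Fin m) ℝ :=
  diagonal fun j => descEig (kendall_isHermitian T y) j

/-- `L` is a robust two-step loading estimate: its columns are `√N` times orthonormal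
eigenvectors of the sample Kendall's tau matrix, belonging to the `m` largest eigenvalues in
descending order. -/
def IsRTSLoading {N m : ℕ} (T : ℕ) (y : ℕ → Fin N → ℝ) (L : Matrix (Fin N) (Fin m) ℝ) : Prop :=
  Lᵀ * L = (N : ℝ) • (1 : Matrix (Fin m) (Fin m) ℝ) ∧ kendall T y * L = L * eigMatrix m T y

/-- The rotation matrix `Ĥ = M₁ Λᵀ Λ̃ V̂⁻¹`, with
`M₁ = (2 / (T (T - 1))) ∑_{t < s} (f_t - f_s) (f_t - f_s)ᵀ / ‖y_t - y_s‖²`. -/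
def rotation {N m : ℕ} (T : ℕ) (Λ : Matrix (Fin N) (Fin m) ℝ) (f : ℕ → Fin m → ℝ)
    (y : ℕ → Fin N → ℝ) (L : Matrix (Fin N) (Fin m) ℝ) : Matrix (Fin m) (Fin m) ℝ :=
  pairAverage T y f f * Λᵀ * L * (eigMatrix m T y)⁻¹

/-- `max_i ‖λ̃_i - Hᵀ λ_i‖₂`, where `λ̃_i`, `λ_i` are the rows of `L`, `Λ`. -/
def maxError {N m : ℕ} (L Λ : Matrix (Fin N) (Fin m) ℝ) (H : Matrix (Fin m) (Fin m) ℝ) : ℝ :=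
  ⨆ i : Fin N, l2norm (L i - Hᵀ *ᵥ Λ i)

/-- The stacked scatter matrix `diag(I_m, A Aᵀ)` of factors and idiosyncratic errors. -/
def scatter (m : ℕ) {N : ℕ} (A : Matrix (Fin N) (Fin N) ℝ) :
    Matrix (Fin m ⊕ Fin N) (Fin m ⊕ Fin N) ℝ :=
  fromBlocks 1 0 0 (A * Aᵀ)

/-- The factor model with jointly elliptical factors and errors, for each cross-sectional
dimension `N`. For fixed `N` the sample is indexed by `t = 0, 1, 2, …`; nothing is assumed on the
joint law of the samples for different `N`. -/
structure EllipticalFactorModel {Ω : Type*} [MeasurableSpace Ω] (P : Measure Ω) (m : ℕ)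
    (Λ : (N : ℕ) → Matrix (Fin N) (Fin m) ℝ) (A : (N : ℕ) → Matrix (Fin N) (Fin N) ℝ)
    (ξ : ℕ → ℕ → Ω → ℝ) (g : (N : ℕ) → ℕ → Ω → Fin m ⊕ Fin N → ℝ)
    (f : (N : ℕ) → ℕ → Ω → Fin m → ℝ) (e y : (N : ℕ) → ℕ → Ω → Fin N → ℝ) : Prop where
  measurable_radius : ∀ N t, Measurable (ξ N t)
  measurable_gaussian : ∀ N t, Measurable (g N t)
  /-- The pairs `(ξ_t, g_t)` are independent over `t`. -/
  indep_time : ∀ N, iIndepFun (fun t ω => (ξ N t ω, g N t ω)) P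
  indep_radius : ∀ N t, IndepFun (ξ N t) (g N t) P
  identDistrib_radius : ∀ N t, IdentDistrib (ξ N t) (ξ N 0) P P
  gaussian_law : ∀ N t, P.map (g N t) = Measure.pi fun _ => gaussianReal 0 1
  /-- The radius does not vanish, so that Kendall's tau is well defined almost surely. -/
  radius_ne_zero : ∀ N, 1 ≤ N → ∀ᵐ ω ∂P, ξ N 0 ω ≠ 0
  /-- `ξ / √N = O_p(1)` as `N → ∞`. -/
  radius_bounded : IsBigOp P atTop (fun N ω => ξ N 0 ω / √(N : ℝ)) fun _ => 1
  /-- `(fᵀ, eᵀ)ᵀ = ξ diag(I_m, A) g / ‖g‖`. -/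
  representation : ∀ N t ω, Sum.elim (f N t ω) (e N t ω) =
    ξ N t ω • (fromBlocks (1 : Matrix (Fin m) (Fin m) ℝ) 0 0 (A N) *ᵥ
      ((l2norm (g N t ω))⁻¹ • g N t ω))
  observation : ∀ N t ω, y N t ω = Λ N *ᵥ f N t ω + e N t ω
  /-- `‖diag(Σ₀)‖_∞ = 1` (the norm on a function type is the sup norm). -/
  identifiable : ∀ N, 1 ≤ N → ‖fun j => scatter m (A N) j j‖ = 1

/-- Bounded loadings, and `Λᵀ Λ / N → V` with `V` positive definite with distinct eigenvalues. -/
structure LoadingAssumption {m : ℕ} (Λ : (N : ℕ) → Matrix (Fin N) (Fin m) ℝ)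
    (V : Matrix (Fin m) (Fin m) ℝ) : Prop where
  bounded : ∃ C : ℝ, ∀ N i, l2norm (Λ N i) ≤ C
  limit : Tendsto (fun N : ℕ => (N : ℝ)⁻¹ • ((Λ N)ᵀ * Λ N)) atTop (𝓝 V)
  posDef : V.PosDef
  distinct : StrictAnti posDef.isHermitian.eigenvalues₀
  eigenvalue_bounds : ∃ c₁ c₂ : ℝ, 0 < c₁ ∧ 0 < c₂ ∧
    ∀ j, c₂ ≤ posDef.isHermitian.eigenvalues₀ j ∧ posDef.isHermitian.eigenvalues₀ j ≤ c₁

/-- The eigenvalues of `Σ_ε = A Aᵀ` are bounded above and away from zero, uniformly in `N`. -/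
def NoiseAssumption (A : (N : ℕ) → Matrix (Fin N) (Fin N) ℝ) : Prop :=
  ∃ c₁ c₂ : ℝ, 0 < c₁ ∧ 0 < c₂ ∧ ∀ N i,
    c₂ ≤ (scatter_isHermitian (A N)).eigenvalues i ∧
      (scatter_isHermitian (A N)).eigenvalues i ≤ c₁

end RTS

end

/-
Put `D = K̂_y - Λ M₁ Λᵀ`, what remains of Kendall's tau after its common part is removed. Then
`K̂_y Λ̃ = Λ̃ V̂` gives `Λ̃ - Λ Ĥ = D Λ̃ V̂⁻¹`, and everything follows from two facts: the `m`
leading eigenvalues of `K̂_y` stay away from zero, and `‖D‖ ≤ O(1 / N) + O_p(T^(-1/2))`. Moreover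
`Λ̃ᵀ Λ̃ = N I` turns the bound on `Λ̃ - Λ Ĥ` into `Ĥᵀ V Ĥ → I`.

`K̂_y` and `D` are U-statistics in the pairs `(ξ_t, g_t)`, whose kernels do not change when their
argument is scaled. As `g` has the rotation-invariant Gaussian law, `ξ_t g_t / ‖g_t‖ -
ξ_s g_s / ‖g_s‖` has, up to a random scale, again this law, so that no assumption on the tails of
`ξ` is needed. The variance of a U-statistic of order two is `O(1 / T)`.

For the mean of `D`, write a Gaussian observation as `y = Λ h + A k`. The cross terms
`Λ h (A k)ᵀ` change sign under `k ↦ -k`, so only the asymmetry of `1 / ‖y‖²` under this reflection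
contributes to their mean. That contribution and the mean of the idiosyncratic term
`A k (A k)ᵀ / ‖y‖²` are `O(1 / N)`, because `A Aᵀ` is bounded below and hence the negative moments
`E ‖y‖^(-2p)` are `O(N^(-p))`.
-/

noncomputable section

namespace RTS

section RotationInvariance

variable {E : Type*} [NormedAddCommGroup E] [InnerProductSpace ℝ E] [MeasurableSpace E]

/-- A measure on a Euclidean space that is preserved by every linear isometry of the space. On the
unit sphere this characterises the uniform distribution. -/
def IsRotationInvariant (μ : Measure E) : Prop :=
  ∀ O : E ≃ₗᵢ[ℝ] E, MeasurePreserving O μ μ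

theorem IsRotationInvariant.map [BorelSpace E] {μ : Measure E} (hμ : IsRotationInvariant μ)
    {F : E → E} (hF : Measurable F) (hcomm : ∀ (O : E ≃ₗᵢ[ℝ] E) x, F (O x) = O (F x)) :
    IsRotationInvariant (μ.map F) := fun O => by
  refine ⟨O.continuous.measurable, ?_⟩
  have hO : F ∘ O = O ∘ F := funext (hcomm O)
  rw [Measure.map_map O.continuous.measurable hF, ← hO,
    ← Measure.map_map hF O.continuous.measurable, (hμ O).map_eq]

theorem IsRotationInvariant.charFun_eq_of_norm_eq {μ : Measure E} (hμ : IsRotationInvariant μ)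
    [BorelSpace E] {s t : E} (h : ‖s‖ = ‖t‖) : charFun μ s = charFun μ t := by
  set O : E ≃ₗᵢ[ℝ] E := Submodule.reflection (ℝ ∙ (s - t))ᗮ
  have hO : O s = t := Submodule.reflection_sub h
  rw [← hO, charFun_apply, charFun_apply, eq_comm,
    ← (hμ O).integral_comp O.toHomeomorph.measurableEmbedding]
  simp only [LinearIsometryEquiv.inner_map_map]

theorem IsRotationInvariant.charFun_eq_integral {μ ν : Measure E} [BorelSpace E]
    [IsProbabilityMeasure ν] (hμ : IsRotationInvariant μ) (hν : ∀ᵐ x ∂ν, ‖x‖ = 1) (t : E) :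
    charFun μ t = ∫ y, charFun μ (‖t‖ • y) ∂ν := by
  have h : ∀ᵐ y ∂ν, charFun μ (‖t‖ • y) = charFun μ t := by
    filter_upwards [hν] with y hy
    exact hμ.charFun_eq_of_norm_eq (by rw [norm_smul, hy, norm_norm, mul_one])
  rw [integral_congr_ae h, integral_const, probReal_univ, one_smul]

-- Averaging either characteristic function over the other sphere gives the same double integral.
theorem IsRotationInvariant.eq_of_norm_eq_one [BorelSpace E] [FiniteDimensional ℝ E]
    {μ ν : Measure E} [IsProbabilityMeasure μ] [IsProbabilityMeasure ν]
    (hμ : IsRotationInvariant μ) (hν : IsRotationInvariant ν)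
    (hμ1 : ∀ᵐ x ∂μ, ‖x‖ = 1) (hν1 : ∀ᵐ x ∂ν, ‖x‖ = 1) : μ = ν := by
  refine Measure.ext_of_charFun (funext fun t => ?_)
  rw [hμ.charFun_eq_integral hν1 t, hν.charFun_eq_integral hμ1 t]
  simp only [charFun_apply]
  rw [integral_integral_swap]
  · simp only [inner_smul_right, real_inner_comm]
  · refine (integrable_const (1 : ℝ)).mono ?_ (.of_forall fun p => ?_)
    · exact Continuous.aestronglyMeasurable (by simp only [Function.uncurry_def]; fun_prop)
    · simp [Function.uncurry_def, Complex.norm_exp_ofReal_mul_I]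

theorem IsRotationInvariant.map_normalize_eq [BorelSpace E] [FiniteDimensional ℝ E]
    {μ ν : Measure E} [IsProbabilityMeasure μ] [IsProbabilityMeasure ν]
    (hμ : IsRotationInvariant μ) (hν : IsRotationInvariant ν)
    (hμ0 : ∀ᵐ x ∂μ, x ≠ 0) (hν0 : ∀ᵐ x ∂ν, x ≠ 0) :
    (μ.map fun x => ‖x‖⁻¹ • x) = ν.map fun x => ‖x‖⁻¹ • x := by
  have hm : Measurable fun x : E => ‖x‖⁻¹ • x := by fun_prop
  have norm_eq_one {ρ : Measure E} (hρ : ∀ᵐ x ∂ρ, x ≠ 0) :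
      ∀ᵐ x ∂ρ.map fun x => ‖x‖⁻¹ • x, ‖x‖ = 1 := by
    rw [ae_map_iff hm.aemeasurable (measurableSet_eq_fun measurable_norm measurable_const)]
    filter_upwards [hρ] with x hx
    rw [norm_smul, norm_inv, norm_norm, inv_mul_cancel₀ (norm_ne_zero_iff.2 hx)]
  have := Measure.isProbabilityMeasure_map (μ := μ) hm.aemeasurable
  have := Measure.isProbabilityMeasure_map (μ := ν) hm.aemeasurable
  exact (hμ.map hm fun O x => by simp).eq_of_norm_eq_one (hν.map hm fun O x => by simp)
    (norm_eq_one hμ0) (norm_eq_one hν0)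

theorem IsRotationInvariant.map_eq_of_homogeneous [BorelSpace E] [FiniteDimensional ℝ E]
    {μ ν : Measure E} [IsProbabilityMeasure μ] [IsProbabilityMeasure ν]
    (hμ : IsRotationInvariant μ) (hν : IsRotationInvariant ν)
    (hμ0 : ∀ᵐ x ∂μ, x ≠ 0) (hν0 : ∀ᵐ x ∂ν, x ≠ 0) {S : Type*} [MeasurableSpace S] {Φ : E → S}
    (hΦ : Measurable Φ) (hom : ∀ (c : ℝ) x, 0 < c → Φ (c • x) = Φ x) : μ.map Φ = ν.map Φ := by
  have hm : Measurable fun x : E => ‖x‖⁻¹ • x := by fun_prop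
  have normalize {ρ : Measure E} (hρ : ∀ᵐ x ∂ρ, x ≠ 0) :
      ρ.map Φ = (ρ.map fun x => ‖x‖⁻¹ • x).map Φ := by
    rw [Measure.map_map hΦ hm]
    refine Measure.map_congr ?_
    filter_upwards [hρ] with x hx
    exact (hom _ _ (inv_pos.2 (norm_pos_iff.2 hx))).symm
  rw [normalize hμ0, normalize hν0, hμ.map_normalize_eq hν hμ0 hν0]

variable [FiniteDimensional ℝ E] [BorelSpace E]

theorem isRotationInvariant_stdGaussian : IsRotationInvariant (stdGaussian E) :=
  fun O => ⟨O.continuous.measurable, stdGaussian_map O⟩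

theorem map_inner_stdGaussian (a : E) :
    (stdGaussian E).map (fun x => inner ℝ a x) = gaussianReal 0 (‖a‖ ^ 2).toNNReal := by
  have h := IsGaussian.map_eq_gaussianReal (μ := stdGaussian E) (innerSL ℝ a)
  rwa [integral_strongDual_stdGaussian, variance_dual_stdGaussian, innerSL_apply_norm] at h

theorem ae_inner_stdGaussian_ne_zero {a : E} (ha : a ≠ 0) :
    ∀ᵐ x ∂stdGaussian E, inner ℝ a x ≠ 0 := by
  have hv : (‖a‖ ^ 2).toNNReal ≠ 0 := by simpa using ha
  have := nullSingletonClass_gaussianReal (μ := 0) hv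
  have h : ∀ᵐ y ∂(stdGaussian E).map (fun x => inner ℝ a x), y ≠ 0 := by
    rw [map_inner_stdGaussian]
    exact Measure.ae_ne _ 0
  exact ae_of_ae_map (p := fun y => y ≠ 0) (by fun_prop) h

theorem ae_stdGaussian_notMem_of_ne_top {S : Submodule ℝ E} (hS : S ≠ ⊤) :
    ∀ᵐ x ∂stdGaussian E, x ∉ S := by
  obtain ⟨a, ha, ha0⟩ := Submodule.exists_mem_ne_zero_of_ne_bot
    (mt (Submodule.orthogonal_eq_bot_iff).1 hS)
  filter_upwards [ae_inner_stdGaussian_ne_zero ha0] with x hx hxS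
  exact hx (Submodule.inner_left_of_mem_orthogonal hxS ha)

theorem ae_stdGaussian_ne_zero [Nontrivial E] : ∀ᵐ x ∂stdGaussian E, x ≠ 0 := by
  filter_upwards [ae_stdGaussian_notMem_of_ne_top (bot_ne_top (α := Submodule ℝ E))] with x hx
  exact mt (Submodule.mem_bot ℝ).2 hx

end RotationInvariance

section ScaledDirection

variable {E : Type*} [NormedAddCommGroup E] [InnerProductSpace ℝ E]

/-- The vector of signed length `p.1` in the direction of `p.2`: one draw of an elliptical
distribution with radius `p.1`. It is `0` where `p.2 = 0`. -/
def scaledDirection (p : ℝ × E) : E := p.1 • (‖p.2‖⁻¹ • p.2)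

@[fun_prop]
theorem measurable_scaledDirection [FiniteDimensional ℝ E] [MeasurableSpace E] [BorelSpace E] :
    Measurable (scaledDirection (E := E)) := by
  unfold scaledDirection
  fun_prop

theorem mem_span_of_scaledDirection_eq {p q : ℝ × E} (hp1 : p.1 ≠ 0) (hp2 : p.2 ≠ 0)
    (h : scaledDirection p = scaledDirection q) : q.2 ∈ Submodule.span ℝ {p.2} := by
  simp only [scaledDirection, smul_smul] at h
  have hne : (q.1 * ‖q.2‖⁻¹) • q.2 ≠ 0 := by simp [← h, hp1, hp2]
  rw [Submodule.mem_span_singleton]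
  refine ⟨(q.1 * ‖q.2‖⁻¹)⁻¹ * (p.1 * ‖p.2‖⁻¹), ?_⟩
  rw [mul_smul, h, smul_smul, inv_mul_cancel₀ (left_ne_zero_of_smul hne), one_smul]

variable [FiniteDimensional ℝ E] [MeasurableSpace E] [BorelSpace E]

theorem ae_scaledDirection_ne_scaledDirection (hE : 2 ≤ Module.finrank ℝ E) (μ ν : Measure ℝ)
    [IsProbabilityMeasure μ] [IsProbabilityMeasure ν] (hμ : ∀ᵐ a ∂μ, a ≠ 0) :
    ∀ᵐ p ∂(μ.prod (stdGaussian E)).prod (ν.prod (stdGaussian E)),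
      scaledDirection p.1 - scaledDirection p.2 ≠ 0 := by
  have : Nontrivial E := Module.nontrivial_of_finrank_pos (R := ℝ) (by omega)
  have hspan (z : E) : Submodule.span ℝ {z} ≠ ⊤ := fun h => by
    have := finrank_span_le_card (R := ℝ) ({z} : Set E)
    rw [h, finrank_top, Set.toFinset_singleton, Finset.card_singleton] at this
    omega
  have hm : Measurable fun p : (ℝ × E) × (ℝ × E) =>
    scaledDirection p.1 - scaledDirection p.2 := by fun_prop
  rw [Measure.ae_prod_iff_ae_ae
    (p := fun p : (ℝ × E) × (ℝ × E) => scaledDirection p.1 - scaledDirection p.2 ≠ 0)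
    (hm (measurableSet_singleton 0)).compl]
  have hradius : ∀ᵐ p ∂μ.prod (stdGaussian E), p.1 ≠ 0 :=
    Measure.quasiMeasurePreserving_fst.ae hμ
  have hdirection : ∀ᵐ p ∂μ.prod (stdGaussian E), p.2 ≠ 0 :=
    Measure.quasiMeasurePreserving_snd.ae ae_stdGaussian_ne_zero
  filter_upwards [hradius, hdirection] with p hp1 hp2
  have hnot : ∀ᵐ q ∂ν.prod (stdGaussian E), q.2 ∉ Submodule.span ℝ {p.2} :=
    Measure.quasiMeasurePreserving_snd.ae (ae_stdGaussian_notMem_of_ne_top (hspan p.2))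
  filter_upwards [hnot] with q hq h
  exact hq (mem_span_of_scaledDirection_eq hp1 hp2 (sub_eq_zero.1 h))

theorem isRotationInvariant_map_scaledDirection_sub (μ ν : Measure ℝ) [SFinite μ] [SFinite ν] :
    IsRotationInvariant (((μ.prod (stdGaussian E)).prod (ν.prod (stdGaussian E))).map
      fun p => scaledDirection p.1 - scaledDirection p.2) := fun O => by
  have hO : Measurable O := O.continuous.measurable
  have hm : Measurable fun p : (ℝ × E) × (ℝ × E) =>
    scaledDirection p.1 - scaledDirection p.2 := by fun_prop
  have hrot := (((MeasurePreserving.id μ).prod (isRotationInvariant_stdGaussian O)).prod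
    ((MeasurePreserving.id ν).prod (isRotationInvariant_stdGaussian O)))
  refine ⟨hO, ?_⟩
  rw [Measure.map_map hO hm]
  conv_rhs => rw [← hrot.map_eq, Measure.map_map hm hrot.measurable]
  congr 1
  ext p
  simp [scaledDirection]

theorem hasLaw_homogeneous_scaledDirection_sub {Ω S : Type*} [MeasurableSpace Ω] [MeasurableSpace S]
    {P : Measure Ω} [IsProbabilityMeasure P] (hE : 2 ≤ Module.finrank ℝ E)
    {X Y : Ω → ℝ × E} (hXY : IndepFun X Y P) {μ ν : Measure ℝ} [IsProbabilityMeasure μ]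
    [IsProbabilityMeasure ν] (hμ : ∀ᵐ a ∂μ, a ≠ 0) (hX : HasLaw X (μ.prod (stdGaussian E)) P)
    (hY : HasLaw Y (ν.prod (stdGaussian E)) P) {Φ : E → S} (hΦ : Measurable Φ)
    (hom : ∀ (c : ℝ) x, 0 < c → Φ (c • x) = Φ x) :
    HasLaw (fun ω => Φ (scaledDirection (X ω) - scaledDirection (Y ω)))
      ((stdGaussian E).map Φ) P := by
  have : Nontrivial E := Module.nontrivial_of_finrank_pos (R := ℝ) (by omega)
  have hm : Measurable fun p : (ℝ × E) × (ℝ × E) =>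
    scaledDirection p.1 - scaledDirection p.2 := by fun_prop
  have hlaw : HasLaw (fun ω => scaledDirection (X ω) - scaledDirection (Y ω))
      (((μ.prod (stdGaussian E)).prod (ν.prod (stdGaussian E))).map
        fun p => scaledDirection p.1 - scaledDirection p.2) P :=
    HasLaw.comp ⟨hm.aemeasurable, rfl⟩ (hXY.hasLaw_prod hX hY)
  have := Measure.isProbabilityMeasure_map
    (μ := (μ.prod (stdGaussian E)).prod (ν.prod (stdGaussian E))) hm.aemeasurable
  rw [← (isRotationInvariant_map_scaledDirection_sub μ ν).map_eq_of_homogeneous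
    isRotationInvariant_stdGaussian ((ae_map_iff hm.aemeasurable
      (measurableSet_singleton (0 : E)).compl).2 (ae_scaledDirection_ne_scaledDirection hE μ ν hμ))
    ae_stdGaussian_ne_zero hΦ hom]
  exact HasLaw.comp ⟨hΦ.aemeasurable, rfl⟩ hlaw

end ScaledDirection

section UStatistic

/-- The index pairs `(s, t)` with `t < s < T` over which a statistic of order two averages. -/
def orderedPairs (T : ℕ) : Finset (ℕ × ℕ) :=
  (Finset.range T ×ˢ Finset.range T).filter fun p => p.2 < p.1

theorem sum_orderedPairs {M : Type*} [AddCommMonoid M] (T : ℕ) (F : ℕ → ℕ → M) :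
    ∑ p ∈ orderedPairs T, F p.1 p.2 = ∑ s ∈ Finset.range T, ∑ t ∈ Finset.range s, F s t := by
  rw [orderedPairs, Finset.sum_filter, Finset.sum_product]
  refine Finset.sum_congr rfl fun s hs => ?_
  rw [← Finset.sum_filter]
  refine Finset.sum_congr ?_ fun _ _ => rfl
  ext t
  simp only [Finset.mem_filter, Finset.mem_range] at hs ⊢
  omega

theorem card_orderedPairs (T : ℕ) : ((orderedPairs T).card : ℝ) = T * (T - 1) / 2 := by
  have h := sum_orderedPairs T fun _ _ => (1 : ℝ)
  simp only [Finset.sum_const, nsmul_eq_mul, mul_one, Finset.card_range] at h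
  rw [h]
  clear h
  induction T with
  | zero => simp
  | succ n ih =>
    rw [Finset.sum_range_succ, ih]
    push_cast
    ring

/-- Two index pairs have an index in common; the corresponding terms of a statistic of order two
may then be correlated. -/
def Meets (p q : ℕ × ℕ) : Prop := q.1 = p.1 ∨ q.1 = p.2 ∨ q.2 = p.1 ∨ q.2 = p.2

instance : DecidableRel Meets := fun p q => by unfold Meets; infer_instance

theorem card_filter_meets_le (T : ℕ) (p : ℕ × ℕ) :
    ((orderedPairs T).filter (Meets p)).card ≤ 4 * T := by
  have hsub : (orderedPairs T).filter (Meets p) ⊆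
      (({p.1} ×ˢ Finset.range T ∪ {p.2} ×ˢ Finset.range T) ∪
        (Finset.range T ×ˢ {p.1} ∪ Finset.range T ×ˢ {p.2})) := by
    rintro ⟨a, b⟩ h
    simp only [orderedPairs, Meets, Finset.mem_filter, Finset.mem_product, Finset.mem_range,
      Finset.mem_union, Finset.mem_singleton] at h ⊢
    tauto
  refine (Finset.card_le_card hsub).trans ((Finset.card_union_le _ _).trans ?_)
  have h₁ := Finset.card_union_le ({p.1} ×ˢ Finset.range T) ({p.2} ×ˢ Finset.range T)
  have h₂ := Finset.card_union_le (Finset.range T ×ˢ {p.1}) (Finset.range T ×ˢ {p.2})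
  simp only [Finset.card_product, Finset.card_singleton, Finset.card_range] at h₁ h₂
  omega

/-- The average of a kernel over the pairs `t < s` of sample points. It is `0` for `T < 2`. -/
def uStatistic {Ω S : Type*} (T : ℕ) (κ : S → S → ℝ) (X : ℕ → Ω → S) (ω : Ω) : ℝ :=
  2 / ((T : ℝ) * ((T : ℝ) - 1)) *
    ∑ s ∈ Finset.range T, ∑ t ∈ Finset.range s, κ (X t ω) (X s ω)

theorem uStatistic_eq {Ω S : Type*} (T : ℕ) (κ : S → S → ℝ) (X : ℕ → Ω → S) (ω : Ω) :
    uStatistic T κ X ω =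
      ((orderedPairs T).card : ℝ)⁻¹ * ∑ p ∈ orderedPairs T, κ (X p.2 ω) (X p.1 ω) := by
  rw [uStatistic, card_orderedPairs, sum_orderedPairs T fun s t => κ (X t ω) (X s ω), inv_div]

theorem memLp_comp_hasLaw {Ω S : Type*} [MeasurableSpace Ω] [MeasurableSpace S] {P : Measure Ω}
    {Y : Ω → S} {μ : Measure S} (hY : HasLaw Y μ P) {f : S → ℝ}
    {p : ENNReal} (hf : MemLp f p μ) : MemLp (fun ω => f (Y ω)) p P := by
  rw [← hY.map_eq] at hf
  exact (memLp_map_measure_iff hf.1 hY.aemeasurable).1 hf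

variable {Ω S : Type*} [MeasurableSpace Ω] {P : Measure Ω} {X : ℕ → Ω → S} {κ : S → S → ℝ}
  {ν : Measure ℝ}

theorem memLp_uStatistic (hν : ∀ t s, t < s → HasLaw (fun ω => κ (X t ω) (X s ω)) ν P)
    {p : ENNReal} (hνp : MemLp id p ν) (T : ℕ) : MemLp (uStatistic T κ X) p P := by
  have hfun : uStatistic T κ X = fun ω => ((orderedPairs T).card : ℝ)⁻¹ *
      ∑ p ∈ orderedPairs T, κ (X p.2 ω) (X p.1 ω) := funext (uStatistic_eq T κ X)
  rw [hfun]
  exact (memLp_finsetSum _ fun p hp =>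
    memLp_comp_hasLaw (hν _ _ (Finset.mem_filter.1 hp).2) hνp).const_mul _

theorem integral_uStatistic [IsFiniteMeasure P]
    (hν : ∀ t s, t < s → HasLaw (fun ω => κ (X t ω) (X s ω)) ν P)
    (hνi : Integrable id ν) {T : ℕ} (hT : 2 ≤ T) :
    ∫ ω, uStatistic T κ X ω ∂P = ∫ x, x ∂ν := by
  have law {p} (hp : p ∈ orderedPairs T) := hν _ _ (Finset.mem_filter.1 hp).2
  have hcard : ((orderedPairs T).card : ℝ) ≠ 0 := by
    rw [card_orderedPairs]
    have : (2 : ℝ) ≤ T := by exact_mod_cast hT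
    nlinarith
  have integrable : ∀ p ∈ orderedPairs T, Integrable (fun ω => κ (X p.2 ω) (X p.1 ω)) P :=
    fun p hp => (memLp_comp_hasLaw (law hp) (memLp_one_iff_integrable.2 hνi)).integrable le_rfl
  simp only [uStatistic_eq]
  rw [integral_const_mul, integral_finsetSum _ integrable,
    Finset.sum_congr rfl fun p hp => (law hp).integral_eq, Finset.sum_const, nsmul_eq_mul,
    inv_mul_cancel_left₀ hcard]

variable [MeasurableSpace S] [IsProbabilityMeasure P]

theorem covariance_le_integral_sq {Y Z : Ω → ℝ} (hY : MemLp Y 2 P) (hZ : MemLp Z 2 P) {q : ℝ}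
    (hYq : ∫ ω, Y ω ^ 2 ∂P ≤ q) (hZq : ∫ ω, Z ω ^ 2 ∂P ≤ q) : cov[Y, Z; P] ≤ q := by
  have hsub := variance_sub hY hZ
  have hnonneg := variance_nonneg (Y - Z) P
  have hVarY := variance_le_expectation_sq hY.aestronglyMeasurable
  have hVarZ := variance_le_expectation_sq hZ.aestronglyMeasurable
  simp only [Pi.pow_apply] at hVarY hVarZ
  linarith

theorem covariance_pair_le (hX : ∀ t, Measurable (X t)) (hind : iIndepFun X P)
    (hκ : Measurable (Function.uncurry κ))
    (hν : ∀ t s, t < s → HasLaw (fun ω => κ (X t ω) (X s ω)) ν P) (hν2 : MemLp id 2 ν) {T : ℕ}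
    {p p' : ℕ × ℕ} (hp : p ∈ orderedPairs T) (hp' : p' ∈ orderedPairs T) :
    cov[fun ω => κ (X p.2 ω) (X p.1 ω), fun ω => κ (X p'.2 ω) (X p'.1 ω); P] ≤
      if Meets p p' then ∫ x, x ^ 2 ∂ν else 0 := by
  have law {p} (hp : p ∈ orderedPairs T) := hν _ _ (Finset.mem_filter.1 hp).2
  have memLp {p} (hp : p ∈ orderedPairs T) : MemLp (fun ω => κ (X p.2 ω) (X p.1 ω)) 2 P :=
    memLp_comp_hasLaw (law hp) hν2
  have second_moment {p} (hp : p ∈ orderedPairs T) :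
      ∫ ω, κ (X p.2 ω) (X p.1 ω) ^ 2 ∂P = ∫ x, x ^ 2 ∂ν :=
    (law hp).integral_comp (f := fun x => x ^ 2) (by fun_prop)
  split_ifs with h
  · exact covariance_le_integral_sq (memLp hp) (memLp hp') (second_moment hp).le
      (second_moment hp').le
  · simp only [Meets, not_or] at h
    have hindep := hind.indepFun_prodMk_prodMk hX p.2 p.1 p'.2 p'.1 (Ne.symm h.2.2.2)
      (Ne.symm h.2.1) (Ne.symm h.2.2.1) (Ne.symm h.1)
    exact ((hindep.comp hκ hκ).covariance_eq_zero (memLp hp) (memLp hp')).le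

theorem variance_sum_orderedPairs_le (hX : ∀ t, Measurable (X t)) (hind : iIndepFun X P)
    (hκ : Measurable (Function.uncurry κ))
    (hν : ∀ t s, t < s → HasLaw (fun ω => κ (X t ω) (X s ω)) ν P) (hν2 : MemLp id 2 ν) (T : ℕ) :
    Var[∑ p ∈ orderedPairs T, fun ω => κ (X p.2 ω) (X p.1 ω); P] ≤
      (orderedPairs T).card * (4 * T) * ∫ x, x ^ 2 ∂ν := by
  have memLp : ∀ p ∈ orderedPairs T, MemLp (fun ω => κ (X p.2 ω) (X p.1 ω)) 2 P := fun p hp =>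
    memLp_comp_hasLaw (hν _ _ (Finset.mem_filter.1 hp).2) hν2
  rw [variance_sum' memLp]
  calc _ ≤ ∑ p ∈ orderedPairs T, ∑ p' ∈ orderedPairs T,
        if Meets p p' then ∫ x, x ^ 2 ∂ν else 0 :=
        Finset.sum_le_sum fun p hp => Finset.sum_le_sum fun p' hp' =>
          covariance_pair_le hX hind hκ hν hν2 hp hp'
    _ ≤ ∑ p ∈ orderedPairs T, (4 * T : ℝ) * ∫ x, x ^ 2 ∂ν := by
        refine Finset.sum_le_sum fun p _ => ?_
        rw [← Finset.sum_filter, Finset.sum_const, nsmul_eq_mul]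
        have hcard : (((orderedPairs T).filter (Meets p)).card : ℝ) ≤ 4 * T := by
          exact_mod_cast card_filter_meets_le T p
        exact mul_le_mul_of_nonneg_right hcard (integral_nonneg fun x => sq_nonneg x)
    _ = _ := by rw [Finset.sum_const, nsmul_eq_mul]; ring

theorem variance_uStatistic_le (hX : ∀ t, Measurable (X t)) (hind : iIndepFun X P)
    (hκ : Measurable (Function.uncurry κ))
    (hν : ∀ t s, t < s → HasLaw (fun ω => κ (X t ω) (X s ω)) ν P) (hν2 : MemLp id 2 ν) {T : ℕ}
    (hT : 2 ≤ T) : Var[uStatistic T κ X; P] ≤ 16 / T * ∫ x, x ^ 2 ∂ν := by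
  have hT' : (2 : ℝ) ≤ T := by exact_mod_cast hT
  have hsub : (T : ℝ) - 1 ≠ 0 := by linarith
  have hfun : uStatistic T κ X = fun ω => ((orderedPairs T).card : ℝ)⁻¹ *
      (∑ p ∈ orderedPairs T, fun ω => κ (X p.2 ω) (X p.1 ω)) ω := by
    ext ω
    rw [uStatistic_eq, Finset.sum_apply]
  rw [hfun, variance_const_mul]
  calc _ ≤ ((orderedPairs T).card : ℝ)⁻¹ ^ 2 *
        ((orderedPairs T).card * (4 * T) * ∫ x, x ^ 2 ∂ν) := by
        gcongr
        exact variance_sum_orderedPairs_le hX hind hκ hν hν2 T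
    _ = 8 / ((T : ℝ) - 1) * ∫ x, x ^ 2 ∂ν := by
        rw [card_orderedPairs]
        field_simp
        ring
    _ ≤ 16 / T * ∫ x, x ^ 2 ∂ν := by
        refine mul_le_mul_of_nonneg_right ?_ (integral_nonneg fun x => sq_nonneg x)
        rw [div_le_div_iff₀ (by linarith) (by linarith)]
        linarith

theorem prob_sum_sq_uStatistic_sub_le {K : Type*} [Fintype K] {κ : K → S → S → ℝ}
    {ν : K → Measure ℝ} (hX : ∀ t, Measurable (X t)) (hind : iIndepFun X P)
    (hκ : ∀ k, Measurable (Function.uncurry (κ k)))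
    (hν : ∀ k t s, t < s → HasLaw (fun ω => κ k (X t ω) (X s ω)) (ν k) P)
    (hν2 : ∀ k, MemLp id 2 (ν k)) {q : ℝ} (hq : ∑ k, ∫ x, x ^ 2 ∂ν k ≤ q) {T : ℕ} (hT : 2 ≤ T)
    {a : ℝ} (ha : 0 < a) :
    P {ω | a < ∑ k, (uStatistic T (κ k) X ω - ∫ x, x ∂ν k) ^ 2} ≤
      ENNReal.ofReal (16 * q / (T * a)) := by
  have : (0 : ℝ) < T := by exact_mod_cast (by omega : 0 < T)
  have memLp (k) : MemLp (fun ω => uStatistic T (κ k) X ω - ∫ x, x ∂ν k) 2 P :=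
    (memLp_uStatistic (hν k) (hν2 k) T).sub (memLp_const _)
  have second_moment (k) :
      ∫ ω, (uStatistic T (κ k) X ω - ∫ x, x ∂ν k) ^ 2 ∂P ≤ 16 / T * ∫ x, x ^ 2 ∂ν k := by
    have : IsProbabilityMeasure (ν k) :=
      (hν k 0 1 one_pos).isProbabilityMeasure_iff.1 inferInstance
    rw [← integral_uStatistic (hν k) ((hν2 k).integrable one_le_two) hT,
      ← variance_eq_integral (memLp_uStatistic (hν k) (hν2 k) T).aemeasurable]
    exact variance_uStatistic_le hX hind (hκ k) (hν k) (hν2 k) hT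
  have hsum : ∫ ω, ∑ k, (uStatistic T (κ k) X ω - ∫ x, x ∂ν k) ^ 2 ∂P ≤ 16 / T * q :=
    calc _ = ∑ k, ∫ ω, (uStatistic T (κ k) X ω - ∫ x, x ∂ν k) ^ 2 ∂P :=
          integral_finsetSum _ fun k _ => (memLp k).integrable_sq
      _ ≤ ∑ k, 16 / T * ∫ x, x ^ 2 ∂ν k := Finset.sum_le_sum fun k _ => second_moment k
      _ ≤ 16 / T * q := by
          rw [← Finset.mul_sum]
          gcongr
  have hmarkov := (mul_meas_ge_le_integral_of_nonneg
    (.of_forall fun ω => Finset.sum_nonneg fun k _ => sq_nonneg _)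
    (integrable_finsetSum _ fun k _ => (memLp k).integrable_sq) a).trans hsum
  calc _ ≤ P {ω | a ≤ ∑ k, (uStatistic T (κ k) X ω - ∫ x, x ∂ν k) ^ 2} :=
        measure_mono fun ω (hω : a < _) => hω.le
    _ ≤ _ := ?_
  rw [← ofReal_measureReal]
  refine ENNReal.ofReal_le_ofReal ?_
  rwa [← div_div, le_div_iff₀' ha, mul_div_right_comm]

end UStatistic

section LinearForms

/-- The standard Gaussian measure on a coordinate space. -/
abbrev stdPi (ι : Type*) [Fintype ι] : Measure (ι → ℝ) := Measure.pi fun _ => gaussianReal 0 1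

variable {ι : Type*} [Fintype ι]

theorem measurable_dotProduct (a : ι → ℝ) : Measurable fun x : ι → ℝ => a ⬝ᵥ x := by
  unfold dotProduct
  fun_prop

theorem inner_toLp_eq_dotProduct (a x : ι → ℝ) :
    inner ℝ (WithLp.toLp 2 a : EuclideanSpace ℝ ι) (WithLp.toLp 2 x) = a ⬝ᵥ x := by
  simp [PiLp.inner_apply, dotProduct, mul_comm]

theorem norm_toLp_sq (a : ι → ℝ) : ‖(WithLp.toLp 2 a : EuclideanSpace ℝ ι)‖ ^ 2 = a ⬝ᵥ a := by
  rw [← inner_toLp_eq_dotProduct, real_inner_self_eq_norm_sq]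

theorem hasLaw_dotProduct_stdPi (a : ι → ℝ) :
    HasLaw (fun x => a ⬝ᵥ x) ((gaussianReal 0 1).map fun x => √(a ⬝ᵥ a) * x) (stdPi ι) := by
  refine ⟨(measurable_dotProduct a).aemeasurable, ?_⟩
  have h := map_inner_stdGaussian (WithLp.toLp 2 a : EuclideanSpace ℝ ι)
  rw [← map_pi_eq_stdGaussian, Measure.map_map (by fun_prop) (WithLp.measurable_toLp 2 _)] at h
  simp only [Function.comp_def, inner_toLp_eq_dotProduct, norm_toLp_sq] at h
  rw [h, gaussianReal_map_const_mul, mul_zero, mul_one]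
  congr 1
  ext
  have hnonneg : 0 ≤ a ⬝ᵥ a := Finset.sum_nonneg fun i _ => mul_self_nonneg _
  simp [hnonneg]

theorem ae_dotProduct_ne_zero {a : ι → ℝ} (ha : a ≠ 0) : ∀ᵐ x ∂stdPi ι, a ⬝ᵥ x ≠ 0 := by
  have h := ae_inner_stdGaussian_ne_zero (a := (WithLp.toLp 2 a : EuclideanSpace ℝ ι))
    (by simpa using ha)
  rw [← map_pi_eq_stdGaussian] at h
  simpa only [inner_toLp_eq_dotProduct] using ae_of_ae_map (by fun_prop) h

theorem integrable_abs_pow_gaussianReal (p : ℕ) :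
    Integrable (fun x : ℝ => |x| ^ p) (gaussianReal 0 1) := by
  simpa only [id, Real.norm_eq_abs] using
    (memLp_id_gaussianReal (μ := 0) (v := 1) p).integrable_norm_pow'

theorem integrable_abs_dotProduct_pow (a : ι → ℝ) (p : ℕ) :
    Integrable (fun x => |a ⬝ᵥ x| ^ p) (stdPi ι) := by
  refine (memLp_comp_hasLaw (hasLaw_dotProduct_stdPi a) (f := fun y : ℝ => |y| ^ p)
    (memLp_one_iff_integrable.2 ?_)).integrable le_rfl
  rw [integrable_map_measure (by fun_prop) (by fun_prop)]
  simp only [Function.comp_def, abs_mul, mul_pow]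
  exact (integrable_abs_pow_gaussianReal p).const_mul _

theorem integral_abs_dotProduct_pow (a : ι → ℝ) (p : ℕ) :
    ∫ x, |a ⬝ᵥ x| ^ p ∂stdPi ι = √(a ⬝ᵥ a) ^ p * ∫ x, |x| ^ p ∂gaussianReal 0 1 := by
  have h := (hasLaw_dotProduct_stdPi a).integral_comp (f := fun y : ℝ => |y| ^ p) (by fun_prop)
  rw [Function.comp_def] at h
  rw [h, integral_map (by fun_prop) (by fun_prop), ← integral_const_mul]
  simp only [abs_mul, mul_pow, abs_of_nonneg (Real.sqrt_nonneg _)]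

theorem integral_abs_gaussianReal_pos : 0 < ∫ x, |x| ∂gaussianReal 0 1 := by
  rw [integral_pos_iff_support_of_nonneg (fun x => abs_nonneg x)
    (by simpa only [pow_one] using integrable_abs_pow_gaussianReal 1)]
  have hsupport : Function.support (fun x : ℝ => |x|) = {0}ᶜ := by ext; simp
  have := nullSingletonClass_gaussianReal (μ := 0) one_ne_zero
  rw [hsupport, prob_compl_eq_one_sub (measurableSet_singleton 0), measure_singleton]
  simp

theorem integral_sq_gaussianReal : ∫ x, |x| ^ 2 ∂gaussianReal 0 1 = 1 := by
  have h := variance_id_gaussianReal (μ := 0) (v := 1)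
  rw [variance_eq_integral (by fun_prop)] at h
  simpa using h

end LinearForms

section NegativeMoments

open scoped ENNReal NNReal

theorem gaussianReal_le_volume (μ : ℝ) : gaussianReal μ 1 ≤ volume := by
  have pdf_le_one : gaussianPDF μ 1 ≤ 1 := by
    intro x
    rw [gaussianPDF, Pi.one_apply, ENNReal.ofReal_le_one, gaussianPDFReal]
    refine mul_le_one₀ (inv_le_one_of_one_le₀ ?_) (Real.exp_nonneg _) ?_
    · rw [Real.one_le_sqrt, NNReal.coe_one]
      linarith [Real.pi_gt_three]
    · rw [Real.exp_le_one_iff, neg_div]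
      exact neg_nonpos.2 (by positivity)
  rw [gaussianReal_of_var_ne_zero μ one_ne_zero]
  exact (withDensity_mono (.of_forall pdf_le_one)).trans withDensity_one.le

theorem setLIntegral_ball_enorm_rpow_lt_top {s : ℝ} (hs : s < 1) :
    ∫⁻ x in Metric.ball (0 : ℝ) 1, ‖x‖ₑ ^ (-s) < ⊤ := by
  have hmeas : Measurable fun x : ℝ => |x| ^ (-s) := by fun_prop
  have hint : IntegrableOn (fun x : ℝ => |x| ^ (-s)) (Metric.ball 0 1) volume :=
    integrableOn_ball_of_norm_le_rpow (α := s) (C := 1) (by simp) (by simpa using hs)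
      (.of_forall fun x => by
        rw [Real.norm_of_nonneg (by positivity), one_mul, Real.norm_eq_abs])
      hmeas.aestronglyMeasurable
  refine (lintegral_congr_ae ?_).trans_lt hint.hasFiniteIntegral
  filter_upwards [ae_restrict_of_ae (Measure.ae_ne volume (0 : ℝ))] with x hx
  rw [Real.enorm_of_nonneg (r := |x| ^ (-s)) (by positivity),
    ← ENNReal.ofReal_rpow_of_pos (abs_pos.2 hx), ← Real.enorm_eq_ofReal_abs]

theorem exists_lintegral_enorm_add_rpow_le {s : ℝ} (hs₀ : 0 < s) (hs₁ : s < 1) :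
    ∃ C : ℝ≥0, ∀ v : ℝ, ∫⁻ x, ‖x + v‖ₑ ^ (-s) ∂gaussianReal 0 1 ≤ C := by
  set F : ℝ → ℝ≥0∞ := (Metric.ball (0 : ℝ) 1).indicator fun x => ‖x‖ₑ ^ (-s) with hF
  have F_lt_top : 1 + ∫⁻ x, F x < ⊤ := by
    rw [lintegral_indicator Metric.isOpen_ball.measurableSet]
    exact ENNReal.add_lt_top.2 ⟨ENNReal.one_lt_top, setLIntegral_ball_enorm_rpow_lt_top hs₁⟩
  have le_one_add (y : ℝ) : ‖y‖ₑ ^ (-s) ≤ 1 + F y := by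
    by_cases hy : y ∈ Metric.ball (0 : ℝ) 1
    · rw [hF, Set.indicator_of_mem hy]
      exact le_add_self
    · refine le_add_right (ENNReal.rpow_le_one_of_one_le_of_neg ?_ (neg_lt_zero.2 hs₀))
      rw [mem_ball_zero_iff, not_lt] at hy
      rwa [← ofReal_norm, ENNReal.one_le_ofReal]
  refine ⟨(1 + ∫⁻ x, F x).toNNReal, fun v => ?_⟩
  rw [ENNReal.coe_toNNReal F_lt_top.ne]
  calc ∫⁻ x, ‖x + v‖ₑ ^ (-s) ∂gaussianReal 0 1
      ≤ ∫⁻ x, (1 + F (x + v)) ∂gaussianReal 0 1 := lintegral_mono fun x => le_one_add (x + v)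
    _ = 1 + ∫⁻ x, F (x + v) ∂gaussianReal 0 1 := by
        rw [lintegral_add_left measurable_const]
        simp
    _ ≤ 1 + ∫⁻ x, F (x + v) := by
        gcongr
        exact gaussianReal_le_volume 0
    _ = 1 + ∫⁻ x, F x := by rw [lintegral_add_right_eq_self F v]

theorem lintegral_rpow_le_rpow_lintegral {α : Type*} [MeasurableSpace α] (μ : Measure α)
    [IsProbabilityMeasure μ] {ψ : α → ℝ≥0∞} (hψ : AEMeasurable ψ μ) {θ : ℝ} (hθ₀ : 0 < θ)
    (hθ₁ : θ ≤ 1) : ∫⁻ x, ψ x ^ θ ∂μ ≤ (∫⁻ x, ψ x ∂μ) ^ θ := by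
  have h := eLpNorm'_le_eLpNorm'_of_exponent_le hθ₀ hθ₁ μ hψ.aestronglyMeasurable
  simp only [eLpNorm', enorm_eq_self, ENNReal.rpow_one, div_one] at h
  rwa [one_div, ENNReal.rpow_inv_le_iff hθ₀] at h

variable {ι : Type*} [Fintype ι]

theorem div_dotProduct_self_le [Nonempty ι] {x : ι → ℝ} (hx : ∀ i, x i ≠ 0) :
    (Fintype.card ι : ℝ) / (x ⬝ᵥ x) ≤ ∏ i, |x i| ^ (-(2 / Fintype.card ι) : ℝ) := by
  have hn : (0 : ℝ) < Fintype.card ι := by exact_mod_cast Fintype.card_pos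
  have hpos (i) : 0 < |x i| := abs_pos.2 (hx i)
  have mean_le : ∏ i, |x i| ^ (2 / Fintype.card ι : ℝ) ≤ (x ⬝ᵥ x) / Fintype.card ι := by
    have h := Real.geom_mean_le_arith_mean_weighted Finset.univ
      (fun _ : ι => (Fintype.card ι : ℝ)⁻¹) (fun i => |x i| ^ 2) (fun _ _ => by positivity)
      (by simp [hn.ne']) (fun _ _ => by positivity)
    convert h using 1
    · refine Finset.prod_congr rfl fun i _ => ?_
      rw [← Real.rpow_natCast, ← Real.rpow_mul (hpos i).le, Nat.cast_ofNat, div_eq_mul_inv]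
    · rw [← Finset.mul_sum, dotProduct, div_eq_inv_mul]
      simp only [sq, abs_mul_abs_self]
  simp only [Real.rpow_neg (abs_nonneg _), Finset.prod_inv_distrib]
  rw [← inv_div]
  exact inv_anti₀ (Finset.prod_pos fun i _ => Real.rpow_pos_of_pos (hpos i) _) mean_le

theorem ofReal_div_dotProduct_self_pow_le [Nonempty ι] {p : ℕ} (hp : p ≠ 0) (x : ι → ℝ) :
    ENNReal.ofReal ((Fintype.card ι / (x ⬝ᵥ x)) ^ p) ≤
      ∏ i, ‖x i‖ₑ ^ (-(2 * p / Fintype.card ι) : ℝ) := by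
  have hn : (0 : ℝ) < Fintype.card ι := by exact_mod_cast Fintype.card_pos
  have : (0 : ℝ) < p := by exact_mod_cast Nat.pos_of_ne_zero hp
  by_cases h : ∃ i, x i = 0
  · obtain ⟨i, hi⟩ := h
    have hexp : (0 : ℝ) < 2 * p / Fintype.card ι := by positivity
    classical
    rw [← Finset.mul_prod_erase _ _ (Finset.mem_univ i), hi, enorm_zero,
      ENNReal.zero_rpow_of_neg (neg_lt_zero.2 hexp), ENNReal.top_mul]
    · exact le_top
    · exact Finset.prod_ne_zero_iff.2 fun j _ => by simp [ENNReal.rpow_eq_zero_iff, hexp.le]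
  · push Not at h
    have hdiv : 0 ≤ (Fintype.card ι : ℝ) / (x ⬝ᵥ x) :=
      div_nonneg hn.le (Finset.sum_nonneg fun i _ => mul_self_nonneg _)
    refine (ENNReal.ofReal_le_ofReal
      (pow_le_pow_left₀ hdiv (div_dotProduct_self_le h) p)).trans_eq ?_
    rw [← Finset.prod_pow, ENNReal.ofReal_prod_of_nonneg fun i _ => by positivity]
    refine Finset.prod_congr rfl fun i _ => ?_
    rw [← Real.rpow_natCast, ← Real.rpow_mul (abs_nonneg _), Real.enorm_eq_ofReal_abs,
      ENNReal.ofReal_rpow_of_pos (abs_pos.2 (h i))]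
    congr 2
    ring

theorem lintegral_prod_enorm_add_rpow (v : ι → ℝ) (s : ℝ) :
    ∫⁻ x, ∏ i, ‖x i + v i‖ₑ ^ s ∂stdPi ι =
      ∏ i, ∫⁻ x, ‖x + v i‖ₑ ^ s ∂gaussianReal 0 1 := by
  rw [lintegral_prod_eq_prod_lintegral_of_indepFun Finset.univ
    (fun i (x : ι → ℝ) => ‖x i + v i‖ₑ ^ s) (iIndepFun_pi (X := fun i (x : ℝ) => ‖x + v i‖ₑ ^ s)
      fun i => by fun_prop) fun i => by fun_prop]
  exact Finset.prod_congr rfl fun i _ =>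
    (measurePreserving_eval (fun _ : ι => gaussianReal 0 1) i).lintegral_comp
      (f := fun x : ℝ => ‖x + v i‖ₑ ^ s) (by fun_prop)

-- The exponent `2p / n` of each coordinate in the AM-GM bound is at most `1/2`, where the
-- negative moments of a Gaussian variable are finite; Jensen makes their product bounded in `n`.
theorem exists_lintegral_div_dotProduct_self_pow_le {p : ℕ} (hp : p ≠ 0) :
    ∃ C : ℝ≥0, ∀ (n : ℕ) (v : Fin n → ℝ), 4 * p ≤ n →
      ∫⁻ x, ENNReal.ofReal ((n / ((x + v) ⬝ᵥ (x + v))) ^ p) ∂stdPi (Fin n) ≤ C := by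
  obtain ⟨C, hC⟩ := exists_lintegral_enorm_add_rpow_le (s := 1 / 2) (by norm_num) (by norm_num)
  refine ⟨C ^ (4 * p), fun n v hn => ?_⟩
  have : NeZero n := ⟨by omega⟩
  have hn₀ : (0 : ℝ) < n := by exact_mod_cast NeZero.pos n
  have hθ₀ : (0 : ℝ) < 4 * p / n := by
    have : (0 : ℝ) < p := by exact_mod_cast Nat.pos_of_ne_zero hp
    positivity
  have hθ₁ : (4 * p / n : ℝ) ≤ 1 := (div_le_one hn₀).2 (by exact_mod_cast hn)
  have coordinate (i : Fin n) :
      ∫⁻ x, ‖x + v i‖ₑ ^ (-(2 * p / n) : ℝ) ∂gaussianReal 0 1 ≤ (C : ℝ≥0∞) ^ (4 * p / n : ℝ) := by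
    have hexp : (-(2 * p / n) : ℝ) = -(1 / 2) * (4 * p / n) := by ring
    simp only [hexp, ENNReal.rpow_mul]
    exact (lintegral_rpow_le_rpow_lintegral _ (by fun_prop) hθ₀ hθ₁).trans
      (ENNReal.rpow_le_rpow (hC (v i)) hθ₀.le)
  calc ∫⁻ x, ENNReal.ofReal ((n / ((x + v) ⬝ᵥ (x + v))) ^ p) ∂stdPi (Fin n)
      ≤ ∫⁻ x, ∏ i, ‖x i + v i‖ₑ ^ (-(2 * p / n) : ℝ) ∂stdPi (Fin n) :=
        lintegral_mono fun x => by
          have h := ofReal_div_dotProduct_self_pow_le hp (x + v)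
          rwa [Fintype.card_fin] at h
    _ = ∏ i, ∫⁻ x, ‖x + v i‖ₑ ^ (-(2 * p / n) : ℝ) ∂gaussianReal 0 1 :=
        lintegral_prod_enorm_add_rpow v _
    _ ≤ ∏ _i : Fin n, (C : ℝ≥0∞) ^ (4 * p / n : ℝ) := Finset.prod_le_prod' fun i _ => coordinate i
    _ = ((C ^ (4 * p) : ℝ≥0) : ℝ≥0∞) := by
        rw [Finset.prod_const, Finset.card_univ, Fintype.card_fin, ← ENNReal.rpow_natCast,
          ← ENNReal.rpow_mul, div_mul_cancel₀ _ hn₀.ne', ENNReal.coe_pow,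
          ← ENNReal.rpow_natCast, Nat.cast_mul, Nat.cast_ofNat]

end NegativeMoments

section DotProduct

variable {ι κ : Type*} [Fintype ι] [Fintype κ]

theorem l2norm_sq (v : ι → ℝ) : l2norm v ^ 2 = v ⬝ᵥ v :=
  norm_toLp_sq v

theorem dotProduct_self_nonneg (v : ι → ℝ) : 0 ≤ v ⬝ᵥ v :=
  dotProduct_self_star_nonneg v

theorem dotProduct_self_pos {v : ι → ℝ} (hv : v ≠ 0) : 0 < v ⬝ᵥ v :=
  (dotProduct_self_nonneg v).lt_of_ne' fun h => hv (dotProduct_self_eq_zero.1 h)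

theorem smul_dotProduct_smul_self (c : ℝ) (v : ι → ℝ) :
    (c • v) ⬝ᵥ (c • v) = c ^ 2 * (v ⬝ᵥ v) := by
  rw [smul_dotProduct, dotProduct_smul, smul_eq_mul, smul_eq_mul, ← mul_assoc, sq]

theorem sq_dotProduct_le (u v : ι → ℝ) : (u ⬝ᵥ v) ^ 2 ≤ (u ⬝ᵥ u) * (v ⬝ᵥ v) := by
  simpa only [dotProduct, sq] using Finset.sum_mul_sq_le_sq_mul_sq Finset.univ u v

theorem abs_dotProduct_le_sqrt (u v : ι → ℝ) : |u ⬝ᵥ v| ≤ √(u ⬝ᵥ u) * √(v ⬝ᵥ v) := by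
  rw [← Real.sqrt_mul (dotProduct_self_nonneg u)]
  exact Real.abs_le_sqrt (sq_dotProduct_le u v)

theorem exists_eq_sqrt_smul (u : ι → ℝ) : ∃ u' : ι → ℝ, u' ⬝ᵥ u' ≤ 1 ∧ u = √(u ⬝ᵥ u) • u' := by
  refine ⟨(√(u ⬝ᵥ u))⁻¹ • u, ?_, ?_⟩
  · rw [smul_dotProduct_smul_self, inv_pow, Real.sq_sqrt (dotProduct_self_nonneg u)]
    exact inv_mul_le_one
  · rcases eq_or_ne u 0 with rfl | hu
    · simp
    · rw [smul_inv_smul₀ (Real.sqrt_pos.2 (dotProduct_self_pos hu)).ne']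

theorem sumElim_dotProduct (a : ι → ℝ) (b : κ → ℝ) (w : ι ⊕ κ → ℝ) :
    Sum.elim a b ⬝ᵥ w = a ⬝ᵥ (w ∘ Sum.inl) + b ⬝ᵥ (w ∘ Sum.inr) := by
  simp only [dotProduct, Fintype.sum_sum_type, Sum.elim_inl, Sum.elim_inr, Function.comp_apply]

theorem transpose_mulVec_dotProduct (M : Matrix ι κ ℝ) (u : ι → ℝ) (x : κ → ℝ) :
    (Mᵀ *ᵥ u) ⬝ᵥ x = u ⬝ᵥ (M *ᵥ x) := by
  rw [mulVec_transpose, dotProduct_mulVec]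

theorem mulVec_sq_le_frobenius (M : Matrix ι κ ℝ) (x : κ → ℝ) :
    (M *ᵥ x) ⬝ᵥ (M *ᵥ x) ≤ (∑ i, ∑ j, M i j ^ 2) * (x ⬝ᵥ x) := by
  calc (M *ᵥ x) ⬝ᵥ (M *ᵥ x) = ∑ i, (M i ⬝ᵥ x) ^ 2 := by simp only [dotProduct, mulVec, sq]
    _ ≤ ∑ i, (M i ⬝ᵥ M i) * (x ⬝ᵥ x) := Finset.sum_le_sum fun i _ => sq_dotProduct_le _ _
    _ = _ := by simp only [← Finset.sum_mul, dotProduct, sq]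

theorem mulVec_sq_le_of_rows {M : Matrix ι κ ℝ} {B : ℝ} (h : ∀ i, M i ⬝ᵥ M i ≤ B) (x : κ → ℝ) :
    (M *ᵥ x) ⬝ᵥ (M *ᵥ x) ≤ Fintype.card ι * B * (x ⬝ᵥ x) := by
  refine (mulVec_sq_le_frobenius M x).trans
    (mul_le_mul_of_nonneg_right ?_ (dotProduct_self_nonneg x))
  calc ∑ i, ∑ j, M i j ^ 2 = ∑ i, M i ⬝ᵥ M i := by simp only [dotProduct, sq]
    _ ≤ ∑ _i : ι, B := Finset.sum_le_sum fun i _ => h i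
    _ = _ := by rw [Finset.sum_const, Finset.card_univ, nsmul_eq_mul]

theorem transpose_mulVec_sq_le {M : Matrix ι κ ℝ} {c : ℝ} (hc : 0 ≤ c)
    (h : ∀ x, (M *ᵥ x) ⬝ᵥ (M *ᵥ x) ≤ c * (x ⬝ᵥ x)) (u : ι → ℝ) :
    (Mᵀ *ᵥ u) ⬝ᵥ (Mᵀ *ᵥ u) ≤ c * (u ⬝ᵥ u) := by
  set x := Mᵀ *ᵥ u
  have hxx : x ⬝ᵥ x = u ⬝ᵥ (M *ᵥ x) := transpose_mulVec_dotProduct M u x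
  have hu := dotProduct_self_nonneg u
  rcases (dotProduct_self_nonneg x).eq_or_lt with h0 | h0
  · rw [← h0]
    positivity
  · refine le_of_mul_le_mul_right ?_ h0
    calc (x ⬝ᵥ x) * (x ⬝ᵥ x) = (u ⬝ᵥ (M *ᵥ x)) ^ 2 := by rw [← hxx, sq]
      _ ≤ (u ⬝ᵥ u) * (c * (x ⬝ᵥ x)) :=
          (sq_dotProduct_le u (M *ᵥ x)).trans (mul_le_mul_of_nonneg_left (h x) hu)
      _ = c * (u ⬝ᵥ u) * (x ⬝ᵥ x) := by ring

theorem mulVec_sq_le_transpose_mulVec_sq {M : Matrix ι κ ℝ} {c : ℝ}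
    (h : ∀ z, c * (z ⬝ᵥ z) ≤ (M *ᵥ z) ⬝ᵥ (M *ᵥ z)) (z : κ → ℝ) :
    c * ((M *ᵥ z) ⬝ᵥ (M *ᵥ z)) ≤ (Mᵀ *ᵥ (M *ᵥ z)) ⬝ᵥ (Mᵀ *ᵥ (M *ᵥ z)) := by
  set x := M *ᵥ z with hx
  have hxx : (Mᵀ *ᵥ x) ⬝ᵥ z = x ⬝ᵥ x := transpose_mulVec_dotProduct M x z
  rcases eq_or_ne z 0 with rfl | hz
  · simp [hx]
  · refine le_of_mul_le_mul_right ?_ (dotProduct_self_pos hz)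
    calc c * (x ⬝ᵥ x) * (z ⬝ᵥ z) = (c * (z ⬝ᵥ z)) * (x ⬝ᵥ x) := by ring
      _ ≤ (x ⬝ᵥ x) * (x ⬝ᵥ x) := mul_le_mul_of_nonneg_right (h z) (dotProduct_self_nonneg x)
      _ = ((Mᵀ *ᵥ x) ⬝ᵥ z) ^ 2 := by rw [hxx, sq]
      _ ≤ _ := sq_dotProduct_le _ _

theorem mulVec_injective_of_lower_bound {M : Matrix ι κ ℝ} {c : ℝ} (hc : 0 < c)
    (h : ∀ z, c * (z ⬝ᵥ z) ≤ (M *ᵥ z) ⬝ᵥ (M *ᵥ z)) : Function.Injective M.mulVecLin := by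
  rw [← LinearMap.ker_eq_bot, LinearMap.ker_eq_bot']
  intro z hz
  rw [mulVecLin_apply] at hz
  have hle := h z
  rw [hz, zero_dotProduct] at hle
  exact dotProduct_self_eq_zero.1
    (le_antisymm (nonpos_of_mul_nonpos_right hle hc) (dotProduct_self_nonneg z))

theorem mulVec_surjective_of_lower_bound {M : Matrix ι ι ℝ} {c : ℝ} (hc : 0 < c)
    (h : ∀ z, c * (z ⬝ᵥ z) ≤ (M *ᵥ z) ⬝ᵥ (M *ᵥ z)) (x : ι → ℝ) : ∃ z, M *ᵥ z = x :=
  LinearMap.injective_iff_surjective.1 (mulVec_injective_of_lower_bound hc h) x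

theorem mulVec_lower_bound_of_transpose {M : Matrix ι ι ℝ} {c : ℝ} (hc : 0 < c)
    (h : ∀ u, c * (u ⬝ᵥ u) ≤ (Mᵀ *ᵥ u) ⬝ᵥ (Mᵀ *ᵥ u)) (x : ι → ℝ) :
    c * (x ⬝ᵥ x) ≤ (M *ᵥ x) ⬝ᵥ (M *ᵥ x) := by
  obtain ⟨z, rfl⟩ := mulVec_surjective_of_lower_bound hc h x
  simpa only [transpose_transpose] using mulVec_sq_le_transpose_mulVec_sq h z

theorem abs_dotProduct_mulVec_le_of_unit {M : Matrix ι κ ℝ} {k : ℝ}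
    (h : ∀ u v, u ⬝ᵥ u ≤ 1 → v ⬝ᵥ v ≤ 1 → |u ⬝ᵥ (M *ᵥ v)| ≤ k) (u : ι → ℝ) (v : κ → ℝ) :
    |u ⬝ᵥ (M *ᵥ v)| ≤ k * (√(u ⬝ᵥ u) * √(v ⬝ᵥ v)) := by
  obtain ⟨u', hu', hu⟩ := exists_eq_sqrt_smul u
  obtain ⟨v', hv', hv⟩ := exists_eq_sqrt_smul v
  calc |u ⬝ᵥ (M *ᵥ v)| = |√(u ⬝ᵥ u) * √(v ⬝ᵥ v) * (u' ⬝ᵥ (M *ᵥ v'))| := by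
        conv_lhs => rw [hu, hv, mulVec_smul, smul_dotProduct, dotProduct_smul, smul_eq_mul,
          smul_eq_mul, ← mul_assoc]
    _ = |u' ⬝ᵥ (M *ᵥ v')| * (√(u ⬝ᵥ u) * √(v ⬝ᵥ v)) := by
        rw [abs_mul, abs_of_nonneg (by positivity), mul_comm]
    _ ≤ _ := mul_le_mul_of_nonneg_right (h u' v' hu' hv') (by positivity)

theorem mulVec_sq_le_of_bilinear_le {M : Matrix ι κ ℝ} {k : ℝ}
    (h : ∀ u v, u ⬝ᵥ u ≤ 1 → v ⬝ᵥ v ≤ 1 → |u ⬝ᵥ (M *ᵥ v)| ≤ k) (x : κ → ℝ) :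
    (M *ᵥ x) ⬝ᵥ (M *ᵥ x) ≤ k ^ 2 * (x ⬝ᵥ x) := by
  set y := M *ᵥ x
  rcases eq_or_ne y 0 with hy0 | hy0
  · rw [hy0, zero_dotProduct]
    exact mul_nonneg (sq_nonneg k) (dotProduct_self_nonneg x)
  have hpos := Real.sqrt_pos.2 (dotProduct_self_pos hy0)
  have hle : √(y ⬝ᵥ y) ≤ k * √(x ⬝ᵥ x) := by
    refine le_of_mul_le_mul_left ?_ hpos
    calc √(y ⬝ᵥ y) * √(y ⬝ᵥ y) = y ⬝ᵥ y := Real.mul_self_sqrt (dotProduct_self_nonneg y)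
      _ ≤ k * (√(y ⬝ᵥ y) * √(x ⬝ᵥ x)) :=
          (le_abs_self _).trans (abs_dotProduct_mulVec_le_of_unit h y x)
      _ = √(y ⬝ᵥ y) * (k * √(x ⬝ᵥ x)) := by ring
  have hsq := pow_le_pow_left₀ hpos.le hle 2
  rwa [mul_pow, Real.sq_sqrt (dotProduct_self_nonneg y),
    Real.sq_sqrt (dotProduct_self_nonneg x)] at hsq

theorem sum_abs_le_sqrt_card_mul (v : ι → ℝ) :
    ∑ i, |v i| ≤ √(Fintype.card ι) * √(v ⬝ᵥ v) := by
  have h := abs_dotProduct_le_sqrt (fun _ : ι => (1 : ℝ)) fun i => |v i|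
  rw [abs_of_nonneg (Finset.sum_nonneg fun i _ => by positivity)] at h
  simpa [dotProduct] using h

theorem abs_dotProduct_mulVec_le {M : Matrix ι κ ℝ} {ε : ℝ} (hε : ∀ i j, |M i j| ≤ ε)
    (hε₀ : 0 ≤ ε) (x : ι → ℝ) (z : κ → ℝ) :
    |x ⬝ᵥ (M *ᵥ z)| ≤
      ε * (√(Fintype.card ι) * √(x ⬝ᵥ x)) * (√(Fintype.card κ) * √(z ⬝ᵥ z)) := by
  calc |x ⬝ᵥ (M *ᵥ z)| = |∑ i, ∑ j, x i * (M i j * z j)| := by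
        simp only [dotProduct, mulVec, Finset.mul_sum]
    _ ≤ ∑ i, ∑ j, |x i| * (ε * |z j|) := by
        refine (Finset.abs_sum_le_sum_abs _ _).trans (Finset.sum_le_sum fun i _ => ?_)
        refine (Finset.abs_sum_le_sum_abs _ _).trans (Finset.sum_le_sum fun j _ => ?_)
        rw [abs_mul, abs_mul]
        gcongr
        exact hε i j
    _ = ε * (∑ i, |x i|) * ∑ j, |z j| := by
        simp only [← Finset.mul_sum, ← Finset.sum_mul]
        ring
    _ ≤ _ := by
        gcongr
        · exact sum_abs_le_sqrt_card_mul x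
        · exact sum_abs_le_sqrt_card_mul z

end DotProduct

section MomentBounds

variable {α : Type*} [MeasurableSpace α] {μ : Measure α} {p : ℕ}

/-- The function `F` is measurable and its absolute moment of order `p` is finite and at most
`C`. -/
structure HasMomentBound (p : ℕ) (μ : Measure α) (F : α → ℝ) (C : ℝ) : Prop where
  measurable : Measurable F
  integrable : Integrable (fun x => |F x| ^ p) μ
  integral_le : ∫ x, |F x| ^ p ∂μ ≤ C

theorem HasMomentBound.mono {F : α → ℝ} {C C' : ℝ} (h : HasMomentBound p μ F C) (hC : C ≤ C') :
    HasMomentBound p μ F C' :=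
  ⟨h.measurable, h.integrable, h.integral_le.trans hC⟩

theorem HasMomentBound.of_lintegral_le {F : α → ℝ} {C : ℝ} (hF : Measurable F) (hC : 0 ≤ C)
    (h : ∫⁻ x, ENNReal.ofReal (|F x| ^ p) ∂μ ≤ ENNReal.ofReal C) : HasMomentBound p μ F C := by
  have hnonneg : 0 ≤ᵐ[μ] fun x => |F x| ^ p := .of_forall fun x => by positivity
  have hmeas : AEStronglyMeasurable (fun x => |F x| ^ p) μ :=
    (hF.abs.pow_const p).aestronglyMeasurable
  refine ⟨hF, ⟨hmeas, ?_⟩, ?_⟩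
  · exact (hasFiniteIntegral_iff_ofReal hnonneg).2 (h.trans_lt ENNReal.ofReal_lt_top)
  · rw [integral_eq_lintegral_of_nonneg_ae hnonneg hmeas]
    exact ENNReal.toReal_le_of_le_ofReal hC h

theorem prod_abs_le_one_add_sum_abs_pow {ι : Type*} [Fintype ι] (hp : Fintype.card ι ≤ p)
    (x : ι → ℝ) : ∏ i, |x i| ≤ 1 + ∑ i, |x i| ^ p := by
  rcases eq_or_ne p 0 with rfl | hp0
  · have := Fintype.card_eq_zero_iff.1 (Nat.le_zero.1 hp)
    simp
  set S := 1 + ∑ i, |x i| ^ p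
  have hsum : 0 ≤ ∑ i, |x i| ^ p := Finset.sum_nonneg fun i _ => by positivity
  have hS : 1 ≤ S := le_add_of_nonneg_right hsum
  have hle : ∀ i, |x i| ^ p ≤ S := fun i =>
    (Finset.single_le_sum (f := fun i => |x i| ^ p) (fun i _ => by positivity)
      (Finset.mem_univ i)).trans (le_add_of_nonneg_left zero_le_one)
  refine le_of_pow_le_pow_left₀ hp0 (by linarith) ?_
  calc (∏ i, |x i|) ^ p = ∏ i, |x i| ^ p := (Finset.prod_pow _ _ _).symm
    _ ≤ ∏ _i : ι, S := Finset.prod_le_prod (fun i _ => by positivity) fun i _ => hle i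
    _ = S ^ Fintype.card ι := by simp
    _ ≤ S ^ p := pow_le_pow_right₀ hS hp

theorem HasMomentBound.integrable_prod {ι : Type*} [Fintype ι] [IsFiniteMeasure μ]
    (hp : Fintype.card ι ≤ p) {F : ι → α → ℝ} {C : ι → ℝ}
    (h : ∀ i, HasMomentBound p μ (F i) (C i)) : Integrable (fun x => ∏ i, F i x) μ := by
  have hdom : Integrable (fun x => 1 + ∑ i, |F i x| ^ p) μ :=
    (integrable_const 1).add (integrable_finsetSum _ fun i _ => (h i).integrable)
  refine hdom.mono'
    (Finset.measurable_prod _ fun i _ => (h i).measurable).aestronglyMeasurable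
    (.of_forall fun x => ?_)
  rw [Real.norm_eq_abs, Finset.abs_prod]
  exact prod_abs_le_one_add_sum_abs_pow hp fun i => F i x

theorem HasMomentBound.integral_abs_prod_le {ι : Type*} [Fintype ι] [IsProbabilityMeasure μ]
    (hp : Fintype.card ι ≤ p) {F : ι → α → ℝ} {C : ℝ} (h : ∀ i, HasMomentBound p μ (F i) C) :
    ∫ x, |∏ i, F i x| ∂μ ≤ 1 + Fintype.card ι * C := by
  have hsum : Integrable (fun x => ∑ i, |F i x| ^ p) μ :=
    integrable_finsetSum _ fun i _ => (h i).integrable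
  calc ∫ x, |∏ i, F i x| ∂μ ≤ ∫ x, (1 + ∑ i, |F i x| ^ p) ∂μ :=
        integral_mono (integrable_prod hp h).abs ((integrable_const 1).add hsum) fun x =>
          (Finset.abs_prod _ _).trans_le (prod_abs_le_one_add_sum_abs_pow hp fun i => F i x)
    _ = 1 + ∑ i, ∫ x, |F i x| ^ p ∂μ := by
        rw [integral_add (integrable_const 1) hsum,
          integral_finsetSum _ fun i _ => (h i).integrable]
        simp
    _ ≤ 1 + ∑ _i : ι, C := by gcongr with i; exact (h i).integral_le
    _ = 1 + Fintype.card ι * C := by simp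

theorem HasMomentBound.abs_integral_prod_le {ι : Type*} [Fintype ι] [IsProbabilityMeasure μ]
    (hp : Fintype.card ι ≤ p) {F : ι → α → ℝ} {C : ℝ} (h : ∀ i, HasMomentBound p μ (F i) C) :
    |∫ x, ∏ i, F i x ∂μ| ≤ 1 + Fintype.card ι * C :=
  abs_integral_le_integral_abs.trans (integral_abs_prod_le hp h)

theorem hasMomentBound_dotProduct {ι : Type*} [Fintype ι] {a : ι → ℝ} {B : ℝ} (h : a ⬝ᵥ a ≤ B)
    (p : ℕ) :
    HasMomentBound p (stdPi ι) (fun x => a ⬝ᵥ x) (√B ^ p * ∫ x, |x| ^ p ∂gaussianReal 0 1) where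
  measurable := measurable_dotProduct a
  integrable := integrable_abs_dotProduct_pow a p
  integral_le := by
    rw [integral_abs_dotProduct_pow]
    gcongr

theorem sq_integral_abs_le_integral_mul_integral_sq_div {F G : α → ℝ} (hF : Integrable F μ)
    (hG : Integrable G μ) (hpos : ∀ᵐ x ∂μ, 0 < G x)
    (hFG : Integrable (fun x => F x ^ 2 / G x) μ) :
    (∫ x, |F x| ∂μ) ^ 2 ≤ (∫ x, G x ∂μ) * ∫ x, F x ^ 2 / G x ∂μ := by
  have hquad : ∀ θ : ℝ, 0 ≤ (∫ x, G x ∂μ) * (θ * θ) + -2 * (∫ x, |F x| ∂μ) * θ +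
      ∫ x, F x ^ 2 / G x ∂μ := fun θ => by
    have htangent : ∀ᵐ x ∂μ, 2 * θ * |F x| - θ ^ 2 * G x ≤ F x ^ 2 / G x := by
      filter_upwards [hpos] with x hx
      rw [le_div_iff₀ hx, ← sq_abs (F x)]
      nlinarith [sq_nonneg (|F x| - θ * G x)]
    have hint := integral_mono_ae ((hF.abs.const_mul (2 * θ)).sub (hG.const_mul (θ ^ 2))) hFG
      htangent
    simp only [Pi.sub_apply] at hint
    rw [integral_sub (hF.abs.const_mul _) (hG.const_mul _), integral_const_mul,
      integral_const_mul] at hint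
    linarith
  have hdiscrim := discrim_le_zero hquad
  rw [discrim] at hdiscrim
  linarith

end MomentBounds

section Reflection

variable {ι κ : Type*}

/-- The reflection `(h, k) ↦ (h, -k)`, which turns `Λ h + A k` into `Λ h - A k`. -/
def reflect (w : ι ⊕ κ → ℝ) : ι ⊕ κ → ℝ := Sum.elim (w ∘ Sum.inl) (-(w ∘ Sum.inr))

theorem measurePreserving_reflect [Fintype ι] [Fintype κ] :
    MeasurePreserving (reflect : (ι ⊕ κ → ℝ) → ι ⊕ κ → ℝ) (stdPi (ι ⊕ κ)) (stdPi (ι ⊕ κ)) := by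
  have hsign := measurePreserving_pi (fun _ : ι ⊕ κ => gaussianReal 0 1)
    (fun _ => gaussianReal 0 1) (f := fun i x => Sum.elim (fun _ => (1 : ℝ)) (fun _ => -1) i * x)
    fun i => by
      refine ⟨by fun_prop, ?_⟩
      rw [gaussianReal_map_const_mul]
      rcases i with i | i <;> simp
  convert hsign using 2
  ext i
  rcases i with i | i <;> simp [reflect]

end Reflection

section Design

variable {m N : ℕ} {Λ : Matrix (Fin N) (Fin m) ℝ} {A : Matrix (Fin N) (Fin N) ℝ} {B c₁ c₂ : ℝ}

/-- The common component `Λ h` of the vector `w = (h, k)`. -/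
def common (Λ : Matrix (Fin N) (Fin m) ℝ) (w : Fin m ⊕ Fin N → ℝ) : Fin N → ℝ :=
  Λ *ᵥ (w ∘ Sum.inl)

/-- The idiosyncratic component `A k` of the vector `w = (h, k)`. -/
def idio (A : Matrix (Fin N) (Fin N) ℝ) (w : Fin m ⊕ Fin N → ℝ) : Fin N → ℝ :=
  A *ᵥ (w ∘ Sum.inr)

/-- The observation `Λ h + A k` made from the vector `w = (h, k)`. -/
def obs (Λ : Matrix (Fin N) (Fin m) ℝ) (A : Matrix (Fin N) (Fin N) ℝ)
    (w : Fin m ⊕ Fin N → ℝ) : Fin N → ℝ :=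
  common Λ w + idio A w

/-- Bounds on the loadings and on the spectrum of `A Aᵀ` in a fixed dimension `N`: this is what
remains of the asymptotic assumptions once `N` is fixed. -/
structure DesignBounds (Λ : Matrix (Fin N) (Fin m) ℝ) (A : Matrix (Fin N) (Fin N) ℝ)
    (B c₁ c₂ : ℝ) : Prop where
  nonneg : 0 ≤ B
  upper_pos : 0 < c₁
  lower_pos : 0 < c₂
  rows : ∀ i, Λ i ⬝ᵥ Λ i ≤ B
  upper : ∀ u, (Aᵀ *ᵥ u) ⬝ᵥ (Aᵀ *ᵥ u) ≤ c₁ * (u ⬝ᵥ u)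
  lower : ∀ u, c₂ * (u ⬝ᵥ u) ≤ (Aᵀ *ᵥ u) ⬝ᵥ (Aᵀ *ᵥ u)

theorem DesignBounds.neg (h : DesignBounds Λ A B c₁ c₂) : DesignBounds Λ (-A) B c₁ c₂ where
  __ := h
  upper u := by simpa [transpose_neg, neg_mulVec] using h.upper u
  lower u := by simpa [transpose_neg, neg_mulVec] using h.lower u

theorem dotProduct_common (u : Fin N → ℝ) (w : Fin m ⊕ Fin N → ℝ) :
    u ⬝ᵥ common Λ w = Sum.elim (Λᵀ *ᵥ u) 0 ⬝ᵥ w := by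
  rw [sumElim_dotProduct, transpose_mulVec_dotProduct, zero_dotProduct, add_zero, common]

theorem dotProduct_idio (u : Fin N → ℝ) (w : Fin m ⊕ Fin N → ℝ) :
    u ⬝ᵥ idio A w = Sum.elim 0 (Aᵀ *ᵥ u) ⬝ᵥ w := by
  rw [sumElim_dotProduct, transpose_mulVec_dotProduct, zero_dotProduct, zero_add, idio]

theorem dotProduct_obs (u : Fin N → ℝ) (w : Fin m ⊕ Fin N → ℝ) :
    u ⬝ᵥ obs Λ A w = Sum.elim (Λᵀ *ᵥ u) (Aᵀ *ᵥ u) ⬝ᵥ w := by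
  rw [obs, dotProduct_add, sumElim_dotProduct, transpose_mulVec_dotProduct,
    transpose_mulVec_dotProduct, common, idio]

theorem common_dotProduct_eq_sum (v : Fin N → ℝ) (w : Fin m ⊕ Fin N → ℝ) :
    common Λ w ⬝ᵥ v = ∑ j, w (Sum.inl j) * (Λᵀ j ⬝ᵥ v) := by
  rw [dotProduct_comm, common, ← transpose_mulVec_dotProduct, dotProduct_comm]
  rfl

theorem idio_neg (w : Fin m ⊕ Fin N → ℝ) : idio (-A) w = -idio A w :=
  neg_mulVec _ _

theorem common_reflect (w : Fin m ⊕ Fin N → ℝ) : common Λ (reflect w) = common Λ w :=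
  rfl

theorem idio_reflect (w : Fin m ⊕ Fin N → ℝ) : idio A (reflect w) = -idio A w :=
  mulVec_neg _ _

theorem obs_reflect (w : Fin m ⊕ Fin N → ℝ) : obs Λ A (reflect w) = obs Λ (-A) w := by
  rw [obs, obs, common_reflect, idio_reflect, idio_neg]

theorem obs_neg_dotProduct_self (w : Fin m ⊕ Fin N → ℝ) :
    obs Λ (-A) w ⬝ᵥ obs Λ (-A) w =
      obs Λ A w ⬝ᵥ obs Λ A w - 4 * (common Λ w ⬝ᵥ idio A w) := by
  rw [obs, obs, idio_neg]
  simp only [add_dotProduct, dotProduct_add, neg_dotProduct, dotProduct_neg,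
    dotProduct_comm (idio A w) (common Λ w)]
  ring

theorem measurable_common : Measurable fun w => common Λ w := by
  unfold common mulVec dotProduct
  fun_prop

theorem measurable_obs : Measurable fun w => obs Λ A w := by
  unfold obs common idio mulVec dotProduct
  fun_prop

theorem measurable_obs_dotProduct_self : Measurable fun w => obs Λ A w ⬝ᵥ obs Λ A w := by
  have := measurable_obs (Λ := Λ) (A := A)
  unfold dotProduct
  fun_prop

theorem DesignBounds.ae_obs_ne_zero (h : DesignBounds Λ A B c₁ c₂) (hN : 0 < N) :
    ∀ᵐ w ∂stdPi (Fin m ⊕ Fin N), obs Λ A w ≠ 0 := by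
  obtain ⟨u, hu⟩ : ∃ u : Fin N → ℝ, u ≠ 0 := ⟨Pi.single ⟨0, hN⟩ 1, by simp⟩
  have hu0 : Aᵀ *ᵥ u ≠ 0 := fun h0 => by
    have hle := h.lower u
    rw [h0, zero_dotProduct] at hle
    exact (mul_pos h.lower_pos (dotProduct_self_pos hu)).not_ge hle
  have hr : Sum.elim (Λᵀ *ᵥ u) (Aᵀ *ᵥ u) ≠ 0 := fun h0 => hu0 (by
    rw [← Sum.elim_comp_inr (Λᵀ *ᵥ u) (Aᵀ *ᵥ u), h0]
    rfl)
  filter_upwards [ae_dotProduct_ne_zero hr] with w hw hobs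
  rw [← dotProduct_obs, hobs, dotProduct_zero] at hw
  exact hw rfl

theorem DesignBounds.exists_div_obs_le (h : DesignBounds Λ A B c₁ c₂) (a : Fin m → ℝ) :
    ∃ v : Fin N → ℝ, ∀ k : Fin N → ℝ,
      N / (obs Λ A (Sum.elim a k) ⬝ᵥ obs Λ A (Sum.elim a k)) ≤
        c₂⁻¹ * (N / ((k + v) ⬝ᵥ (k + v))) := by
  have hlower := mulVec_lower_bound_of_transpose h.lower_pos h.lower
  obtain ⟨v, hv⟩ := mulVec_surjective_of_lower_bound h.lower_pos hlower (Λ *ᵥ a)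
  refine ⟨v, fun k => ?_⟩
  have hobs : obs Λ A (Sum.elim a k) = A *ᵥ (k + v) := by
    rw [obs, common, idio, Sum.elim_comp_inl, Sum.elim_comp_inr, mulVec_add, hv, add_comm]
  rw [hobs]
  rcases eq_or_ne (k + v) 0 with hkv | hkv
  · simp [hkv]
  · have := h.lower_pos
    have := dotProduct_self_pos hkv
    rw [inv_mul_eq_div, div_div, mul_comm _ c₂]
    exact div_le_div_of_nonneg_left (Nat.cast_nonneg _) (by positivity) (hlower (k + v))

open scoped NNReal in
theorem DesignBounds.lintegral_div_obs_pow_le (h : DesignBounds Λ A B c₁ c₂) {p : ℕ} {C : ℝ≥0}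
    (hC : ∀ v : Fin N → ℝ,
      ∫⁻ k, ENNReal.ofReal ((N / ((k + v) ⬝ᵥ (k + v))) ^ p) ∂stdPi (Fin N) ≤ C) :
    ∫⁻ w, ENNReal.ofReal ((N / (obs Λ A w ⬝ᵥ obs Λ A w)) ^ p) ∂stdPi (Fin m ⊕ Fin N) ≤
      ENNReal.ofReal (c₂⁻¹ ^ p * C) := by
  have hpos := h.lower_pos
  have hsplit := measurePreserving_sumPiEquivProdPi_symm (X := fun _ : Fin m ⊕ Fin N => ℝ)
    fun _ => gaussianReal 0 1
  have hmeas : Measurable fun w => ENNReal.ofReal ((N / (obs Λ A w ⬝ᵥ obs Λ A w)) ^ p) :=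
    ((measurable_const.div measurable_obs_dotProduct_self).pow_const p).ennreal_ofReal
  rw [← hsplit.lintegral_comp hmeas]
  refine (lintegral_prod _ (hmeas.comp hsplit.measurable).aemeasurable).trans_le ?_
  refine (lintegral_mono fun a => ?_).trans_eq
    ((lintegral_const _).trans (by rw [measure_univ, mul_one]))
  obtain ⟨v, hv⟩ := h.exists_div_obs_le a
  calc _ ≤ ∫⁻ k, ENNReal.ofReal (c₂⁻¹ ^ p) *
        ENNReal.ofReal ((N / ((k + v) ⬝ᵥ (k + v))) ^ p) ∂stdPi (Fin N) := by
        refine lintegral_mono fun k => ?_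
        rw [← ENNReal.ofReal_mul (by positivity), ← mul_pow]
        exact ENNReal.ofReal_le_ofReal (pow_le_pow_left₀
          (div_nonneg (Nat.cast_nonneg _) (dotProduct_self_nonneg _)) (hv k) p)
    _ ≤ ENNReal.ofReal (c₂⁻¹ ^ p * C) := by
        rw [lintegral_const_mul' _ _ ENNReal.ofReal_ne_top, ENNReal.ofReal_mul (by positivity),
          ENNReal.ofReal_coe_nnreal]
        gcongr
        exact hC v

theorem exists_hasMomentBound_div_obs {p : ℕ} (hp : p ≠ 0) (c₂ : ℝ) :
    ∃ C : ℝ, ∀ (m N : ℕ) (Λ : Matrix (Fin N) (Fin m) ℝ) (A : Matrix (Fin N) (Fin N) ℝ) (B c₁ : ℝ),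
      4 * p ≤ N → DesignBounds Λ A B c₁ c₂ →
        HasMomentBound p (stdPi (Fin m ⊕ Fin N)) (fun w => N / (obs Λ A w ⬝ᵥ obs Λ A w)) C := by
  obtain ⟨C, hC⟩ := exists_lintegral_div_dotProduct_self_pow_le hp
  refine ⟨c₂⁻¹ ^ p * C, fun m N Λ A B c₁ hN h => .of_lintegral_le
    (measurable_const.div measurable_obs_dotProduct_self)
    (mul_nonneg (pow_nonneg (inv_nonneg.2 h.lower_pos.le) _) C.2) ?_⟩
  have habs : ∀ w, |(N : ℝ) / (obs Λ A w ⬝ᵥ obs Λ A w)| = N / (obs Λ A w ⬝ᵥ obs Λ A w) :=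
    fun w => abs_of_nonneg (div_nonneg (Nat.cast_nonneg _) (dotProduct_self_nonneg _))
  simp only [habs]
  exact h.lintegral_div_obs_pow_le fun v => hC N v hN

end Design

section DesignMoments

variable {m N p : ℕ} {Λ : Matrix (Fin N) (Fin m) ℝ} {A : Matrix (Fin N) (Fin N) ℝ}
  {B c₁ c₂ Q : ℝ} {u v : Fin N → ℝ}

/-- Bounds `Q` on the moments of order `p` of the factors that make up the entries of Kendall's
tau, each scaled to be of order one. -/
structure DesignMoments (p : ℕ) (Λ : Matrix (Fin N) (Fin m) ℝ) (A : Matrix (Fin N) (Fin N) ℝ)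
    (Q : ℝ) : Prop where
  common_form : ∀ u : Fin N → ℝ, u ⬝ᵥ u ≤ 1 →
    HasMomentBound p (stdPi (Fin m ⊕ Fin N)) (fun w => (√N)⁻¹ * (u ⬝ᵥ common Λ w)) Q
  idio_form : ∀ u : Fin N → ℝ, u ⬝ᵥ u ≤ 1 →
    HasMomentBound p (stdPi (Fin m ⊕ Fin N)) (fun w => u ⬝ᵥ idio A w) Q
  factor : ∀ j : Fin m, HasMomentBound p (stdPi (Fin m ⊕ Fin N)) (fun w => w (Sum.inl j)) Q
  loading_idio : ∀ j : Fin m,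
    HasMomentBound p (stdPi (Fin m ⊕ Fin N)) (fun w => (√N)⁻¹ * (Λᵀ j ⬝ᵥ idio A w)) Q
  inv : HasMomentBound p (stdPi (Fin m ⊕ Fin N)) (fun w => N / (obs Λ A w ⬝ᵥ obs Λ A w)) Q
  inv_neg : HasMomentBound p (stdPi (Fin m ⊕ Fin N))
    (fun w => N / (obs Λ (-A) w ⬝ᵥ obs Λ (-A) w)) Q

theorem inv_sqrt_smul_dotProduct_self_le {ι : Type*} [Fintype ι] {a : ι → ℝ} {C : ℝ}
    (hN : 0 < N) (h : a ⬝ᵥ a ≤ N * C) : ((√N)⁻¹ • a) ⬝ᵥ ((√N)⁻¹ • a) ≤ C := by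
  rw [smul_dotProduct_smul_self, inv_pow, Real.sq_sqrt (Nat.cast_nonneg _),
    inv_mul_le_iff₀ (by exact_mod_cast hN)]
  exact h

theorem DesignBounds.hasMomentBound_common_form (h : DesignBounds Λ A B c₁ c₂) (hN : 0 < N)
    (p : ℕ) (hu : u ⬝ᵥ u ≤ 1) :
    HasMomentBound p (stdPi (Fin m ⊕ Fin N)) (fun w => (√N)⁻¹ * (u ⬝ᵥ common Λ w))
      (√B ^ p * ∫ x, |x| ^ p ∂gaussianReal 0 1) := by
  have hNB : (0 : ℝ) ≤ N * B := mul_nonneg (Nat.cast_nonneg _) h.nonneg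
  have hcoeff : Sum.elim (Λᵀ *ᵥ u) (0 : Fin N → ℝ) ⬝ᵥ Sum.elim (Λᵀ *ᵥ u) 0 ≤ N * B := by
    rw [sumElim_dotProduct_sumElim, zero_dotProduct, add_zero]
    refine (transpose_mulVec_sq_le hNB (fun x => ?_) u).trans (mul_le_of_le_one_right hNB hu)
    simpa using mulVec_sq_le_of_rows h.rows x
  simpa only [smul_dotProduct, smul_eq_mul, ← dotProduct_common] using
    hasMomentBound_dotProduct (inv_sqrt_smul_dotProduct_self_le hN hcoeff) p

theorem DesignBounds.hasMomentBound_idio_form (h : DesignBounds Λ A B c₁ c₂) (p : ℕ)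
    (hu : u ⬝ᵥ u ≤ 1) :
    HasMomentBound p (stdPi (Fin m ⊕ Fin N)) (fun w => u ⬝ᵥ idio A w)
      (√c₁ ^ p * ∫ x, |x| ^ p ∂gaussianReal 0 1) := by
  have hcoeff : Sum.elim (0 : Fin m → ℝ) (Aᵀ *ᵥ u) ⬝ᵥ Sum.elim 0 (Aᵀ *ᵥ u) ≤ c₁ := by
    rw [sumElim_dotProduct_sumElim, zero_dotProduct, zero_add]
    exact (h.upper u).trans (mul_le_of_le_one_right h.upper_pos.le hu)
  simpa only [← dotProduct_idio] using hasMomentBound_dotProduct hcoeff p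

theorem DesignBounds.col_dotProduct_self_le (h : DesignBounds Λ A B c₁ c₂) (j : Fin m) :
    Λᵀ j ⬝ᵥ Λᵀ j ≤ N * B :=
  calc Λᵀ j ⬝ᵥ Λᵀ j = ∑ i, Λ i j * Λ i j := rfl
    _ ≤ ∑ _i : Fin N, B := Finset.sum_le_sum fun i _ =>
        (Finset.single_le_sum (f := fun j => Λ i j * Λ i j) (fun _ _ => mul_self_nonneg _)
          (Finset.mem_univ j)).trans (h.rows i)
    _ = N * B := by simp

theorem DesignBounds.hasMomentBound_loading_idio (h : DesignBounds Λ A B c₁ c₂) (hN : 0 < N)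
    (p : ℕ) (j : Fin m) :
    HasMomentBound p (stdPi (Fin m ⊕ Fin N)) (fun w => (√N)⁻¹ * (Λᵀ j ⬝ᵥ idio A w))
      (√(c₁ * B) ^ p * ∫ x, |x| ^ p ∂gaussianReal 0 1) := by
  have hcoeff : Sum.elim (0 : Fin m → ℝ) (Aᵀ *ᵥ Λᵀ j) ⬝ᵥ Sum.elim 0 (Aᵀ *ᵥ Λᵀ j) ≤
      N * (c₁ * B) := by
    rw [sumElim_dotProduct_sumElim, zero_dotProduct, zero_add]
    calc _ ≤ c₁ * (Λᵀ j ⬝ᵥ Λᵀ j) := h.upper _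
      _ ≤ c₁ * (N * B) := mul_le_mul_of_nonneg_left (h.col_dotProduct_self_le j) h.upper_pos.le
      _ = N * (c₁ * B) := by ring
  simpa only [smul_dotProduct, smul_eq_mul, ← dotProduct_idio] using
    hasMomentBound_dotProduct (inv_sqrt_smul_dotProduct_self_le hN hcoeff) p

theorem hasMomentBound_eval {ι : Type*} [Fintype ι] (p : ℕ) (i : ι) :
    HasMomentBound p (stdPi ι) (fun w => w i) (∫ x, |x| ^ p ∂gaussianReal 0 1) := by
  classical
  simpa using hasMomentBound_dotProduct (a := Pi.single i 1) (B := 1) (by simp) p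

theorem exists_designMoments (hp : p ≠ 0) (B c₁ c₂ : ℝ) :
    ∃ Q : ℝ, 0 ≤ Q ∧ ∀ (m N : ℕ) (Λ : Matrix (Fin N) (Fin m) ℝ) (A : Matrix (Fin N) (Fin N) ℝ),
      4 * p ≤ N → DesignBounds Λ A B c₁ c₂ → DesignMoments p Λ A Q := by
  obtain ⟨C, hC⟩ := exists_hasMomentBound_div_obs hp c₂
  set G := ∫ x, |x| ^ p ∂gaussianReal 0 1
  have hG : 0 ≤ G := integral_nonneg fun x => by positivity
  have hB : 0 ≤ √B ^ p * G := by positivity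
  have hc₁ : 0 ≤ √c₁ ^ p * G := by positivity
  have hc₁B : 0 ≤ √(c₁ * B) ^ p * G := by positivity
  refine ⟨√B ^ p * G + √c₁ ^ p * G + √(c₁ * B) ^ p * G + G + |C|, by positivity,
    fun m N Λ A hN h => ?_⟩
  have hN0 : 0 < N := by omega
  have hC0 := abs_nonneg C
  have hCle := le_abs_self C
  exact {
    common_form := fun u hu => (h.hasMomentBound_common_form hN0 p hu).mono (by linarith)
    idio_form := fun u hu => (h.hasMomentBound_idio_form p hu).mono (by linarith)
    factor := fun j => (hasMomentBound_eval p _).mono (by linarith)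
    loading_idio := fun j => (h.hasMomentBound_loading_idio hN0 p j).mono (by linarith)
    inv := (hC m N Λ A B c₁ hN h).mono (by linarith)
    inv_neg := (hC m N Λ (-A) B c₁ hN h.neg).mono (by linarith) }

/-- The contribution `uᵀ (Λ h) (A k)ᵀ v / ‖y‖²` of the common and idiosyncratic components to
`uᵀ (y yᵀ / ‖y‖²) v`, where `y = Λ h + A k`. -/
def crossTerm (Λ : Matrix (Fin N) (Fin m) ℝ) (A : Matrix (Fin N) (Fin N) ℝ) (u v : Fin N → ℝ)
    (w : Fin m ⊕ Fin N → ℝ) : ℝ :=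
  (obs Λ A w ⬝ᵥ obs Λ A w)⁻¹ * ((u ⬝ᵥ common Λ w) * (v ⬝ᵥ idio A w))

/-- The contribution `uᵀ (A k) (A k)ᵀ v / ‖y‖²` of the idiosyncratic component alone to
`uᵀ (y yᵀ / ‖y‖²) v`, where `y = Λ h + A k`. -/
def idioTerm (Λ : Matrix (Fin N) (Fin m) ℝ) (A : Matrix (Fin N) (Fin N) ℝ) (u v : Fin N → ℝ)
    (w : Fin m ⊕ Fin N → ℝ) : ℝ :=
  (obs Λ A w ⬝ᵥ obs Λ A w)⁻¹ * ((u ⬝ᵥ idio A w) * (v ⬝ᵥ idio A w))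

/-- The summands, of order one, into which the symmetrization of `crossTerm` under `reflect`
splits, up to the factor `-4 / N`. -/
def crossRemainder (Λ : Matrix (Fin N) (Fin m) ℝ) (A : Matrix (Fin N) (Fin N) ℝ)
    (u v : Fin N → ℝ) (j : Fin m) (w : Fin m ⊕ Fin N → ℝ) : ℝ :=
  N / (obs Λ A w ⬝ᵥ obs Λ A w) * (N / (obs Λ (-A) w ⬝ᵥ obs Λ (-A) w)) *
    ((√N)⁻¹ * (u ⬝ᵥ common Λ w)) * (v ⬝ᵥ idio A w) * w (Sum.inl j) *
    ((√N)⁻¹ * (Λᵀ j ⬝ᵥ idio A w))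

theorem crossTerm_add_crossTerm_reflect (hN : 0 < N) (u v : Fin N → ℝ) {w : Fin m ⊕ Fin N → ℝ}
    (hw : obs Λ A w ≠ 0) (hw' : obs Λ (-A) w ≠ 0) :
    crossTerm Λ A u v w + crossTerm Λ A u v (reflect w) =
      -(4 / N) * ∑ j, crossRemainder Λ A u v j w := by
  have hNpos : (0 : ℝ) < N := by exact_mod_cast hN
  have hsq : √(N : ℝ) ^ 2 = N := Real.sq_sqrt hNpos.le
  have hsqrt : √(N : ℝ) ≠ 0 := (Real.sqrt_pos.2 hNpos).ne'
  have hsum : ∑ j, crossRemainder Λ A u v j w = N / (obs Λ A w ⬝ᵥ obs Λ A w) *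
      (N / (obs Λ (-A) w ⬝ᵥ obs Λ (-A) w)) * ((√N)⁻¹ * (u ⬝ᵥ common Λ w)) *
      (v ⬝ᵥ idio A w) * ((√N)⁻¹ * (common Λ w ⬝ᵥ idio A w)) := by
    rw [common_dotProduct_eq_sum, Finset.mul_sum, Finset.mul_sum]
    refine Finset.sum_congr rfl fun j _ => ?_
    rw [crossRemainder]
    ring
  have hdiff := obs_neg_dotProduct_self (Λ := Λ) (A := A) w
  have ha := (dotProduct_self_pos hw).ne'
  have hb := (dotProduct_self_pos hw').ne'
  rw [hsum, crossTerm, crossTerm, obs_reflect, common_reflect, idio_reflect, dotProduct_neg]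
  set a := obs Λ A w ⬝ᵥ obs Λ A w
  set b := obs Λ (-A) w ⬝ᵥ obs Λ (-A) w
  have hcross : common Λ w ⬝ᵥ idio A w = (a - b) / 4 := by linarith
  rw [hcross]
  field_simp
  rw [hsq]
  ring

theorem DesignMoments.idioTerm_bound (hQ : DesignMoments p Λ A Q) (hp : 3 ≤ p) (hN : 0 < N)
    (hu : u ⬝ᵥ u ≤ 1) (hv : v ⬝ᵥ v ≤ 1) :
    Integrable (idioTerm Λ A u v) (stdPi (Fin m ⊕ Fin N)) ∧
      |∫ w, idioTerm Λ A u v w ∂stdPi (Fin m ⊕ Fin N)| ≤ (1 + 3 * Q) / N := by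
  have hNpos : (0 : ℝ) < N := by exact_mod_cast hN
  set F : Fin 3 → (Fin m ⊕ Fin N → ℝ) → ℝ :=
    ![fun w => N / (obs Λ A w ⬝ᵥ obs Λ A w), fun w => u ⬝ᵥ idio A w, fun w => v ⬝ᵥ idio A w]
  have hF : ∀ i, HasMomentBound p (stdPi (Fin m ⊕ Fin N)) (F i) Q := by
    simp only [Fin.forall_fin_succ]
    exact ⟨hQ.inv, hQ.idio_form u hu, hQ.idio_form v hv, fun i => i.elim0⟩
  have heq : idioTerm Λ A u v = fun w => (N : ℝ)⁻¹ * ∏ i, F i w := by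
    ext w
    simp only [idioTerm, F, Fin.prod_univ_three, Matrix.cons_val]
    field_simp
  rw [heq]
  refine ⟨(HasMomentBound.integrable_prod (by simpa using hp) hF).const_mul _, ?_⟩
  rw [integral_const_mul, abs_mul, abs_of_pos (inv_pos.2 hNpos), inv_mul_eq_div]
  gcongr
  simpa using HasMomentBound.abs_integral_prod_le (by simpa using hp) hF

theorem DesignMoments.integrable_crossTerm (hQ : DesignMoments p Λ A Q) (hp : 3 ≤ p) (hN : 0 < N)
    (hu : u ⬝ᵥ u ≤ 1) (hv : v ⬝ᵥ v ≤ 1) :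
    Integrable (crossTerm Λ A u v) (stdPi (Fin m ⊕ Fin N)) := by
  have hNpos : (0 : ℝ) < N := by exact_mod_cast hN
  have hsqrt : √(N : ℝ) ≠ 0 := (Real.sqrt_pos.2 hNpos).ne'
  set F : Fin 3 → (Fin m ⊕ Fin N → ℝ) → ℝ :=
    ![fun w => N / (obs Λ A w ⬝ᵥ obs Λ A w), fun w => (√N)⁻¹ * (u ⬝ᵥ common Λ w),
      fun w => v ⬝ᵥ idio A w]
  have hF : ∀ i, HasMomentBound p (stdPi (Fin m ⊕ Fin N)) (F i) Q := by
    simp only [Fin.forall_fin_succ]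
    exact ⟨hQ.inv, hQ.common_form u hu, hQ.idio_form v hv, fun i => i.elim0⟩
  have heq : crossTerm Λ A u v = fun w => (N : ℝ)⁻¹ * √N * ∏ i, F i w := by
    ext w
    simp only [crossTerm, F, Fin.prod_univ_three, Matrix.cons_val]
    field_simp
  rw [heq]
  exact (HasMomentBound.integrable_prod (by simpa using hp) hF).const_mul _

theorem DesignMoments.crossRemainder_bound (hQ : DesignMoments p Λ A Q) (hp : 6 ≤ p)
    (hu : u ⬝ᵥ u ≤ 1) (hv : v ⬝ᵥ v ≤ 1) (j : Fin m) :
    Integrable (crossRemainder Λ A u v j) (stdPi (Fin m ⊕ Fin N)) ∧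
      |∫ w, crossRemainder Λ A u v j w ∂stdPi (Fin m ⊕ Fin N)| ≤ 1 + 6 * Q := by
  set F : Fin 6 → (Fin m ⊕ Fin N → ℝ) → ℝ :=
    ![fun w => N / (obs Λ A w ⬝ᵥ obs Λ A w), fun w => N / (obs Λ (-A) w ⬝ᵥ obs Λ (-A) w),
      fun w => (√N)⁻¹ * (u ⬝ᵥ common Λ w), fun w => v ⬝ᵥ idio A w, fun w => w (Sum.inl j),
      fun w => (√N)⁻¹ * (Λᵀ j ⬝ᵥ idio A w)]
  have hF : ∀ i, HasMomentBound p (stdPi (Fin m ⊕ Fin N)) (F i) Q := by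
    simp only [Fin.forall_fin_succ]
    exact ⟨hQ.inv, hQ.inv_neg, hQ.common_form u hu, hQ.idio_form v hv, hQ.factor j,
      hQ.loading_idio j, fun i => i.elim0⟩
  have heq : crossRemainder Λ A u v j = fun w => ∏ i, F i w := by
    ext w
    simp only [crossRemainder, F, Fin.prod_univ_six, Matrix.cons_val]
  rw [heq]
  exact ⟨HasMomentBound.integrable_prod (by simpa using hp) hF, by
    simpa using HasMomentBound.abs_integral_prod_le (by simpa using hp) hF⟩

theorem DesignMoments.two_mul_integral_crossTerm (hQ : DesignMoments p Λ A Q) (hp : 6 ≤ p)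
    (hD : DesignBounds Λ A B c₁ c₂) (hN : 0 < N) (hu : u ⬝ᵥ u ≤ 1) (hv : v ⬝ᵥ v ≤ 1) :
    2 * ∫ w, crossTerm Λ A u v w ∂stdPi (Fin m ⊕ Fin N) =
      -(4 / N) * ∑ j, ∫ w, crossRemainder Λ A u v j w ∂stdPi (Fin m ⊕ Fin N) := by
  have hint := hQ.integrable_crossTerm (by omega) hN hu hv
  have hlaw := (measurePreserving_reflect (ι := Fin m) (κ := Fin N)).hasLaw
  have hint' : Integrable (fun w => crossTerm Λ A u v (reflect w)) (stdPi (Fin m ⊕ Fin N)) :=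
    measurePreserving_reflect.integrable_comp_of_integrable hint
  have hreflect : ∫ w, crossTerm Λ A u v (reflect w) ∂stdPi (Fin m ⊕ Fin N) =
      ∫ w, crossTerm Λ A u v w ∂stdPi (Fin m ⊕ Fin N) :=
    hlaw.integral_comp hint.aestronglyMeasurable
  calc 2 * ∫ w, crossTerm Λ A u v w ∂stdPi (Fin m ⊕ Fin N)
      = ∫ w, (crossTerm Λ A u v w + crossTerm Λ A u v (reflect w)) ∂stdPi (Fin m ⊕ Fin N) := by
        rw [integral_add hint hint', hreflect, two_mul]
    _ = ∫ w, -(4 / N) * ∑ j, crossRemainder Λ A u v j w ∂stdPi (Fin m ⊕ Fin N) := by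
        refine integral_congr_ae ?_
        filter_upwards [hD.ae_obs_ne_zero hN, hD.neg.ae_obs_ne_zero hN] with w hw hw'
        exact crossTerm_add_crossTerm_reflect hN u v hw hw'
    _ = _ := by
        rw [integral_const_mul, integral_finsetSum _ fun j _ =>
          (hQ.crossRemainder_bound hp hu hv j).1]

-- Each cross term is only of order `N ^ (-1/2)`; the leading part is odd in `k`, so it integrates
-- to zero and the mean is of the smaller order `1 / N`.
theorem DesignMoments.abs_integral_crossTerm_le (hQ : DesignMoments p Λ A Q) (hp : 6 ≤ p)
    (hD : DesignBounds Λ A B c₁ c₂) (hN : 0 < N) (hu : u ⬝ᵥ u ≤ 1) (hv : v ⬝ᵥ v ≤ 1) :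
    |∫ w, crossTerm Λ A u v w ∂stdPi (Fin m ⊕ Fin N)| ≤ 2 * m * (1 + 6 * Q) / N := by
  have : (0 : ℝ) < N := by exact_mod_cast hN
  set S := ∑ j, ∫ w, crossRemainder Λ A u v j w ∂stdPi (Fin m ⊕ Fin N)
  have hS : |S| ≤ m * (1 + 6 * Q) := by
    refine (Finset.abs_sum_le_sum_abs _ _).trans
      ((Finset.sum_le_sum fun j _ => (hQ.crossRemainder_bound hp hu hv j).2).trans_eq ?_)
    simp [mul_add]
  have hI : ∫ w, crossTerm Λ A u v w ∂stdPi (Fin m ⊕ Fin N) = -(2 / N) * S := by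
    linear_combination (1 / 2) * hQ.two_mul_integral_crossTerm hp hD hN hu hv
  rw [hI, abs_mul, abs_neg, abs_of_pos (by positivity)]
  calc 2 / (N : ℝ) * |S| ≤ 2 / N * (m * (1 + 6 * Q)) := by gcongr
    _ = _ := by ring

theorem DesignMoments.abs_integral_residual_le (hQ : DesignMoments p Λ A Q) (hp : 6 ≤ p)
    (hD : DesignBounds Λ A B c₁ c₂) (hN : 0 < N) (hu : u ⬝ᵥ u ≤ 1) (hv : v ⬝ᵥ v ≤ 1) :
    |∫ w, (obs Λ A w ⬝ᵥ obs Λ A w)⁻¹ * ((u ⬝ᵥ obs Λ A w) * (v ⬝ᵥ obs Λ A w) -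
      (u ⬝ᵥ common Λ w) * (v ⬝ᵥ common Λ w)) ∂stdPi (Fin m ⊕ Fin N)| ≤
      (4 * m * (1 + 6 * Q) + (1 + 3 * Q)) / N := by
  have huv := hQ.integrable_crossTerm (by omega) hN hu hv
  have hvu := hQ.integrable_crossTerm (by omega) hN hv hu
  obtain ⟨hidio, hidio_le⟩ := hQ.idioTerm_bound (by omega) hN hu hv
  have hsplit : ∀ w, (obs Λ A w ⬝ᵥ obs Λ A w)⁻¹ * ((u ⬝ᵥ obs Λ A w) * (v ⬝ᵥ obs Λ A w) -
      (u ⬝ᵥ common Λ w) * (v ⬝ᵥ common Λ w)) =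
      crossTerm Λ A u v w + crossTerm Λ A v u w + idioTerm Λ A u v w := fun w => by
    have hobs : ∀ x : Fin N → ℝ, x ⬝ᵥ obs Λ A w = x ⬝ᵥ common Λ w + x ⬝ᵥ idio A w := fun x =>
      dotProduct_add _ _ _
    rw [hobs u, hobs v, crossTerm, crossTerm, idioTerm]
    ring
  simp only [hsplit]
  have hcross : Integrable (fun w => crossTerm Λ A u v w + crossTerm Λ A v u w)
      (stdPi (Fin m ⊕ Fin N)) := huv.add hvu
  rw [integral_add hcross hidio, integral_add huv hvu]
  calc _ ≤ 2 * m * (1 + 6 * Q) / N + 2 * m * (1 + 6 * Q) / N + (1 + 3 * Q) / N :=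
        (abs_add_le _ _).trans (add_le_add ((abs_add_le _ _).trans (add_le_add
          (hQ.abs_integral_crossTerm_le hp hD hN hu hv)
          (hQ.abs_integral_crossTerm_le hp hD hN hv hu))) hidio_le)
    _ = _ := by ring

theorem DesignBounds.common_ratio_sq_le (hD : DesignBounds Λ A B c₁ c₂)
    (w : Fin m ⊕ Fin N → ℝ) :
    ((obs Λ A w ⬝ᵥ obs Λ A w)⁻¹ * (common Λ w ⬝ᵥ common Λ w)) ^ 2 ≤
      B ^ 2 * m * ∑ j, w (Sum.inl j) ^ 4 * (N / (obs Λ A w ⬝ᵥ obs Λ A w)) ^ 2 := by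
  set h : Fin m → ℝ := w ∘ Sum.inl
  have hinv := inv_nonneg.2 (dotProduct_self_nonneg (obs Λ A w))
  have hcommon : common Λ w ⬝ᵥ common Λ w ≤ N * B * (h ⬝ᵥ h) :=
    (mulVec_sq_le_of_rows hD.rows h).trans_eq (by rw [Fintype.card_fin])
  have hh : (h ⬝ᵥ h) ^ 2 ≤ m * ∑ j, h j ^ 4 := by
    refine (sq_sum_le_card_mul_sum_sq (s := Finset.univ) (f := fun j => h j * h j)).trans_eq ?_
    rw [Finset.card_univ, Fintype.card_fin]
    exact congrArg _ (Finset.sum_congr rfl fun j _ => by ring)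
  calc ((obs Λ A w ⬝ᵥ obs Λ A w)⁻¹ * (common Λ w ⬝ᵥ common Λ w)) ^ 2
      ≤ ((obs Λ A w ⬝ᵥ obs Λ A w)⁻¹ * (N * B * (h ⬝ᵥ h))) ^ 2 :=
        pow_le_pow_left₀ (mul_nonneg hinv (dotProduct_self_nonneg _))
          (mul_le_mul_of_nonneg_left hcommon hinv) 2
    _ = B ^ 2 * (N / (obs Λ A w ⬝ᵥ obs Λ A w)) ^ 2 * (h ⬝ᵥ h) ^ 2 := by
        rw [div_eq_mul_inv]
        ring
    _ ≤ B ^ 2 * (N / (obs Λ A w ⬝ᵥ obs Λ A w)) ^ 2 * (m * ∑ j, h j ^ 4) := by gcongr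
    _ = B ^ 2 * m * ∑ j, w (Sum.inl j) ^ 4 * (N / (obs Λ A w ⬝ᵥ obs Λ A w)) ^ 2 := by
        rw [← Finset.sum_mul]
        simp only [h, Function.comp_apply]
        ring

theorem DesignMoments.factor_pow_mul_inv_sq_bound (hQ : DesignMoments p Λ A Q) (hp : 6 ≤ p)
    (j : Fin m) :
    Integrable (fun w => w (Sum.inl j) ^ 4 * (N / (obs Λ A w ⬝ᵥ obs Λ A w)) ^ 2)
      (stdPi (Fin m ⊕ Fin N)) ∧
    ∫ w, w (Sum.inl j) ^ 4 * (N / (obs Λ A w ⬝ᵥ obs Λ A w)) ^ 2 ∂stdPi (Fin m ⊕ Fin N) ≤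
      1 + 6 * Q := by
  set F : Fin 4 ⊕ Fin 2 → (Fin m ⊕ Fin N → ℝ) → ℝ :=
    Sum.elim (fun _ w => w (Sum.inl j)) (fun _ w => N / (obs Λ A w ⬝ᵥ obs Λ A w))
  have hF : ∀ i, HasMomentBound p (stdPi (Fin m ⊕ Fin N)) (F i) Q := by
    rintro (_ | _)
    exacts [hQ.factor j, hQ.inv]
  have heq : (fun w => w (Sum.inl j) ^ 4 * (N / (obs Λ A w ⬝ᵥ obs Λ A w)) ^ 2) =
      fun w => ∏ i, F i w := by
    ext w
    simp only [F, Fintype.prod_sum_type, Sum.elim_inl, Sum.elim_inr, Finset.prod_const,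
      Finset.card_univ, Fintype.card_fin]
  rw [heq]
  refine ⟨HasMomentBound.integrable_prod (by simpa using hp) hF, (le_abs_self _).trans ?_⟩
  refine (HasMomentBound.abs_integral_prod_le (by simpa using hp) hF).trans_eq ?_
  norm_num

theorem DesignMoments.common_ratio_sq_bound (hQ : DesignMoments p Λ A Q) (hp : 6 ≤ p)
    (hD : DesignBounds Λ A B c₁ c₂) :
    Integrable (fun w => ((obs Λ A w ⬝ᵥ obs Λ A w)⁻¹ * (common Λ w ⬝ᵥ common Λ w)) ^ 2)
      (stdPi (Fin m ⊕ Fin N)) ∧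
    ∫ w, ((obs Λ A w ⬝ᵥ obs Λ A w)⁻¹ * (common Λ w ⬝ᵥ common Λ w)) ^ 2
      ∂stdPi (Fin m ⊕ Fin N) ≤ B ^ 2 * m * (m * (1 + 6 * Q)) := by
  have hbound := fun j => hQ.factor_pow_mul_inv_sq_bound hp j
  have hdom : Integrable (fun w => B ^ 2 * m *
      ∑ j : Fin m, w (Sum.inl j) ^ 4 * (N / (obs Λ A w ⬝ᵥ obs Λ A w)) ^ 2)
      (stdPi (Fin m ⊕ Fin N)) :=
    (integrable_finsetSum _ fun j _ => (hbound j).1).const_mul _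
  have hmeas : Measurable fun w =>
      ((obs Λ A w ⬝ᵥ obs Λ A w)⁻¹ * (common Λ w ⬝ᵥ common Λ w)) ^ 2 := by
    have hobs := measurable_obs_dotProduct_self (Λ := Λ) (A := A)
    have hcommon := measurable_common (Λ := Λ)
    unfold dotProduct at hobs ⊢
    fun_prop
  have hint := hdom.mono' hmeas.aestronglyMeasurable (.of_forall fun w => by
    rw [Real.norm_eq_abs, abs_of_nonneg (sq_nonneg _)]
    exact hD.common_ratio_sq_le w)
  refine ⟨hint, (integral_mono hint hdom hD.common_ratio_sq_le).trans ?_⟩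
  rw [integral_const_mul, integral_finsetSum _ fun j _ => (hbound j).1]
  refine mul_le_mul_of_nonneg_left ?_ (by positivity)
  exact (Finset.sum_le_sum fun j _ => (hbound j).2).trans_eq (by simp [mul_add])

theorem DesignBounds.obs_apply_sq_bound (hD : DesignBounds Λ A B c₁ c₂) (i : Fin N) :
    Integrable (fun w => obs Λ A w i * obs Λ A w i) (stdPi (Fin m ⊕ Fin N)) ∧
      ∫ w, obs Λ A w i * obs Λ A w i ∂stdPi (Fin m ⊕ Fin N) ≤ B + c₁ := by
  set r : Fin m ⊕ Fin N → ℝ := Sum.elim (Λ i) (A i)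
  have hobs : ∀ w, obs Λ A w i * obs Λ A w i = |r ⬝ᵥ w| ^ 2 := fun w => by
    rw [sq_abs, sumElim_dotProduct, sq]
    rfl
  have hrow : A i ⬝ᵥ A i ≤ c₁ := by
    have hcol : Aᵀ *ᵥ Pi.single i 1 = A i := by
      ext
      simp
    simpa [hcol] using hD.upper (Pi.single i 1)
  simp only [hobs]
  refine ⟨integrable_abs_dotProduct_pow r 2, ?_⟩
  rw [integral_abs_dotProduct_pow, integral_sq_gaussianReal, mul_one,
    Real.sq_sqrt (dotProduct_self_nonneg r), sumElim_dotProduct_sumElim]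
  exact add_le_add (hD.rows i) hrow

theorem DesignBounds.obs_dotProduct_self_bound (hD : DesignBounds Λ A B c₁ c₂) :
    Integrable (fun w => obs Λ A w ⬝ᵥ obs Λ A w) (stdPi (Fin m ⊕ Fin N)) ∧
      ∫ w, obs Λ A w ⬝ᵥ obs Λ A w ∂stdPi (Fin m ⊕ Fin N) ≤ N * (B + c₁) := by
  have hbound := fun i => hD.obs_apply_sq_bound i
  refine ⟨integrable_finsetSum _ fun i _ => (hbound i).1, ?_⟩
  simp only [dotProduct]
  rw [integral_finsetSum _ fun i _ => (hbound i).1]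
  exact (Finset.sum_le_sum fun i _ => (hbound i).2).trans_eq (by simp [mul_add])

theorem integrable_sq_dotProduct_obs_div (x : Fin N → ℝ) :
    Integrable (fun w => (x ⬝ᵥ obs Λ A w) ^ 2 / (obs Λ A w ⬝ᵥ obs Λ A w))
      (stdPi (Fin m ⊕ Fin N)) := by
  have hmeas : Measurable fun w => (x ⬝ᵥ obs Λ A w) ^ 2 / (obs Λ A w ⬝ᵥ obs Λ A w) :=
    (((measurable_dotProduct x).comp measurable_obs).pow_const 2).div
      measurable_obs_dotProduct_self
  refine (integrable_const (x ⬝ᵥ x)).mono' hmeas.aestronglyMeasurable (.of_forall fun w => ?_)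
  have hobs := dotProduct_self_nonneg (obs Λ A w)
  rw [Real.norm_eq_abs, abs_of_nonneg (by positivity)]
  exact div_le_of_le_mul₀ hobs (dotProduct_self_nonneg x) (sq_dotProduct_le x _)

theorem DesignBounds.le_integral_obs_sq (hD : DesignBounds Λ A B c₁ c₂) (hN : 0 < N)
    (x : Fin N → ℝ) :
    (∫ t, |t| ∂gaussianReal 0 1) ^ 2 * ((Λᵀ *ᵥ x) ⬝ᵥ (Λᵀ *ᵥ x)) / (N * (B + c₁)) ≤
      ∫ w, (x ⬝ᵥ obs Λ A w) ^ 2 / (obs Λ A w ⬝ᵥ obs Λ A w) ∂stdPi (Fin m ⊕ Fin N) := by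
  have : (0 : ℝ) < N := by exact_mod_cast hN
  have hB := hD.nonneg
  have hc₁ := hD.upper_pos
  set r : Fin m ⊕ Fin N → ℝ := Sum.elim (Λᵀ *ᵥ x) (Aᵀ *ᵥ x) with hr
  have hrr : (Λᵀ *ᵥ x) ⬝ᵥ (Λᵀ *ᵥ x) ≤ r ⬝ᵥ r := by
    rw [hr, sumElim_dotProduct_sumElim]
    exact le_add_of_nonneg_right (dotProduct_self_nonneg _)
  have hform : Integrable (fun w => x ⬝ᵥ obs Λ A w) (stdPi (Fin m ⊕ Fin N)) := by
    simp only [dotProduct_obs]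
    refine (integrable_norm_iff (measurable_dotProduct r).aestronglyMeasurable).1 ?_
    simpa using integrable_abs_dotProduct_pow r 1
  have habs : ∫ w, |x ⬝ᵥ obs Λ A w| ∂stdPi (Fin m ⊕ Fin N) =
      √(r ⬝ᵥ r) * ∫ t, |t| ∂gaussianReal 0 1 := by
    simp only [dotProduct_obs]
    simpa using integral_abs_dotProduct_pow r 1
  obtain ⟨hobs, hobs_le⟩ := hD.obs_dotProduct_self_bound
  have hcauchy := sq_integral_abs_le_integral_mul_integral_sq_div hform hobs
    ((hD.ae_obs_ne_zero hN).mono fun w => dotProduct_self_pos)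
    (integrable_sq_dotProduct_obs_div x)
  rw [habs, mul_pow, Real.sq_sqrt (dotProduct_self_nonneg r)] at hcauchy
  have hratio : 0 ≤ ∫ w, (x ⬝ᵥ obs Λ A w) ^ 2 / (obs Λ A w ⬝ᵥ obs Λ A w)
      ∂stdPi (Fin m ⊕ Fin N) :=
    integral_nonneg fun w => div_nonneg (sq_nonneg _) (dotProduct_self_nonneg _)
  rw [div_le_iff₀ (by positivity)]
  calc _ ≤ (∫ t, |t| ∂gaussianReal 0 1) ^ 2 * (r ⬝ᵥ r) := by gcongr
    _ ≤ _ := by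
        rw [mul_comm]
        refine hcauchy.trans ?_
        rw [mul_comm]
        gcongr

end DesignMoments

theorem exists_ne_zero_forall_dotProduct_mulVec_eq_zero {ι n κ : Type*} [Fintype ι] [Fintype n]
    [Fintype κ] (h : Fintype.card ι < Fintype.card κ) (u : ι → n → ℝ) (M : Matrix n κ ℝ) :
    ∃ b ≠ 0, ∀ i, u i ⬝ᵥ (M *ᵥ b) = 0 := by
  have hker : LinearMap.ker (Matrix.of u * M).mulVecLin ≠ ⊥ :=
    LinearMap.ker_ne_bot_of_finrank_lt (by simpa using h)
  obtain ⟨b, hb, hb₀⟩ := Submodule.exists_mem_ne_zero_of_ne_bot hker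
  rw [LinearMap.mem_ker, mulVecLin_apply, ← mulVec_mulVec] at hb
  exact ⟨b, hb₀, congrFun hb⟩

section Spectral

variable {n : Type*} [Fintype n] [DecidableEq n] {K : Matrix n n ℝ}

theorem sum_eigenvectorBasis_dotProduct (hK : K.IsHermitian) (x z : n → ℝ) :
    ∑ i, (⇑(hK.eigenvectorBasis i) ⬝ᵥ x) * (⇑(hK.eigenvectorBasis i) ⬝ᵥ z) = x ⬝ᵥ z := by
  have h := hK.eigenvectorBasis.sum_inner_mul_inner (WithLp.toLp 2 x) (WithLp.toLp 2 z)
  simp only [EuclideanSpace.inner_eq_star_dotProduct, star_trivial] at h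
  rw [dotProduct_comm x z, ← h]
  exact Finset.sum_congr rfl fun i _ => by rw [dotProduct_comm z]

theorem dotProduct_mulVec_eq_sum_eigenvalues (hK : K.IsHermitian) (x : n → ℝ) :
    x ⬝ᵥ (K *ᵥ x) = ∑ i, hK.eigenvalues i * (⇑(hK.eigenvectorBasis i) ⬝ᵥ x) ^ 2 := by
  have hKT : Kᵀ = K := by
    rw [← conjTranspose_eq_transpose_of_trivial, hK.eq]
  rw [← sum_eigenvectorBasis_dotProduct hK]
  refine Finset.sum_congr rfl fun i _ => ?_
  rw [← transpose_mulVec_dotProduct, hKT, hK.mulVec_eigenvectorBasis i, smul_dotProduct,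
    smul_eq_mul]
  ring

theorem le_dotProduct_mulVec (hK : K.IsHermitian) {c : ℝ} (h : ∀ i, c ≤ hK.eigenvalues i)
    (x : n → ℝ) : c * (x ⬝ᵥ x) ≤ x ⬝ᵥ (K *ᵥ x) := by
  rw [dotProduct_mulVec_eq_sum_eigenvalues hK, ← sum_eigenvectorBasis_dotProduct hK,
    Finset.mul_sum]
  simp only [← sq]
  gcongr with i
  exact h i

theorem dotProduct_mulVec_le (hK : K.IsHermitian) {c : ℝ} (h : ∀ i, hK.eigenvalues i ≤ c)
    (x : n → ℝ) : x ⬝ᵥ (K *ᵥ x) ≤ c * (x ⬝ᵥ x) := by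
  rw [dotProduct_mulVec_eq_sum_eigenvalues hK, ← sum_eigenvectorBasis_dotProduct hK,
    Finset.mul_sum]
  simp only [← sq]
  gcongr with i
  exact h i

theorem dotProduct_mulVec_le_eigenvalues₀ (hK : K.IsHermitian) (k : Fin (Fintype.card n))
    {x : n → ℝ} (hx : ∀ i < k, ⇑(hK.eigenvectorBasis
      (Fintype.equivOfCardEq (Fintype.card_fin _) i)) ⬝ᵥ x = 0) :
    x ⬝ᵥ (K *ᵥ x) ≤ hK.eigenvalues₀ k * (x ⬝ᵥ x) := by
  set e : Fin (Fintype.card n) ≃ n := Fintype.equivOfCardEq (Fintype.card_fin _)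
  have heig : ∀ i, hK.eigenvalues i = hK.eigenvalues₀ (e.symm i) := fun _ => rfl
  rw [dotProduct_mulVec_eq_sum_eigenvalues hK, ← sum_eigenvectorBasis_dotProduct hK,
    Finset.mul_sum]
  refine Finset.sum_le_sum fun i _ => ?_
  rw [← sq, heig]
  rcases lt_or_ge (e.symm i) k with hi | hi
  · have hzero := hx (e.symm i) hi
    rw [e.apply_symm_apply] at hzero
    rw [hzero, zero_pow two_ne_zero, mul_zero, mul_zero]
  · exact mul_le_mul_of_nonneg_right (hK.eigenvalues₀_antitone hi) (sq_nonneg _)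

-- Half of the Courant–Fischer principle: dimension counting gives a nonzero vector in the range
-- of `M` that is orthogonal to the first `j` eigenvectors.
theorem le_descEig {N m : ℕ} {K : Matrix (Fin N) (Fin N) ℝ} (hK : K.IsHermitian)
    {M : Matrix (Fin N) (Fin m) ℝ} (hM : Function.Injective M.mulVecLin) {c : ℝ}
    (h : ∀ b, c * ((M *ᵥ b) ⬝ᵥ (M *ᵥ b)) ≤ (M *ᵥ b) ⬝ᵥ (K *ᵥ (M *ᵥ b))) (j : Fin m) :
    c ≤ descEig hK j := by
  have hmN : m ≤ N := by simpa using LinearMap.finrank_le_finrank_of_injective hM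
  have hj : (j : ℕ) < Fintype.card (Fin N) := by
    rw [Fintype.card_fin]
    omega
  rw [descEig, dif_pos hj]
  obtain ⟨b, hb₀, hb⟩ := exists_ne_zero_forall_dotProduct_mulVec_eq_zero (ι := Fin j)
    (by simp) (fun i => hK.eigenvectorBasis (Fintype.equivOfCardEq (Fintype.card_fin _)
      (⟨i, i.2.trans hj⟩ : Fin (Fintype.card (Fin N))))) M
  have hMb : M *ᵥ b ≠ 0 := fun hzero => hb₀ (hM (by simpa using hzero))
  exact le_of_mul_le_mul_right ((h b).trans
    (dotProduct_mulVec_le_eigenvalues₀ hK ⟨j, hj⟩ fun i hi => hb ⟨i, hi⟩))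
    (dotProduct_self_pos hMb)

end Spectral

section Loading

variable {m N T : ℕ} {Λ L : Matrix (Fin N) (Fin m) ℝ} {f : ℕ → Fin m → ℝ} {y : ℕ → Fin N → ℝ}
  {c Δ : ℝ}

/-- The part `K̂ - Λ M₁ Λᵀ` of the sample Kendall's tau matrix that is not due to the factors. -/
def residual (T : ℕ) (Λ : Matrix (Fin N) (Fin m) ℝ) (f : ℕ → Fin m → ℝ) (y : ℕ → Fin N → ℝ) :
    Matrix (Fin N) (Fin N) ℝ :=
  kendall T y - Λ * pairAverage T y f f * Λᵀ

/-- The leading sample eigenvalues are at least `c > 0` and the residual part of the sample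
Kendall's tau matrix has operator norm at most `Δ`: the event on which every loading estimate is
close to a rotation of `Λ`. -/
structure SpectralBounds (T : ℕ) (Λ : Matrix (Fin N) (Fin m) ℝ) (f : ℕ → Fin m → ℝ)
    (y : ℕ → Fin N → ℝ) (c Δ : ℝ) : Prop where
  pos : 0 < c
  nonneg : 0 ≤ Δ
  le_eig : ∀ j : Fin m, c ≤ descEig (kendall_isHermitian T y) j
  residual_le : ∀ x, (residual T Λ f y *ᵥ x) ⬝ᵥ (residual T Λ f y *ᵥ x) ≤ Δ ^ 2 * (x ⬝ᵥ x)

theorem IsRTSLoading.sub_rotation_eq (hL : IsRTSLoading T y L)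
    (hS : SpectralBounds T Λ f y c Δ) :
    L - Λ * rotation T Λ f y L = residual T Λ f y * L * (eigMatrix m T y)⁻¹ := by
  have hdet : IsUnit (eigMatrix m T y).det := by
    rw [eigMatrix, det_diagonal, isUnit_iff_ne_zero]
    exact Finset.prod_ne_zero_iff.2 fun j _ => (hS.pos.trans_le (hS.le_eig j)).ne'
  have hKL : kendall T y * L * (eigMatrix m T y)⁻¹ = L := by
    rw [hL.2, mul_nonsing_inv_cancel_right _ _ hdet]
  rw [residual, Matrix.sub_mul, Matrix.sub_mul, hKL, rotation]
  simp only [Matrix.mul_assoc]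

theorem IsRTSLoading.col_sub_rotation (hL : IsRTSLoading T y L)
    (hS : SpectralBounds T Λ f y c Δ) (j : Fin m) :
    (L - Λ * rotation T Λ f y L)ᵀ j =
      (descEig (kendall_isHermitian T y) j)⁻¹ • (residual T Λ f y *ᵥ Lᵀ j) := by
  have hinv : (eigMatrix m T y)⁻¹ =
      diagonal fun j : Fin m => (descEig (kendall_isHermitian T y) j)⁻¹ := by
    refine Matrix.inv_eq_left_inv ?_
    rw [eigMatrix, diagonal_mul_diagonal, ← diagonal_one]
    congr 1
    ext k
    exact inv_mul_cancel₀ (hS.pos.trans_le (hS.le_eig k)).ne'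
  ext i
  rw [hL.sub_rotation_eq hS, hinv, transpose_apply, mul_diagonal, Pi.smul_apply, smul_eq_mul,
    mul_comm]
  rfl

theorem IsRTSLoading.col_dotProduct (hL : IsRTSLoading T y L) (i j : Fin m) :
    Lᵀ i ⬝ᵥ Lᵀ j = N * (1 : Matrix (Fin m) (Fin m) ℝ) i j :=
  congrFun (congrFun hL.1 i) j

theorem IsRTSLoading.col_sub_rotation_sq_le (hL : IsRTSLoading T y L)
    (hS : SpectralBounds T Λ f y c Δ) (j : Fin m) :
    (L - Λ * rotation T Λ f y L)ᵀ j ⬝ᵥ (L - Λ * rotation T Λ f y L)ᵀ j ≤ (Δ / c) ^ 2 * N := by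
  have hc := hS.pos
  have heig := hS.le_eig j
  have hres := hS.residual_le (Lᵀ j)
  rw [hL.col_dotProduct, one_apply_eq, mul_one] at hres
  rw [hL.col_sub_rotation hS, smul_dotProduct_smul_self, inv_pow, div_pow, div_eq_inv_mul,
    mul_assoc]
  gcongr
  exact dotProduct_self_nonneg _

theorem maxError_nonneg (L Λ : Matrix (Fin N) (Fin m) ℝ) (H : Matrix (Fin m) (Fin m) ℝ) :
    0 ≤ maxError L Λ H :=
  Real.iSup_nonneg fun _ => norm_nonneg _

theorem IsRTSLoading.maxError_le (hL : IsRTSLoading T y L)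
    (hS : SpectralBounds T Λ f y c Δ) :
    maxError L Λ (rotation T Λ f y L) ≤ √m * (Δ / c * √N) := by
  have hc := hS.pos
  have hΔ := hS.nonneg
  set H := rotation T Λ f y L
  set E := L - Λ * H
  have hrow : ∀ i, L i - Hᵀ *ᵥ Λ i = E i := fun i => by
    rw [mulVec_transpose]
    rfl
  refine Real.iSup_le (fun i => ?_) (by positivity)
  refine le_of_sq_le_sq ?_ (by positivity)
  calc l2norm (L i - Hᵀ *ᵥ Λ i) ^ 2 = ∑ j, Eᵀ j i * Eᵀ j i := by
        rw [l2norm_sq, hrow]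
        rfl
    _ ≤ ∑ _j : Fin m, (Δ / c) ^ 2 * N := Finset.sum_le_sum fun j _ =>
        (Finset.single_le_sum (f := fun i => Eᵀ j i * Eᵀ j i)
          (fun _ _ => mul_self_nonneg _) (Finset.mem_univ i)).trans
          (hL.col_sub_rotation_sq_le hS j)
    _ = (√m * (Δ / c * √N)) ^ 2 := by
        rw [mul_pow, mul_pow (Δ / c), Real.sq_sqrt (Nat.cast_nonneg _),
          Real.sq_sqrt (Nat.cast_nonneg _), Finset.sum_const, Finset.card_univ, Fintype.card_fin,
          nsmul_eq_mul]

theorem abs_sub_dotProduct_sub_sub_le {ι : Type*} [Fintype ι] {u v a b : ι → ℝ} {r η : ℝ}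
    (hη₀ : 0 ≤ η) (hη₁ : η ≤ 1) (hu : √(u ⬝ᵥ u) ≤ r) (hv : √(v ⬝ᵥ v) ≤ r)
    (ha : √(a ⬝ᵥ a) ≤ η * r) (hb : √(b ⬝ᵥ b) ≤ η * r) :
    |(u - a) ⬝ᵥ (v - b) - u ⬝ᵥ v| ≤ 3 * η * r ^ 2 := by
  have hr : 0 ≤ r := (Real.sqrt_nonneg _).trans hu
  have hub : |u ⬝ᵥ b| ≤ r * (η * r) :=
    (abs_dotProduct_le_sqrt u b).trans (by gcongr)
  have hav : |a ⬝ᵥ v| ≤ η * r * r :=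
    (abs_dotProduct_le_sqrt a v).trans (by gcongr)
  have hab : |a ⬝ᵥ b| ≤ η * r * (1 * r) :=
    (abs_dotProduct_le_sqrt a b).trans (by gcongr; exact hb.trans (by gcongr))
  have hsplit : (u - a) ⬝ᵥ (v - b) - u ⬝ᵥ v = a ⬝ᵥ b - u ⬝ᵥ b - a ⬝ᵥ v := by
    rw [sub_dotProduct, dotProduct_sub, dotProduct_sub]
    ring
  calc |(u - a) ⬝ᵥ (v - b) - u ⬝ᵥ v| ≤ |a ⬝ᵥ b| + |u ⬝ᵥ b| + |a ⬝ᵥ v| := by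
        rw [hsplit]
        exact (abs_sub _ _).trans (add_le_add_left (abs_sub _ _) _)
    _ ≤ η * r * (1 * r) + r * (η * r) + η * r * r := by gcongr
    _ = 3 * η * r ^ 2 := by ring

theorem transpose_mul_mul_apply {ι κ : Type*} [Fintype ι] (H : Matrix ι κ ℝ) (M : Matrix ι ι ℝ)
    (i j : κ) : (Hᵀ * M * H) i j = Hᵀ i ⬝ᵥ (M *ᵥ Hᵀ j) := by
  rw [Matrix.mul_assoc]
  rfl

theorem IsRTSLoading.abs_gram_rotation_sub_one_le (hL : IsRTSLoading T y L)
    (hS : SpectralBounds T Λ f y c Δ) (hN : 0 < N) (hΔ : Δ ≤ c) (i j : Fin m) :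
    |((rotation T Λ f y L)ᵀ * ((N : ℝ)⁻¹ • (Λᵀ * Λ)) * rotation T Λ f y L) i j -
      (1 : Matrix (Fin m) (Fin m) ℝ) i j| ≤ 3 * (Δ / c) := by
  set H := rotation T Λ f y L
  set E := L - Λ * H with hE
  have hNpos : (0 : ℝ) < N := by exact_mod_cast hN
  have hη : 0 ≤ Δ / c := div_nonneg hS.nonneg hS.pos.le
  have hLcol : ∀ k, √(Lᵀ k ⬝ᵥ Lᵀ k) ≤ √N := fun k => by
    rw [hL.col_dotProduct, one_apply_eq, mul_one]
  have hEcol : ∀ k, √(Eᵀ k ⬝ᵥ Eᵀ k) ≤ Δ / c * √N := fun k => by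
    refine (Real.sqrt_le_sqrt (hL.col_sub_rotation_sq_le hS k)).trans_eq ?_
    rw [Real.sqrt_mul (sq_nonneg _), Real.sqrt_sq hη]
  have hgram : (Hᵀ * ((N : ℝ)⁻¹ • (Λᵀ * Λ)) * H) i j =
      (N : ℝ)⁻¹ * ((Lᵀ i - Eᵀ i) ⬝ᵥ (Lᵀ j - Eᵀ j)) := by
    have hcol : ∀ k, Lᵀ k - Eᵀ k = Λ *ᵥ Hᵀ k := fun k => by
      ext x
      rw [hE, Pi.sub_apply, transpose_apply, transpose_apply, Matrix.sub_apply, sub_sub_cancel]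
      rfl
    rw [transpose_mul_mul_apply, hcol, hcol, smul_mulVec, dotProduct_smul, smul_eq_mul,
      ← mulVec_mulVec, ← transpose_mulVec_dotProduct, transpose_transpose]
  have hone : (1 : Matrix (Fin m) (Fin m) ℝ) i j = (N : ℝ)⁻¹ * (Lᵀ i ⬝ᵥ Lᵀ j) := by
    rw [hL.col_dotProduct, inv_mul_cancel_left₀ hNpos.ne']
  rw [hgram, hone, ← mul_sub, abs_mul, abs_of_pos (inv_pos.2 hNpos), inv_mul_le_iff₀ hNpos]
  refine (abs_sub_dotProduct_sub_sub_le hη ((div_le_one hS.pos).2 hΔ) (hLcol i) (hLcol j)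
    (hEcol i) (hEcol j)).trans_eq ?_
  rw [Real.sq_sqrt hNpos.le, mul_comm]

theorem IsRTSLoading.rotation_col_sq_le (hL : IsRTSLoading T y L)
    (hS : SpectralBounds T Λ f y c Δ) (hN : 0 < N) (hΔ : Δ ≤ c) {v₀ : ℝ} (hv₀ : 0 < v₀)
    (hgram : ∀ b, v₀ * (b ⬝ᵥ b) ≤ b ⬝ᵥ (((N : ℝ)⁻¹ • (Λᵀ * Λ)) *ᵥ b)) (j : Fin m) :
    (rotation T Λ f y L)ᵀ j ⬝ᵥ (rotation T Λ f y L)ᵀ j ≤ 4 / v₀ := by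
  have hlow := hgram ((rotation T Λ f y L)ᵀ j)
  rw [← transpose_mul_mul_apply] at hlow
  have hup := (abs_le.1 (hL.abs_gram_rotation_sub_one_le hS hN hΔ j j)).2
  rw [one_apply_eq] at hup
  have hη := (div_le_one hS.pos).2 hΔ
  rw [le_div_iff₀ hv₀]
  linarith

theorem IsRTSLoading.abs_rotation_sub_one_le (hL : IsRTSLoading T y L)
    (hS : SpectralBounds T Λ f y c Δ) (hN : 0 < N) (hΔ : Δ ≤ c) {v₀ : ℝ} (hv₀ : 0 < v₀)
    (hgram : ∀ b, v₀ * (b ⬝ᵥ b) ≤ b ⬝ᵥ (((N : ℝ)⁻¹ • (Λᵀ * Λ)) *ᵥ b))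
    {V : Matrix (Fin m) (Fin m) ℝ} {ε : ℝ} (hε : 0 ≤ ε)
    (hV : ∀ i j, |(V - (N : ℝ)⁻¹ • (Λᵀ * Λ)) i j| ≤ ε) (i j : Fin m) :
    |((rotation T Λ f y L)ᵀ * V * rotation T Λ f y L) i j -
      (1 : Matrix (Fin m) (Fin m) ℝ) i j| ≤ 3 * (Δ / c) + ε * m * (4 / v₀) := by
  set H := rotation T Λ f y L
  set W := (N : ℝ)⁻¹ • (Λᵀ * Λ)
  have hcol := hL.rotation_col_sq_le hS hN hΔ hv₀ hgram
  have hdiff : |(Hᵀ * (V - W) * H) i j| ≤ ε * m * (4 / v₀) := by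
    rw [transpose_mul_mul_apply]
    refine (abs_dotProduct_mulVec_le hV hε _ _).trans ?_
    rw [Fintype.card_fin]
    calc ε * (√m * √(Hᵀ i ⬝ᵥ Hᵀ i)) * (√m * √(Hᵀ j ⬝ᵥ Hᵀ j))
        ≤ ε * (√m * √(4 / v₀)) * (√m * √(4 / v₀)) := by
          gcongr
          exacts [hcol i, hcol j]
      _ = ε * (√m * √m) * (√(4 / v₀) * √(4 / v₀)) := by ring
      _ = ε * m * (4 / v₀) := by
          rw [Real.mul_self_sqrt (Nat.cast_nonneg m), Real.mul_self_sqrt (by positivity)]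
  have hsplit : (Hᵀ * V * H) i j - (1 : Matrix (Fin m) (Fin m) ℝ) i j =
      ((Hᵀ * W * H) i j - (1 : Matrix (Fin m) (Fin m) ℝ) i j) + (Hᵀ * (V - W) * H) i j := by
    rw [Matrix.mul_sub, Matrix.sub_mul, Matrix.sub_apply]
    ring
  rw [hsplit]
  exact (abs_add_le _ _).trans
    (add_le_add (hL.abs_gram_rotation_sub_one_le hS hN hΔ i j) hdiff)

end Loading

section RadialSample

variable {Ω ι : Type*} [MeasurableSpace Ω] [Fintype ι] {P : Measure Ω} [IsProbabilityMeasure P]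
  {X : ℕ → Ω → ℝ × (ι → ℝ)}

/-- The vector `ξ g / ‖g‖` made from the pair `(ξ, g)`: `scaledDirection` in coordinates. -/
def radialDirection (p : ℝ × (ι → ℝ)) : ι → ℝ := p.1 • ((l2norm p.2)⁻¹ • p.2)

@[fun_prop]
theorem measurable_radialDirection : Measurable (radialDirection (ι := ι)) := by
  have : Measurable (l2norm : (ι → ℝ) → ℝ) := measurable_norm.comp (WithLp.measurable_toLp 2 _)
  unfold radialDirection
  fun_prop

/-- The pairs `(ξ_t, g_t)` of radii and standard Gaussian vectors from which an elliptical sample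
is made. The radii need neither be identically distributed nor satisfy any moment condition. -/
structure RadialSample (P : Measure Ω) (X : ℕ → Ω → ℝ × (ι → ℝ)) : Prop where
  measurable : ∀ t, Measurable (X t)
  indep : iIndepFun X P
  indep_radius : ∀ t, IndepFun (fun ω => (X t ω).1) (fun ω => (X t ω).2) P
  gaussian_law : ∀ t, P.map (fun ω => (X t ω).2) = stdPi ι
  radius_ne_zero : ∀ t, ∀ᵐ ω ∂P, (X t ω).1 ≠ 0

theorem RadialSample.hasLaw_toLp (hX : RadialSample P X) (t : ℕ) :
    HasLaw (fun ω => ((X t ω).1, (WithLp.toLp 2 (X t ω).2 : EuclideanSpace ℝ ι)))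
      ((P.map fun ω => (X t ω).1).prod (stdGaussian (EuclideanSpace ℝ ι))) P := by
  have hradius : Measurable fun ω => (X t ω).1 := (hX.measurable t).fst
  have hgaussian : Measurable fun ω => (X t ω).2 := (hX.measurable t).snd
  have hlp := WithLp.measurable_toLp 2 (ι → ℝ)
  refine ((hX.indep_radius t).comp measurable_id hlp).hasLaw_prod ⟨hradius.aemeasurable, rfl⟩
    ⟨(hlp.comp hgaussian).aemeasurable, ?_⟩
  have h := Measure.map_map (μ := P) hlp hgaussian
  rw [hX.gaussian_law, map_pi_eq_stdGaussian] at h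
  exact h.symm

theorem RadialSample.hasLaw_homogeneous {S : Type*} [MeasurableSpace S] (hX : RadialSample P X)
    (hι : 2 ≤ Fintype.card ι) {Φ : (ι → ℝ) → S} (hΦ : Measurable Φ)
    (hom : ∀ (c : ℝ) x, 0 < c → Φ (c • x) = Φ x) {t s : ℕ} (hts : t ≠ s) :
    HasLaw (fun ω => Φ (radialDirection (X t ω) - radialDirection (X s ω)))
      ((stdPi ι).map Φ) P := by
  have hlp := WithLp.measurable_toLp 2 (ι → ℝ)
  have hpair : Measurable fun p : ℝ × (ι → ℝ) =>
    (p.1, (WithLp.toLp 2 p.2 : EuclideanSpace ℝ ι)) := by fun_prop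
  have hradius := (hX.measurable t).fst
  have := Measure.isProbabilityMeasure_map (μ := P) hradius.aemeasurable
  have := Measure.isProbabilityMeasure_map (μ := P) (hX.measurable s).fst.aemeasurable
  have hofLp : Measurable fun x : EuclideanSpace ℝ ι => Φ x.ofLp :=
    hΦ.comp (WithLp.measurable_ofLp 2 _)
  have h := hasLaw_homogeneous_scaledDirection_sub (Φ := fun x : EuclideanSpace ℝ ι => Φ x.ofLp)
    (by simpa using hι) ((hX.indep.indepFun hts).comp hpair hpair)
    ((ae_map_iff hradius.aemeasurable (measurableSet_singleton (0 : ℝ)).compl).2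
      (hX.radius_ne_zero t))
    (hX.hasLaw_toLp t) (hX.hasLaw_toLp s) hofLp fun c x hc => hom c x.ofLp hc
  rw [← map_pi_eq_stdGaussian, Measure.map_map hofLp hlp] at h
  exact h

end RadialSample

section MatrixKernels

variable {Ω ι κ κ' : Type*} [MeasurableSpace Ω] [Fintype ι]

/-- The entrywise mean of a random matrix that is a function of a standard Gaussian vector. -/
def meanMatrix (Φ : (ι → ℝ) → Matrix κ κ' ℝ) : Matrix κ κ' ℝ :=
  Matrix.of fun i j => ∫ w, Φ w i j ∂stdPi ι

/-- The average of a matrix-valued kernel over the differences `x_t - x_s`, `t < s`, of the points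
`x_t = ξ_t g_t / ‖g_t‖`. -/
def pairMatrix (T : ℕ) (Φ : (ι → ℝ) → Matrix κ κ' ℝ) (X : ℕ → Ω → ℝ × (ι → ℝ)) (ω : Ω) :
    Matrix κ κ' ℝ :=
  Matrix.of fun i j =>
    uStatistic T (fun p q => Φ (radialDirection p - radialDirection q) i j) X ω

variable [Fintype κ] [Fintype κ'] {P : Measure Ω} [IsProbabilityMeasure P]
  {X : ℕ → Ω → ℝ × (ι → ℝ)} {Φ : (ι → ℝ) → Matrix κ κ' ℝ}

theorem sq_apply_le_sum_sq (M : Matrix κ κ' ℝ) (i : κ) (j : κ') :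
    M i j ^ 2 ≤ ∑ i, ∑ j, M i j ^ 2 :=
  (Finset.single_le_sum (f := fun j => M i j ^ 2) (fun _ _ => sq_nonneg _)
    (Finset.mem_univ j)).trans
  (Finset.single_le_sum (f := fun i => ∑ j, M i j ^ 2)
    (fun _ _ => Finset.sum_nonneg fun _ _ => sq_nonneg _) (Finset.mem_univ i))

theorem memLp_two_of_integrable_sum_sq (hΦ : ∀ i j, Measurable fun w => Φ w i j)
    (hint : Integrable (fun w => ∑ i, ∑ j, Φ w i j ^ 2) (stdPi ι)) (i : κ) (j : κ') :
    MemLp (fun w => Φ w i j) 2 (stdPi ι) := by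
  refine (memLp_two_iff_integrable_sq (hΦ i j).aestronglyMeasurable).2
    (hint.mono' ((hΦ i j).pow_const 2).aestronglyMeasurable (.of_forall fun w => ?_))
  rw [Real.norm_eq_abs, abs_of_nonneg (sq_nonneg _)]
  exact sq_apply_le_sum_sq _ i j

theorem dotProduct_meanMatrix_mulVec (hΦ : ∀ i j, Integrable (fun w => Φ w i j) (stdPi ι))
    (u : κ → ℝ) (v : κ' → ℝ) :
    u ⬝ᵥ (meanMatrix Φ *ᵥ v) = ∫ w, u ⬝ᵥ (Φ w *ᵥ v) ∂stdPi ι := by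
  simp only [dotProduct, mulVec, meanMatrix, of_apply]
  rw [integral_finsetSum _ fun i _ => (integrable_finsetSum _ fun j _ =>
    (hΦ i j).mul_const _).const_mul _]
  refine Finset.sum_congr rfl fun i _ => ?_
  rw [integral_const_mul, integral_finsetSum _ fun j _ => (hΦ i j).mul_const _]
  simp only [integral_mul_const]

theorem RadialSample.prob_frobenius_le (hX : RadialSample P X) (hι : 2 ≤ Fintype.card ι)
    (hΦ : ∀ i j, Measurable fun w => Φ w i j)
    (hom : ∀ (c : ℝ) x, 0 < c → Φ (c • x) = Φ x)
    (hint : Integrable (fun w => ∑ i, ∑ j, Φ w i j ^ 2) (stdPi ι)) {q : ℝ}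
    (hq : ∫ w, ∑ i, ∑ j, Φ w i j ^ 2 ∂stdPi ι ≤ q) {T : ℕ} (hT : 2 ≤ T) {a : ℝ} (ha : 0 < a) :
    P {ω | a < ∑ i, ∑ j, (pairMatrix T Φ X ω - meanMatrix Φ) i j ^ 2} ≤
      ENNReal.ofReal (16 * q / (T * a)) := by
  have memLp := memLp_two_of_integrable_sum_sq hΦ hint
  have hsq : ∑ k : κ × κ', ∫ x, x ^ 2 ∂(stdPi ι).map (fun w => Φ w k.1 k.2) ≤ q := by
    refine le_trans (le_of_eq ?_) hq
    rw [integral_finsetSum _ fun i _ => integrable_finsetSum _ fun j _ => (memLp i j).integrable_sq,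
      Fintype.sum_prod_type]
    refine Finset.sum_congr rfl fun i _ => ?_
    rw [integral_finsetSum _ fun j _ => (memLp i j).integrable_sq]
    exact Finset.sum_congr rfl fun j _ => integral_map (hΦ i j).aemeasurable (by fun_prop)
  have hmean (i j) : ∫ x, x ∂(stdPi ι).map (fun w => Φ w i j) = meanMatrix Φ i j :=
    integral_map (hΦ i j).aemeasurable (by fun_prop)
  have hdiff : Measurable fun p : (ℝ × (ι → ℝ)) × (ℝ × (ι → ℝ)) =>
    radialDirection p.1 - radialDirection p.2 := by fun_prop
  have h := prob_sum_sq_uStatistic_sub_le (K := κ × κ')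
    (κ := fun k p q => Φ (radialDirection p - radialDirection q) k.1 k.2)
    hX.measurable hX.indep
    (fun k => (hΦ k.1 k.2).comp hdiff)
    (fun k t s hts => hX.hasLaw_homogeneous hι (hΦ k.1 k.2)
      (fun c x hc => by rw [hom c x hc]) hts.ne)
    (fun k => (memLp_map_measure_iff (by fun_prop) (hΦ k.1 k.2).aemeasurable).2 (memLp k.1 k.2))
    hsq hT ha
  simpa only [Fintype.sum_prod_type, hmean, pairMatrix, Matrix.sub_apply, of_apply] using h

end MatrixKernels

section Kernels

variable {m N : ℕ} {Λ : Matrix (Fin N) (Fin m) ℝ} {A : Matrix (Fin N) (Fin N) ℝ}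

/-- The kernel of the sample Kendall's tau matrix. -/
def kendallKernel (Λ : Matrix (Fin N) (Fin m) ℝ) (A : Matrix (Fin N) (Fin N) ℝ)
    (w : Fin m ⊕ Fin N → ℝ) : Matrix (Fin N) (Fin N) ℝ :=
  (obs Λ A w ⬝ᵥ obs Λ A w)⁻¹ • vecMulVec (obs Λ A w) (obs Λ A w)

/-- The kernel of the part of the sample Kendall's tau matrix that is not due to the factors. -/
def residualKernel (Λ : Matrix (Fin N) (Fin m) ℝ) (A : Matrix (Fin N) (Fin N) ℝ)
    (w : Fin m ⊕ Fin N → ℝ) : Matrix (Fin N) (Fin N) ℝ :=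
  kendallKernel Λ A w - (obs Λ A w ⬝ᵥ obs Λ A w)⁻¹ • vecMulVec (common Λ w) (common Λ w)

theorem inv_smul_vecMulVec_smul {ι κ : Type*} [Fintype ι] {c : ℝ} (hc : 0 < c) (v : ι → ℝ)
    (u : κ → ℝ) : ((c • v) ⬝ᵥ (c • v))⁻¹ • vecMulVec (c • u) (c • u) =
      (v ⬝ᵥ v)⁻¹ • vecMulVec u u := by
  rw [smul_dotProduct_smul_self, smul_vecMulVec, vecMulVec_smul, smul_smul, smul_smul, mul_inv]
  congr 1
  field_simp

theorem common_smul (c : ℝ) (w : Fin m ⊕ Fin N → ℝ) : common Λ (c • w) = c • common Λ w :=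
  mulVec_smul Λ c _

theorem idio_smul (c : ℝ) (w : Fin m ⊕ Fin N → ℝ) : idio A (c • w) = c • idio A w :=
  mulVec_smul A c _

theorem obs_smul (c : ℝ) (w : Fin m ⊕ Fin N → ℝ) : obs Λ A (c • w) = c • obs Λ A w := by
  rw [obs, obs, common_smul, idio_smul, smul_add]

theorem kendallKernel_smul (c : ℝ) (w : Fin m ⊕ Fin N → ℝ) (hc : 0 < c) :
    kendallKernel Λ A (c • w) = kendallKernel Λ A w := by
  rw [kendallKernel, kendallKernel, obs_smul, inv_smul_vecMulVec_smul hc]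

theorem residualKernel_smul (c : ℝ) (w : Fin m ⊕ Fin N → ℝ) (hc : 0 < c) :
    residualKernel Λ A (c • w) = residualKernel Λ A w := by
  rw [residualKernel, residualKernel, kendallKernel_smul c w hc, obs_smul, common_smul,
    inv_smul_vecMulVec_smul hc]

theorem measurable_kendallKernel (i j : Fin N) :
    Measurable fun w => kendallKernel Λ A w i j := by
  have := measurable_obs (Λ := Λ) (A := A)
  have := measurable_obs_dotProduct_self (Λ := Λ) (A := A)
  simp only [kendallKernel, Matrix.smul_apply, vecMulVec_apply, smul_eq_mul]
  fun_prop

theorem measurable_residualKernel (i j : Fin N) :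
    Measurable fun w => residualKernel Λ A w i j := by
  have := measurable_kendallKernel (Λ := Λ) (A := A) i j
  have := measurable_common (Λ := Λ)
  have := measurable_obs_dotProduct_self (Λ := Λ) (A := A)
  simp only [residualKernel, Matrix.sub_apply, Matrix.smul_apply, vecMulVec_apply, smul_eq_mul]
  fun_prop

theorem sum_smul_vecMulVec_sq {ι : Type*} [Fintype ι] (r : ℝ) (v : ι → ℝ) :
    ∑ i, ∑ j, (r • vecMulVec v v) i j ^ 2 = (r * (v ⬝ᵥ v)) ^ 2 := by
  rw [mul_pow, dotProduct, sq (∑ i, v i * v i), Finset.sum_mul_sum, Finset.mul_sum]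
  refine Finset.sum_congr rfl fun i _ => ?_
  rw [Finset.mul_sum]
  refine Finset.sum_congr rfl fun j _ => ?_
  rw [Matrix.smul_apply, vecMulVec_apply, smul_eq_mul]
  ring

theorem sum_kendallKernel_sq_le (w : Fin m ⊕ Fin N → ℝ) :
    ∑ i, ∑ j, kendallKernel Λ A w i j ^ 2 ≤ 1 := by
  simp only [kendallKernel]
  rw [sum_smul_vecMulVec_sq]
  have h := dotProduct_self_nonneg (obs Λ A w)
  exact pow_le_one₀ (mul_nonneg (inv_nonneg.2 h) h) inv_mul_le_one

theorem sum_residualKernel_sq_le (w : Fin m ⊕ Fin N → ℝ) :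
    ∑ i, ∑ j, residualKernel Λ A w i j ^ 2 ≤
      2 + 2 * ((obs Λ A w ⬝ᵥ obs Λ A w)⁻¹ * (common Λ w ⬝ᵥ common Λ w)) ^ 2 := by
  rw [← sum_smul_vecMulVec_sq]
  set C := (obs Λ A w ⬝ᵥ obs Λ A w)⁻¹ • vecMulVec (common Λ w) (common Λ w)
  calc ∑ i, ∑ j, residualKernel Λ A w i j ^ 2
      ≤ ∑ i, ∑ j, (2 * kendallKernel Λ A w i j ^ 2 + 2 * C i j ^ 2) := by
        refine Finset.sum_le_sum fun i _ => Finset.sum_le_sum fun j _ => ?_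
        rw [residualKernel, Matrix.sub_apply]
        linarith [sq_nonneg (kendallKernel Λ A w i j + C i j)]
    _ = 2 * ∑ i, ∑ j, kendallKernel Λ A w i j ^ 2 + 2 * ∑ i, ∑ j, C i j ^ 2 := by
        simp only [Finset.sum_add_distrib, ← Finset.mul_sum]
    _ ≤ _ := by linarith [sum_kendallKernel_sq_le (Λ := Λ) (A := A) w]

theorem dotProduct_smul_vecMulVec_mulVec {ι : Type*} [Fintype ι] (r : ℝ) (u v a : ι → ℝ) :
    u ⬝ᵥ ((r • vecMulVec a a) *ᵥ v) = r * ((u ⬝ᵥ a) * (v ⬝ᵥ a)) := by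
  rw [smul_mulVec, dotProduct_smul, vecMulVec_mulVec, dotProduct_comm a v, op_smul_eq_smul,
    dotProduct_smul, smul_eq_mul, smul_eq_mul]
  ring

end Kernels

section KernelMeans

variable {m N : ℕ} {Λ : Matrix (Fin N) (Fin m) ℝ} {A : Matrix (Fin N) (Fin N) ℝ}
  {B c₁ c₂ Q : ℝ} {p : ℕ}

theorem integrable_sum_sq_of_le {ι κ κ' : Type*} [Fintype ι] [Fintype κ] [Fintype κ']
    {Φ : (ι → ℝ) → Matrix κ κ' ℝ} (hΦ : ∀ i j, Measurable fun w => Φ w i j) {F : (ι → ℝ) → ℝ}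
    (hF : Integrable F (stdPi ι)) (h : ∀ w, ∑ i, ∑ j, Φ w i j ^ 2 ≤ F w) :
    Integrable (fun w => ∑ i, ∑ j, Φ w i j ^ 2) (stdPi ι) := by
  refine hF.mono' (by fun_prop) (.of_forall fun w => ?_)
  rw [Real.norm_eq_abs, abs_of_nonneg (Finset.sum_nonneg fun _ _ => Finset.sum_nonneg
    fun _ _ => sq_nonneg _)]
  exact h w

theorem integrable_sum_kendallKernel_sq :
    Integrable (fun w => ∑ i, ∑ j, kendallKernel Λ A w i j ^ 2) (stdPi (Fin m ⊕ Fin N)) :=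
  integrable_sum_sq_of_le measurable_kendallKernel (integrable_const 1) sum_kendallKernel_sq_le

theorem integral_sum_kendallKernel_sq_le :
    ∫ w, ∑ i, ∑ j, kendallKernel Λ A w i j ^ 2 ∂stdPi (Fin m ⊕ Fin N) ≤ 1 :=
  (integral_mono integrable_sum_kendallKernel_sq (integrable_const 1)
    sum_kendallKernel_sq_le).trans_eq (by simp)

theorem DesignMoments.sum_residualKernel_sq_bound (hQ : DesignMoments p Λ A Q) (hp : 6 ≤ p)
    (hD : DesignBounds Λ A B c₁ c₂) :
    Integrable (fun w => ∑ i, ∑ j, residualKernel Λ A w i j ^ 2) (stdPi (Fin m ⊕ Fin N)) ∧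
      ∫ w, ∑ i, ∑ j, residualKernel Λ A w i j ^ 2 ∂stdPi (Fin m ⊕ Fin N) ≤
        2 + 2 * (B ^ 2 * m * (m * (1 + 6 * Q))) := by
  obtain ⟨hratio, hratio_le⟩ := hQ.common_ratio_sq_bound hp hD
  have hdom : Integrable (fun w => 2 + 2 * ((obs Λ A w ⬝ᵥ obs Λ A w)⁻¹ *
      (common Λ w ⬝ᵥ common Λ w)) ^ 2) (stdPi (Fin m ⊕ Fin N)) :=
    (integrable_const 2).add (hratio.const_mul 2)
  have hint := integrable_sum_sq_of_le measurable_residualKernel hdom sum_residualKernel_sq_le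
  refine ⟨hint, (integral_mono hint hdom sum_residualKernel_sq_le).trans ?_⟩
  rw [integral_add (integrable_const 2) (hratio.const_mul 2), integral_const_mul]
  simp only [integral_const, probReal_univ, one_smul]
  linarith

theorem DesignMoments.meanMatrix_residual_sq_le (hQ : DesignMoments p Λ A Q) (hp : 6 ≤ p)
    (hD : DesignBounds Λ A B c₁ c₂) (hN : 0 < N) (x : Fin N → ℝ) :
    (meanMatrix (residualKernel Λ A) *ᵥ x) ⬝ᵥ (meanMatrix (residualKernel Λ A) *ᵥ x) ≤
      ((4 * m * (1 + 6 * Q) + (1 + 3 * Q)) / N) ^ 2 * (x ⬝ᵥ x) := by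
  have hint (i j) : Integrable (fun w => residualKernel Λ A w i j) (stdPi (Fin m ⊕ Fin N)) :=
    (memLp_two_of_integrable_sum_sq measurable_residualKernel
      (hQ.sum_residualKernel_sq_bound hp hD).1 i j).integrable one_le_two
  refine mulVec_sq_le_of_bilinear_le (fun u v hu hv => ?_) x
  rw [dotProduct_meanMatrix_mulVec hint]
  simp only [residualKernel, kendallKernel, sub_mulVec, dotProduct_sub,
    dotProduct_smul_vecMulVec_mulVec, ← mul_sub]
  exact hQ.abs_integral_residual_le hp hD hN hu hv

/-- The lower bound `(E|z|)² v₀ / (B + c₁)`, `z` standard Gaussian, for the leading eigenvalues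
of the population Kendall's tau matrix. -/
def signalBound (B c₁ v₀ : ℝ) : ℝ := (∫ t, |t| ∂gaussianReal 0 1) ^ 2 * v₀ / (B + c₁)

theorem DesignBounds.signalBound_pos (hD : DesignBounds Λ A B c₁ c₂) {v₀ : ℝ} (hv₀ : 0 < v₀) :
    0 < signalBound B c₁ v₀ := by
  have := integral_abs_gaussianReal_pos
  have := hD.nonneg
  have := hD.upper_pos
  unfold signalBound
  positivity

theorem DesignBounds.le_meanMatrix_kendall (hD : DesignBounds Λ A B c₁ c₂) (hN : 0 < N) {v₀ : ℝ}
    (hlow : ∀ b, N * v₀ * (b ⬝ᵥ b) ≤ (Λ *ᵥ b) ⬝ᵥ (Λ *ᵥ b)) (b : Fin m → ℝ) :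
    signalBound B c₁ v₀ * ((Λ *ᵥ b) ⬝ᵥ (Λ *ᵥ b)) ≤
      (Λ *ᵥ b) ⬝ᵥ (meanMatrix (kendallKernel Λ A) *ᵥ (Λ *ᵥ b)) := by
  have : (0 : ℝ) < N := by exact_mod_cast hN
  have hB := hD.nonneg
  have hc₁ := hD.upper_pos
  have hint (i j) : Integrable (fun w => kendallKernel Λ A w i j) (stdPi (Fin m ⊕ Fin N)) :=
    (memLp_two_of_integrable_sum_sq measurable_kendallKernel
      integrable_sum_kendallKernel_sq i j).integrable one_le_two
  have hform : (Λ *ᵥ b) ⬝ᵥ (meanMatrix (kendallKernel Λ A) *ᵥ (Λ *ᵥ b)) =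
      ∫ w, ((Λ *ᵥ b) ⬝ᵥ obs Λ A w) ^ 2 / (obs Λ A w ⬝ᵥ obs Λ A w) ∂stdPi (Fin m ⊕ Fin N) := by
    rw [dotProduct_meanMatrix_mulVec hint]
    simp only [kendallKernel, dotProduct_smul_vecMulVec_mulVec, ← sq, inv_mul_eq_div]
  rw [hform]
  refine le_trans ?_ (hD.le_integral_obs_sq hN (Λ *ᵥ b))
  rw [signalBound, le_div_iff₀ (by positivity)]
  calc _ = (∫ t, |t| ∂gaussianReal 0 1) ^ 2 * (N * v₀ * ((Λ *ᵥ b) ⬝ᵥ (Λ *ᵥ b))) := by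
        field_simp
    _ ≤ _ := by
        gcongr
        exact mulVec_sq_le_transpose_mulVec_sq hlow b

end KernelMeans

section Perturbation

variable {ι κ : Type*} [Fintype ι] [Fintype κ]

theorem dotProduct_mulVec_ge_of_frobenius_le {K K₀ : Matrix ι ι ℝ} {c : ℝ} (hc : 0 ≤ c)
    (hK : ∑ i, ∑ j, (K - K₀) i j ^ 2 ≤ c ^ 2) (x : ι → ℝ) :
    x ⬝ᵥ (K₀ *ᵥ x) - c * (x ⬝ᵥ x) ≤ x ⬝ᵥ (K *ᵥ x) := by
  have hx := dotProduct_self_nonneg x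
  have hsq : (x ⬝ᵥ ((K - K₀) *ᵥ x)) ^ 2 ≤ (c * (x ⬝ᵥ x)) ^ 2 :=
    calc _ ≤ (x ⬝ᵥ x) * (((K - K₀) *ᵥ x) ⬝ᵥ ((K - K₀) *ᵥ x)) := sq_dotProduct_le _ _
      _ ≤ (x ⬝ᵥ x) * (c ^ 2 * (x ⬝ᵥ x)) := by
          gcongr
          exact (mulVec_sq_le_frobenius _ x).trans (by gcongr)
      _ = _ := by ring
  have hdiff := (abs_le_of_sq_le_sq' hsq (by positivity)).1
  rw [sub_mulVec, dotProduct_sub] at hdiff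
  linarith

theorem mulVec_sq_le_of_frobenius_le {D D₀ : Matrix ι κ ℝ} {a b : ℝ}
    (hD₀ : ∀ x, (D₀ *ᵥ x) ⬝ᵥ (D₀ *ᵥ x) ≤ a * (x ⬝ᵥ x))
    (hD : ∑ i, ∑ j, (D - D₀) i j ^ 2 ≤ b) (x : κ → ℝ) :
    (D *ᵥ x) ⬝ᵥ (D *ᵥ x) ≤ 2 * (a + b) * (x ⬝ᵥ x) := by
  set u := D₀ *ᵥ x
  set v := (D - D₀) *ᵥ x with hv
  have hx := dotProduct_self_nonneg x
  have hvv : v ⬝ᵥ v ≤ b * (x ⬝ᵥ x) := (mulVec_sq_le_frobenius _ x).trans (by gcongr)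
  have hsplit : D *ᵥ x = u + v := by rw [hv, sub_mulVec, add_sub_cancel]
  have hparallelogram := dotProduct_self_nonneg (u - v)
  rw [hsplit]
  simp only [sub_dotProduct, dotProduct_sub, add_dotProduct, dotProduct_add] at hparallelogram ⊢
  linarith [hD₀ x]

end Perturbation

section PairAverage

variable {N p q p' q' T : ℕ} {y : ℕ → Fin N → ℝ}

theorem pairAverage_apply (a : ℕ → Fin p → ℝ) (b : ℕ → Fin q → ℝ) (i : Fin p) (j : Fin q) :
    pairAverage T y a b i j = 2 / ((T : ℝ) * ((T : ℝ) - 1)) *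
      ∑ s ∈ Finset.range T, ∑ t ∈ Finset.range s,
        ((y t - y s) ⬝ᵥ (y t - y s))⁻¹ * ((a t - a s) i * (b t - b s) j) := by
  simp only [pairAverage, l2norm_sq, Matrix.smul_apply, Matrix.sum_apply, vecMulVec_apply,
    smul_eq_mul]

theorem mul_pairAverage_mul_transpose (a : ℕ → Fin p → ℝ) (b : ℕ → Fin q → ℝ)
    (M : Matrix (Fin p') (Fin p) ℝ) (M' : Matrix (Fin q') (Fin q) ℝ) :
    M * pairAverage T y a b * M'ᵀ =
      pairAverage T y (fun t => M *ᵥ a t) (fun t => M' *ᵥ b t) := by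
  simp only [pairAverage, Matrix.mul_smul, Matrix.smul_mul, Matrix.mul_sum, Matrix.sum_mul,
    mul_vecMulVec, vecMulVec_mul, vecMul_transpose, mulVec_sub]

end PairAverage

section FactorSample

variable {Ω : Type*} [MeasurableSpace Ω] {P : Measure Ω} {m N T : ℕ}
  {Λ : Matrix (Fin N) (Fin m) ℝ} {A : Matrix (Fin N) (Fin N) ℝ}
  {X : ℕ → Ω → ℝ × (Fin m ⊕ Fin N → ℝ)} {f : ℕ → Ω → Fin m → ℝ} {y : ℕ → Ω → Fin N → ℝ}

/-- The elliptical factor model in a fixed dimension `N`: the factor `f_t` and the error are `h`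
and `A k`, where `(h, k) = ξ_t g_t / ‖g_t‖`. -/
structure FactorSample (P : Measure Ω) (Λ : Matrix (Fin N) (Fin m) ℝ)
    (A : Matrix (Fin N) (Fin N) ℝ) (X : ℕ → Ω → ℝ × (Fin m ⊕ Fin N → ℝ))
    (f : ℕ → Ω → Fin m → ℝ) (y : ℕ → Ω → Fin N → ℝ) : Prop extends RadialSample P X where
  factor_eq : ∀ t ω, f t ω = radialDirection (X t ω) ∘ Sum.inl
  observation_eq : ∀ t ω, y t ω = obs Λ A (radialDirection (X t ω))

theorem common_sub (v w : Fin m ⊕ Fin N → ℝ) : common Λ (v - w) = common Λ v - common Λ w :=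
  mulVec_sub Λ _ _

theorem obs_sub (v w : Fin m ⊕ Fin N → ℝ) : obs Λ A (v - w) = obs Λ A v - obs Λ A w := by
  have hidio : idio A (v - w) = idio A v - idio A w := mulVec_sub A _ _
  rw [obs, obs, obs, common_sub, hidio, add_sub_add_comm]

theorem FactorSample.pairAverage_eq_pairMatrix (h : FactorSample P Λ A X f y) {q : ℕ}
    {φ : (Fin m ⊕ Fin N → ℝ) → Fin q → ℝ} (hφ : ∀ v w, φ (v - w) = φ v - φ w) (ω : Ω) :
    pairAverage T (y · ω) (fun t => φ (radialDirection (X t ω)))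
        (fun t => φ (radialDirection (X t ω))) =
      pairMatrix T (fun w => (obs Λ A w ⬝ᵥ obs Λ A w)⁻¹ • vecMulVec (φ w) (φ w)) X ω := by
  ext i j
  simp only [pairAverage_apply, h.observation_eq, ← obs_sub, ← hφ]
  rfl

theorem FactorSample.kendall_eq (h : FactorSample P Λ A X f y) (ω : Ω) :
    kendall T (y · ω) = pairMatrix T (kendallKernel Λ A) X ω := by
  have hpair := h.pairAverage_eq_pairMatrix (T := T) (obs_sub (Λ := Λ) (A := A)) ω
  simp only [← h.observation_eq] at hpair
  exact hpair

theorem FactorSample.residual_eq (h : FactorSample P Λ A X f y) (ω : Ω) :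
    residual T Λ (f · ω) (y · ω) = pairMatrix T (residualKernel Λ A) X ω := by
  have hpair := h.pairAverage_eq_pairMatrix (T := T) (common_sub (Λ := Λ)) ω
  have hcommon : ∀ t, common Λ (radialDirection (X t ω)) = Λ *ᵥ f t ω := fun t => by
    rw [h.factor_eq, common]
  simp only [hcommon] at hpair
  rw [residual, mul_pairAverage_mul_transpose, h.kendall_eq, hpair]
  ext i j
  simp only [pairMatrix, uStatistic, Matrix.sub_apply, of_apply, residualKernel,
    Finset.sum_sub_distrib, mul_sub]

theorem FactorSample.spectralBounds (h : FactorSample P Λ A X f y) {B c₁ c₂ Q v₀ : ℝ} {p : ℕ}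
    (hD : DesignBounds Λ A B c₁ c₂) (hQ : DesignMoments p Λ A Q) (hp : 6 ≤ p) (hN : 0 < N)
    (hv₀ : 0 < v₀) (hlow : ∀ b, N * v₀ * (b ⬝ᵥ b) ≤ (Λ *ᵥ b) ⬝ᵥ (Λ *ᵥ b)) {Δ a : ℝ}
    (hΔ : 0 ≤ Δ) (ha : 2 * (((4 * m * (1 + 6 * Q) + (1 + 3 * Q)) / N) ^ 2 + a) ≤ Δ ^ 2) {ω : Ω}
    (hkendall : ∑ i, ∑ j, (pairMatrix T (kendallKernel Λ A) X ω -
      meanMatrix (kendallKernel Λ A)) i j ^ 2 ≤ (signalBound B c₁ v₀ / 2) ^ 2)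
    (hresidual : ∑ i, ∑ j, (pairMatrix T (residualKernel Λ A) X ω -
      meanMatrix (residualKernel Λ A)) i j ^ 2 ≤ a) :
    SpectralBounds T Λ (f · ω) (y · ω) (signalBound B c₁ v₀ / 2) Δ where
  pos := half_pos (hD.signalBound_pos hv₀)
  nonneg := hΔ
  le_eig := by
    have hNpos : (0 : ℝ) < N := by exact_mod_cast hN
    refine le_descEig (kendall_isHermitian T _)
      (mulVec_injective_of_lower_bound (mul_pos hNpos hv₀) hlow) fun b => ?_
    have hpert := dotProduct_mulVec_ge_of_frobenius_le (half_pos (hD.signalBound_pos hv₀)).le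
      hkendall (Λ *ᵥ b)
    rw [h.kendall_eq]
    linarith [hD.le_meanMatrix_kendall hN hlow b]
  residual_le x := by
    rw [h.residual_eq]
    refine (mulVec_sq_le_of_frobenius_le (hQ.meanMatrix_residual_sq_le hp hD hN) hresidual
      x).trans ?_
    gcongr
    exact dotProduct_self_nonneg x

theorem FactorSample.prob_not_spectralBounds_le [IsProbabilityMeasure P]
    (h : FactorSample P Λ A X f y) {B c₁ c₂ Q v₀ : ℝ} {p : ℕ} (hD : DesignBounds Λ A B c₁ c₂)
    (hQ : DesignMoments p Λ A Q) (hp : 6 ≤ p) (hN : 2 ≤ N) (hv₀ : 0 < v₀)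
    (hlow : ∀ b, N * v₀ * (b ⬝ᵥ b) ≤ (Λ *ᵥ b) ⬝ᵥ (Λ *ᵥ b)) (hT : 2 ≤ T) {Δ a : ℝ} (ha₀ : 0 < a)
    (hΔ : 0 ≤ Δ) (ha : 2 * (((4 * m * (1 + 6 * Q) + (1 + 3 * Q)) / N) ^ 2 + a) ≤ Δ ^ 2) :
    P {ω | ¬SpectralBounds T Λ (f · ω) (y · ω) (signalBound B c₁ v₀ / 2) Δ} ≤
      ENNReal.ofReal (16 * 1 / (T * (signalBound B c₁ v₀ / 2) ^ 2)) +
        ENNReal.ofReal (16 * (2 + 2 * (B ^ 2 * m * (m * (1 + 6 * Q)))) / (T * a)) := by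
  have hcard : 2 ≤ Fintype.card (Fin m ⊕ Fin N) := by
    rw [Fintype.card_sum, Fintype.card_fin, Fintype.card_fin]
    omega
  obtain ⟨hint, hint_le⟩ := hQ.sum_residualKernel_sq_bound hp hD
  refine le_trans ?_ (add_le_add
    (h.prob_frobenius_le (Φ := kendallKernel Λ A) hcard measurable_kendallKernel kendallKernel_smul
      integrable_sum_kendallKernel_sq integral_sum_kendallKernel_sq_le hT
      (pow_pos (half_pos (hD.signalBound_pos hv₀)) 2))
    (h.prob_frobenius_le (Φ := residualKernel Λ A) hcard measurable_residualKernel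
      residualKernel_smul hint hint_le hT ha₀))
  refine (measure_mono fun ω hω => ?_).trans (measure_union_le _ _)
  by_contra hnot
  simp only [Set.mem_union, Set.mem_ofPred_eq, not_or, not_lt] at hnot
  exact hω (h.spectralBounds hD hQ hp (by omega) hv₀ hlow hΔ ha hnot.1 hnot.2)

end FactorSample

section Assumptions

variable {m : ℕ} {Λ : (N : ℕ) → Matrix (Fin N) (Fin m) ℝ} {A : (N : ℕ) → Matrix (Fin N) (Fin N) ℝ}

theorem exists_designBounds (hΛ : ∃ C : ℝ, ∀ N i, l2norm (Λ N i) ≤ C) (hA : NoiseAssumption A) :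
    ∃ B c₁ c₂ : ℝ, ∀ N, DesignBounds (Λ N) (A N) B c₁ c₂ := by
  obtain ⟨C, hC⟩ := hΛ
  obtain ⟨c₁, c₂, hc₁, hc₂, heig⟩ := hA
  have hquad (N) (u : Fin N → ℝ) :
      ((A N)ᵀ *ᵥ u) ⬝ᵥ ((A N)ᵀ *ᵥ u) = u ⬝ᵥ ((A N * (A N)ᵀ) *ᵥ u) := by
    rw [transpose_mulVec_dotProduct, mulVec_mulVec]
  refine ⟨C ^ 2, c₁, c₂, fun N => ⟨sq_nonneg _, hc₁, hc₂, fun i => ?_, fun u => ?_, fun u => ?_⟩⟩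
  · rw [← l2norm_sq]
    exact pow_le_pow_left₀ (norm_nonneg _) (hC N i) 2
  · rw [hquad]
    exact dotProduct_mulVec_le (scatter_isHermitian (A N)) (fun i => (heig N i).2) u
  · rw [hquad]
    exact le_dotProduct_mulVec (scatter_isHermitian (A N)) (fun i => (heig N i).1) u

end Assumptions

section MatrixLimits

variable {ι n : Type*} {l : Filter ι} {M : ι → Matrix n n ℝ} {V : Matrix n n ℝ}

theorem eventually_abs_sub_le [Finite n] (hM : Tendsto M l (𝓝 V)) {ε : ℝ} (hε : 0 < ε) :
    ∀ᶠ k in l, ∀ i j, |(V - M k) i j| ≤ ε := by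
  refine eventually_all.2 fun i => eventually_all.2 fun j => ?_
  have hentry : Tendsto (fun k => M k i j) l (𝓝 (V i j)) :=
    tendsto_pi_nhds.1 (tendsto_pi_nhds.1 hM i) j
  filter_upwards [Metric.tendsto_nhds.1 hentry ε hε] with k hk
  rw [Matrix.sub_apply, abs_sub_comm]
  exact hk.le

variable [Fintype n]

theorem exists_pos_le_dotProduct_mulVec (hV : V.PosDef) :
    ∃ c : ℝ, 0 < c ∧ ∀ x, c * (x ⬝ᵥ x) ≤ x ⬝ᵥ (V *ᵥ x) := by
  classical
  rcases isEmpty_or_nonempty n with _ | _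
  · exact ⟨1, one_pos, fun x => by simp [dotProduct]⟩
  · obtain ⟨i, hi⟩ := Finite.exists_min hV.isHermitian.eigenvalues
    exact ⟨_, hV.eigenvalues_pos i, le_dotProduct_mulVec hV.isHermitian hi⟩

theorem exists_eventually_le_dotProduct_mulVec (hV : V.PosDef)
    (hM : Tendsto M l (𝓝 V)) :
    ∃ v₀ : ℝ, 0 < v₀ ∧ ∀ᶠ k in l, ∀ x, v₀ * (x ⬝ᵥ x) ≤ x ⬝ᵥ (M k *ᵥ x) := by
  obtain ⟨c, hc, hlow⟩ := exists_pos_le_dotProduct_mulVec hV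
  set d : ℝ := (Fintype.card n : ℝ)
  refine ⟨c / 2, half_pos hc, ?_⟩
  filter_upwards [eventually_abs_sub_le hM (show 0 < c / 2 / (d + 1) by positivity)] with k hk x
  have hx := dotProduct_self_nonneg x
  have hpert : |x ⬝ᵥ ((V - M k) *ᵥ x)| ≤ c / 2 * (x ⬝ᵥ x) :=
    calc _ ≤ c / 2 / (d + 1) * (√d * √(x ⬝ᵥ x)) * (√d * √(x ⬝ᵥ x)) :=
          abs_dotProduct_mulVec_le hk (by positivity) x x
      _ = d / (d + 1) * (c / 2 * (x ⬝ᵥ x)) := by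
          rw [mul_assoc, mul_mul_mul_comm, Real.mul_self_sqrt (by positivity),
            Real.mul_self_sqrt hx]
          ring
      _ ≤ 1 * (c / 2 * (x ⬝ᵥ x)) := by
          gcongr
          exact div_le_one_of_le₀ (by linarith) (by positivity)
      _ = _ := one_mul _
  rw [sub_mulVec, dotProduct_sub] at hpert
  linarith [hlow x, (abs_le.1 hpert).2]

end MatrixLimits

section BigOp

variable {Ω ι : Type*} [MeasurableSpace Ω] {P : Measure Ω} {l : Filter ι} {X : ι → Ω → ℝ}
  {a b : ι → ℝ}

theorem IsBigOp.ite (h : IsBigOp P l X a) {s : ι → Prop} [DecidablePred s] (hb : ∀ i, 0 ≤ b i)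
    (hab : ∀ i, s i → |a i| ≤ 2 * b i) :
    IsBigOp P l (fun i ω => if s i then X i ω else 0) b := by
  intro δ hδ
  obtain ⟨C, hC⟩ := h δ hδ
  refine ⟨2 * |C|, hC.mono fun i hi => (measure_mono fun ω hω => ?_).trans hi⟩
  simp only [Set.mem_ofPred_eq] at hω ⊢
  split_ifs at hω with hs
  · refine lt_of_le_of_lt ?_ hω
    calc C * a i ≤ |C| * |a i| := (le_abs_self _).trans_eq (abs_mul _ _)
      _ ≤ |C| * (2 * b i) := by gcongr; exact hab i hs
      _ = _ := by ring
  · have := mul_nonneg (abs_nonneg C) (hb i)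
    rw [abs_zero] at hω
    linarith

theorem IsBigOp.exists_add (ha : ∀ i, 0 ≤ a i) (hb : ∀ i, 0 ≤ b i)
    (h : IsBigOp P l X fun i => a i + b i) :
    ∃ R₁ R₂ : ι → Ω → ℝ, (∀ i ω, X i ω = R₁ i ω + R₂ i ω) ∧ IsBigOp P l R₁ a ∧
      IsBigOp P l R₂ b := by
  classical
  refine ⟨fun i ω => if b i ≤ a i then X i ω else 0, fun i ω => if a i < b i then X i ω else 0,
    fun i ω => ?_, h.ite ha fun i hi => ?_, h.ite hb fun i hi => ?_⟩
  · simp only [← not_le, ite_not]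
    split_ifs <;> simp
  all_goals
    rw [abs_of_nonneg (add_nonneg (ha i) (hb i))]
    linarith

end BigOp

section Rate

variable {C S : ℝ}

/-- The bound `2 (C / N + √(S / T))` for the residual part of the sample Kendall's tau matrix:
the first term is its mean, the second its sampling fluctuation. -/
def residualRate (C S : ℝ) (n : ℕ × ℕ) : ℝ := 2 * (C / n.1 + √(S / n.2))

theorem residualRate_nonneg (hC : 0 ≤ C) (n : ℕ × ℕ) : 0 ≤ residualRate C S n := by
  unfold residualRate
  positivity

theorem two_mul_add_le_residualRate_sq (hC : 0 ≤ C) (hS : 0 ≤ S) (n : ℕ × ℕ) :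
    2 * ((C / n.1) ^ 2 + S / n.2) ≤ residualRate C S n ^ 2 := by
  have hmean : 0 ≤ C / n.1 := by positivity
  have hsq : √(S / n.2) ^ 2 = S / n.2 := Real.sq_sqrt (by positivity)
  rw [residualRate]
  nlinarith [mul_nonneg hmean (Real.sqrt_nonneg (S / n.2)), sq_nonneg (C / n.1)]

theorem tendsto_residualRate (C S : ℝ) :
    Tendsto (residualRate C S) (atTop ×ˢ atTop) (𝓝 0) := by
  have hmean : Tendsto (fun n : ℕ × ℕ => C / (n.1 : ℝ)) (atTop ×ˢ atTop) (𝓝 0) :=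
    (tendsto_const_div_atTop_nhds_zero_nat C).comp tendsto_fst
  have hsampling : Tendsto (fun n : ℕ × ℕ => √(S / (n.2 : ℝ))) (atTop ×ˢ atTop) (𝓝 0) := by
    have hsqrt := (tendsto_const_div_atTop_nhds_zero_nat S).sqrt
    rw [Real.sqrt_zero] at hsqrt
    exact hsqrt.comp tendsto_snd
  have hsum := (hmean.add hsampling).const_mul 2
  rwa [add_zero, mul_zero] at hsum

theorem residualRate_mul_sqrt_le (hC : 0 ≤ C) (hS : 0 ≤ S) {n : ℕ × ℕ} (hn : 0 < n.1) :
    residualRate C S n * √n.1 ≤ 2 * (C + √S) *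
      ((n.1 : ℝ) ^ (-(1 / 2) : ℝ) + ((n.1 : ℝ) / (n.2 : ℝ)) ^ (1 / 2 : ℝ)) := by
  have : (0 : ℝ) < √n.1 := Real.sqrt_pos.2 (by exact_mod_cast hn)
  have hinv : (n.1 : ℝ) ^ (-(1 / 2) : ℝ) = (√n.1)⁻¹ := by
    rw [Real.rpow_neg n.1.cast_nonneg, Real.sqrt_eq_rpow]
  have hratio : ((n.1 : ℝ) / n.2) ^ (1 / 2 : ℝ) = √n.1 / √n.2 := by
    rw [← Real.sqrt_eq_rpow, Real.sqrt_div n.1.cast_nonneg]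
  have hmean : C / (n.1 : ℝ) * √n.1 = C * (√n.1)⁻¹ := by
    rw [div_mul_eq_mul_div, mul_div_assoc, Real.sqrt_div_self]
  rw [hinv, hratio]
  calc residualRate C S n * √n.1 = 2 * (C * (√n.1)⁻¹ + √S * (√n.1 / √n.2)) := by
        rw [residualRate, mul_assoc, add_mul, hmean, Real.sqrt_div hS]
        ring
    _ ≤ 2 * (C * (√n.1)⁻¹ + √S * (√n.1 / √n.2)) +
        2 * (C * (√n.1 / √n.2) + √S * (√n.1)⁻¹) := le_add_of_nonneg_right (by positivity)
    _ = _ := by ring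

end Rate

section Consistency

variable {Ω : Type*} [MeasurableSpace Ω] {P : Measure Ω} {m : ℕ}
  {Λ : (N : ℕ) → Matrix (Fin N) (Fin m) ℝ} {A : (N : ℕ) → Matrix (Fin N) (Fin N) ℝ}
  {V : Matrix (Fin m) (Fin m) ℝ} {X : (N : ℕ) → ℕ → Ω → ℝ × (Fin m ⊕ Fin N → ℝ)}
  {f : (N : ℕ) → ℕ → Ω → Fin m → ℝ} {y : (N : ℕ) → ℕ → Ω → Fin N → ℝ}
  {L : (N : ℕ) → ℕ → Ω → Matrix (Fin N) (Fin m) ℝ} {c C : ℝ}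

/-- Along `N, T → ∞`, with probability as close to one as desired, `L` is a loading estimate and
the spectral bounds hold with eigenvalue bound `c` and residual bound `2 (C / N + √(S / T))`,
where `S` may depend on the probability. -/
structure SpectralBoundsInProb (P : Measure Ω) (Λ : (N : ℕ) → Matrix (Fin N) (Fin m) ℝ)
    (f : (N : ℕ) → ℕ → Ω → Fin m → ℝ) (y : (N : ℕ) → ℕ → Ω → Fin N → ℝ)
    (L : (N : ℕ) → ℕ → Ω → Matrix (Fin N) (Fin m) ℝ) (c C : ℝ) : Prop where
  pos : 0 < c
  nonneg : 0 ≤ C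
  prob_le : ∀ δ : ℝ, 0 < δ → ∃ S : ℝ, 0 ≤ S ∧ ∀ᶠ n : ℕ × ℕ in atTop ×ˢ atTop,
    P {ω | ¬(IsRTSLoading n.2 (y n.1 · ω) (L n.1 n.2 ω) ∧
      SpectralBounds n.2 (Λ n.1) (f n.1 · ω) (y n.1 · ω) c (residualRate C S n))} ≤
        ENNReal.ofReal δ

theorem FactorSample.prob_not_spectralBounds_residualRate_le [IsProbabilityMeasure P] {N T p : ℕ}
    {B c₁ c₂ Q v₀ δ : ℝ} (h : FactorSample P (Λ N) (A N) (X N) (f N) (y N))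
    (hD : DesignBounds (Λ N) (A N) B c₁ c₂) (hQ₀ : 0 ≤ Q) (hQ : DesignMoments p (Λ N) (A N) Q)
    (hp : 6 ≤ p) (hN : 2 ≤ N) (hv₀ : 0 < v₀)
    (hlow : ∀ b, v₀ * (b ⬝ᵥ b) ≤ b ⬝ᵥ (((N : ℝ)⁻¹ • ((Λ N)ᵀ * Λ N)) *ᵥ b)) (hT : 2 ≤ T)
    (hδ : 0 < δ) (hTδ : 32 / ((signalBound B c₁ v₀ / 2) ^ 2 * δ) ≤ T) :
    P {ω | ¬SpectralBounds T (Λ N) (f N · ω) (y N · ω) (signalBound B c₁ v₀ / 2)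
      (residualRate (4 * m * (1 + 6 * Q) + (1 + 3 * Q))
        (32 * (2 + 2 * (B ^ 2 * m * (m * (1 + 6 * Q)))) / δ) (N, T))} ≤ ENNReal.ofReal δ := by
  have hNpos : (0 : ℝ) < N := by exact_mod_cast (by omega : 0 < N)
  have : (0 : ℝ) < T := by exact_mod_cast (by omega : 0 < T)
  have hc := half_pos (hD.signalBound_pos hv₀)
  have hq : 0 < 2 + 2 * (B ^ 2 * m * (m * (1 + 6 * Q))) := by positivity
  have hlow' (b : Fin m → ℝ) : N * v₀ * (b ⬝ᵥ b) ≤ (Λ N *ᵥ b) ⬝ᵥ (Λ N *ᵥ b) := by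
    have hgram := hlow b
    rw [smul_mulVec, dotProduct_smul, smul_eq_mul, ← mulVec_mulVec,
      ← transpose_mulVec_dotProduct, transpose_transpose, le_inv_mul_iff₀ hNpos] at hgram
    linarith
  refine (h.prob_not_spectralBounds_le hD hQ hp hN hv₀ hlow' hT (by positivity)
    (residualRate_nonneg (by positivity) _)
    (two_mul_add_le_residualRate_sq (by positivity) (by positivity) (N, T))).trans ?_
  rw [← ENNReal.ofReal_add (by positivity) (by positivity)]
  refine ENNReal.ofReal_le_ofReal ?_
  generalize 2 + 2 * (B ^ 2 * m * (m * (1 + 6 * Q))) = q at hq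
  generalize signalBound B c₁ v₀ / 2 = c at hc hTδ
  have hkendall : 16 * 1 / (T * c ^ 2) ≤ δ / 2 := by
    rw [div_le_iff₀ (by positivity)] at hTδ ⊢
    linarith
  have hresidual : 16 * q / (T * (32 * q / δ / T)) = δ / 2 := by
    field_simp
    norm_num
  linarith

theorem exists_spectralBoundsInProb [IsProbabilityMeasure P]
    (hX : ∀ N, 1 ≤ N → FactorSample P (Λ N) (A N) (X N) (f N) (y N))
    (hΛ : ∃ C : ℝ, ∀ N i, l2norm (Λ N i) ≤ C)
    (hlim : Tendsto (fun N : ℕ => (N : ℝ)⁻¹ • ((Λ N)ᵀ * Λ N)) atTop (𝓝 V)) (hV : V.PosDef)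
    (hA : NoiseAssumption A)
    (hL : ∀ N T, m ≤ N → 2 ≤ T → ∀ᵐ ω ∂P, IsRTSLoading T (y N · ω) (L N T ω)) :
    ∃ c C : ℝ, SpectralBoundsInProb P Λ f y L c C := by
  obtain ⟨B, c₁, c₂, hD⟩ := exists_designBounds hΛ hA
  obtain ⟨Q, hQ₀, hQ⟩ := exists_designMoments (p := 6) (by norm_num) B c₁ c₂
  obtain ⟨v₀, hv₀, hlow⟩ := exists_eventually_le_dotProduct_mulVec hV hlim
  have hc := half_pos ((hD 0).signalBound_pos hv₀)
  refine ⟨signalBound B c₁ v₀ / 2, 4 * m * (1 + 6 * Q) + (1 + 3 * Q), hc, by positivity,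
    fun δ hδ => ⟨32 * (2 + 2 * (B ^ 2 * m * (m * (1 + 6 * Q)))) / δ, by positivity, ?_⟩⟩
  have hN := (eventually_ge_atTop 24).and ((eventually_ge_atTop m).and hlow)
  have hT := (eventually_ge_atTop 2).and
    ((tendsto_natCast_atTop_atTop (R := ℝ)).eventually_ge_atTop
      (32 / ((signalBound B c₁ v₀ / 2) ^ 2 * δ)))
  filter_upwards [hN.prod_mk hT] with ⟨N, T⟩ ⟨⟨hN, hmN, hlowN⟩, hT, hTδ⟩
  have hspectral := (hX N (by omega)).prob_not_spectralBounds_residualRate_le (hD N) hQ₀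
    (hQ m N _ _ hN (hD N)) le_rfl (by omega) hv₀ hlowN hT hδ hTδ
  have hloading : P {ω | ¬IsRTSLoading T (y N · ω) (L N T ω)} = 0 := hL N T hmN hT
  refine (measure_mono fun ω hω => not_and_or.1 hω).trans ((measure_union_le _ _).trans ?_)
  exact (add_le_add hloading.le hspectral).trans_eq (zero_add _)

theorem SpectralBoundsInProb.isBigOp_maxError (h : SpectralBoundsInProb P Λ f y L c C) :
    IsBigOp P (atTop ×ˢ atTop) (fun (n : ℕ × ℕ) ω => maxError (L n.1 n.2 ω) (Λ n.1)
      (rotation n.2 (Λ n.1) (f n.1 · ω) (y n.1 · ω) (L n.1 n.2 ω)))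
      fun n => (n.1 : ℝ) ^ (-(1 / 2) : ℝ) + ((n.1 : ℝ) / (n.2 : ℝ)) ^ (1 / 2 : ℝ) := by
  intro δ hδ
  obtain ⟨S, hS, hprob⟩ := h.prob_le δ hδ
  have hc := h.pos
  refine ⟨√m / c * (2 * (C + √S)), ?_⟩
  filter_upwards [hprob, tendsto_fst.eventually (eventually_gt_atTop 0)] with n hn hN
  refine (measure_mono fun ω hω hgood => ?_).trans hn
  rw [Set.mem_ofPred_eq, abs_of_nonneg (maxError_nonneg _ _ _)] at hω
  refine hω.not_ge ?_
  calc _ ≤ √m * (residualRate C S n / c * √n.1) := hgood.1.maxError_le hgood.2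
    _ = √m / c * (residualRate C S n * √n.1) := by ring
    _ ≤ √m / c * (2 * (C + √S) *
        ((n.1 : ℝ) ^ (-(1 / 2) : ℝ) + ((n.1 : ℝ) / (n.2 : ℝ)) ^ (1 / 2 : ℝ))) :=
      mul_le_mul_of_nonneg_left (residualRate_mul_sqrt_le h.nonneg hS hN) (by positivity)
    _ = _ := (mul_assoc _ _ _).symm

theorem SpectralBoundsInProb.tendstoInMeasure_rotation (h : SpectralBoundsInProb P Λ f y L c C)
    (hlim : Tendsto (fun N : ℕ => (N : ℝ)⁻¹ • ((Λ N)ᵀ * Λ N)) atTop (𝓝 V)) (hV : V.PosDef)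
    (i j : Fin m) :
    TendstoInMeasure P (fun (n : ℕ × ℕ) ω =>
      ((rotation n.2 (Λ n.1) (f n.1 · ω) (y n.1 · ω) (L n.1 n.2 ω))ᵀ * V *
        rotation n.2 (Λ n.1) (f n.1 · ω) (y n.1 · ω) (L n.1 n.2 ω)) i j)
      (atTop ×ˢ atTop) (fun _ => (1 : Matrix (Fin m) (Fin m) ℝ) i j) := by
  obtain ⟨v₀, hv₀, hlow⟩ := exists_eventually_le_dotProduct_mulVec hV hlim
  have hc := h.pos
  rw [tendstoInMeasure_iff_norm]
  intro ε hε
  refine ENNReal.tendsto_nhds_zero.2 fun δ hδ => ?_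
  obtain ⟨δ', hδ'₀, hδ'⟩ := ENNReal.lt_iff_exists_nnreal_btwn.1 hδ
  obtain ⟨S, _, hprob⟩ := h.prob_le δ' (by exact_mod_cast hδ'₀)
  rw [ENNReal.ofReal_coe_nnreal] at hprob
  set ε' : ℝ := ε / 2 / ((m + 1) * (4 / v₀)) with hε'
  have hgram : ε' * m * (4 / v₀) ≤ ε / 2 :=
    calc ε' * m * (4 / v₀) ≤ ε' * (m + 1) * (4 / v₀) := by gcongr; linarith
      _ = ε / 2 := by rw [hε']; field_simp
  have hrate : ∀ᶠ n in atTop ×ˢ atTop, residualRate C S n < min c (ε * c / 6) :=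
    (tendsto_residualRate C S).eventually_lt_const (by positivity)
  filter_upwards [hprob, hrate, tendsto_fst.eventually (eventually_gt_atTop 0),
    tendsto_fst.eventually hlow, tendsto_fst.eventually
      (eventually_abs_sub_le hlim (show 0 < ε' by positivity))] with n hn hΔ hN hlowN hVN
  refine (measure_mono fun ω hω hgood => ?_).trans (hn.trans hδ'.le)
  have hdist := hgood.1.abs_rotation_sub_one_le hgood.2 hN (hΔ.le.trans (min_le_left _ _)) hv₀
    hlowN (show 0 ≤ ε' by positivity) hVN i j
  have hsmall : 3 * (residualRate C S n / c) < ε / 2 := by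
    have hΔ' := hΔ.trans_le (min_le_right _ _)
    rw [← mul_div_assoc, div_lt_iff₀ hc]
    linarith
  exact absurd hdist (not_le.2 ((add_lt_add_of_lt_of_le hsmall hgram).trans_le
    ((add_halves ε).trans_le hω)))

end Consistency

section Model

variable {Ω : Type*} [MeasurableSpace Ω] {P : Measure Ω} {m N : ℕ}
  {Λ : (N : ℕ) → Matrix (Fin N) (Fin m) ℝ} {A : (N : ℕ) → Matrix (Fin N) (Fin N) ℝ}
  {ξ : ℕ → ℕ → Ω → ℝ} {g : (N : ℕ) → ℕ → Ω → Fin m ⊕ Fin N → ℝ}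
  {f : (N : ℕ) → ℕ → Ω → Fin m → ℝ} {e y : (N : ℕ) → ℕ → Ω → Fin N → ℝ}

theorem EllipticalFactorModel.sum_elim_eq (h : EllipticalFactorModel P m Λ A ξ g f e y) (t : ℕ)
    (ω : Ω) : Sum.elim (f N t ω) (e N t ω) =
      Sum.elim (radialDirection (ξ N t ω, g N t ω) ∘ Sum.inl)
        (idio (A N) (radialDirection (ξ N t ω, g N t ω))) := by
  rw [h.representation, ← mulVec_smul, fromBlocks_mulVec]
  simp only [one_mulVec, zero_mulVec, add_zero, zero_add]
  rfl

theorem EllipticalFactorModel.factorSample (h : EllipticalFactorModel P m Λ A ξ g f e y)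
    (hN : 1 ≤ N) :
    FactorSample P (Λ N) (A N) (fun t ω => (ξ N t ω, g N t ω)) (f N) (y N) where
  measurable t := (h.measurable_radius N t).prodMk (h.measurable_gaussian N t)
  indep := h.indep_time N
  indep_radius := h.indep_radius N
  gaussian_law := h.gaussian_law N
  radius_ne_zero t := (h.identDistrib_radius N t).symm.ae_snd
    (measurableSet_singleton (0 : ℝ)).compl (h.radius_ne_zero N hN)
  factor_eq t ω := congrArg (· ∘ Sum.inl) (h.sum_elim_eq t ω)
  observation_eq t ω := by
    have hfactor := congrArg (· ∘ Sum.inl) (h.sum_elim_eq (N := N) t ω)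
    have hnoise := congrArg (· ∘ Sum.inr) (h.sum_elim_eq (N := N) t ω)
    simp only [Sum.elim_comp_inl, Sum.elim_comp_inr] at hfactor hnoise
    rw [h.observation, hfactor, hnoise]
    rfl

end Model

end RTS

end

theorem proposition2_general {Ω : Type*} [MeasurableSpace Ω] (P : Measure Ω)
    [IsProbabilityMeasure P] (m : ℕ) (Λ : (N : ℕ) → Matrix (Fin N) (Fin m) ℝ)
    (A : (N : ℕ) → Matrix (Fin N) (Fin N) ℝ) (V : Matrix (Fin m) (Fin m) ℝ)
    (X : (N : ℕ) → ℕ → Ω → ℝ × (Fin m ⊕ Fin N → ℝ))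
    (f : (N : ℕ) → ℕ → Ω → Fin m → ℝ) (y : (N : ℕ) → ℕ → Ω → Fin N → ℝ)
    (hModel : ∀ N, 1 ≤ N → RTS.FactorSample P (Λ N) (A N) (X N) (f N) (y N))
    (hBounded : ∃ C : ℝ, ∀ N i, RTS.l2norm (Λ N i) ≤ C)
    (hLimit : Tendsto (fun N : ℕ => (N : ℝ)⁻¹ • ((Λ N)ᵀ * Λ N)) atTop (𝓝 V))
    (hV : V.PosDef)
    (hNoise : RTS.NoiseAssumption A)
    (L : (N : ℕ) → ℕ → Ω → Matrix (Fin N) (Fin m) ℝ)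
    (hL : ∀ N T, m ≤ N → 2 ≤ T → ∀ᵐ ω ∂P, RTS.IsRTSLoading T (fun t => y N t ω) (L N T ω))
    (H : ℕ → ℕ → Ω → Matrix (Fin m) (Fin m) ℝ)
    (hH : ∀ N T ω, H N T ω =
      RTS.rotation T (Λ N) (fun t => f N t ω) (fun t => y N t ω) (L N T ω)) :
    (∀ i j, TendstoInMeasure P
      (fun (n : ℕ × ℕ) ω => ((H n.1 n.2 ω)ᵀ * V * H n.1 n.2 ω) i j)
      (atTop ×ˢ atTop) (fun _ => (1 : Matrix (Fin m) (Fin m) ℝ) i j)) ∧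
    ∃ R₁ R₂ : ℕ × ℕ → Ω → ℝ,
      (∀ N T ω, RTS.maxError (L N T ω) (Λ N) (H N T ω) = R₁ (N, T) ω + R₂ (N, T) ω) ∧
      RTS.IsBigOp P (atTop ×ˢ atTop) R₁ (fun n => (n.1 : ℝ) ^ (-(1 / 2) : ℝ)) ∧
      RTS.IsBigOp P (atTop ×ˢ atTop) R₂ (fun n => ((n.1 : ℝ) / (n.2 : ℝ)) ^ (1 / 2 : ℝ)) := by
  simp only [hH]
  obtain ⟨c, C, hspectral⟩ :=
    RTS.exists_spectralBoundsInProb hModel hBounded hLimit hV hNoise hL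
  refine ⟨hspectral.tendstoInMeasure_rotation hLimit hV, ?_⟩
  obtain ⟨R₁, R₂, hsum, h₁, h₂⟩ := hspectral.isBigOp_maxError.exists_add
    (fun _ => by positivity) (fun _ => by positivity)
  exact ⟨R₁, R₂, fun N T => hsum (N, T), h₁, h₂⟩

theorem proposition2 {Ω : Type*} [MeasurableSpace Ω] (P : Measure Ω) [IsProbabilityMeasure P]
    (m : ℕ) (Λ : (N : ℕ) → Matrix (Fin N) (Fin m) ℝ) (A : (N : ℕ) → Matrix (Fin N) (Fin N) ℝ)
    (V : Matrix (Fin m) (Fin m) ℝ)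
    (ξ : ℕ → ℕ → Ω → ℝ) (g : (N : ℕ) → ℕ → Ω → Fin m ⊕ Fin N → ℝ)
    (f : (N : ℕ) → ℕ → Ω → Fin m → ℝ) (e y : (N : ℕ) → ℕ → Ω → Fin N → ℝ)
    (hModel : RTS.EllipticalFactorModel P m Λ A ξ g f e y)
    (hLoading : RTS.LoadingAssumption Λ V)
    (hNoise : RTS.NoiseAssumption A)
    (L : (N : ℕ) → ℕ → Ω → Matrix (Fin N) (Fin m) ℝ)
    (hL : ∀ N T, m ≤ N → 2 ≤ T → ∀ᵐ ω ∂P, RTS.IsRTSLoading T (fun t => y N t ω) (L N T ω))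
    (H : ℕ → ℕ → Ω → Matrix (Fin m) (Fin m) ℝ)
    (hH : ∀ N T ω, H N T ω =
      RTS.rotation T (Λ N) (fun t => f N t ω) (fun t => y N t ω) (L N T ω)) :
    (∀ i j, TendstoInMeasure P
      (fun (n : ℕ × ℕ) ω => ((H n.1 n.2 ω)ᵀ * V * H n.1 n.2 ω) i j)
      (atTop ×ˢ atTop) (fun _ => (1 : Matrix (Fin m) (Fin m) ℝ) i j)) ∧
    ∃ R₁ R₂ : ℕ × ℕ → Ω → ℝ,
      (∀ N T ω, RTS.maxError (L N T ω) (Λ N) (H N T ω) = R₁ (N, T) ω + R₂ (N, T) ω) ∧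
      RTS.IsBigOp P (atTop ×ˢ atTop) R₁ (fun n => (n.1 : ℝ) ^ (-(1 / 2) : ℝ)) ∧
      RTS.IsBigOp P (atTop ×ˢ atTop) R₂ (fun n => ((n.1 : ℝ) / (n.2 : ℝ)) ^ (1 / 2 : ℝ)) :=
  proposition2_general P m Λ A V _ f y (fun _ => hModel.factorSample) hLoading.bounded
    hLoading.limit hLoading.posDef hNoise L hL H hH
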